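/- **Notation.** Let $V_n$ be the space of complex binary forms of degree $n$, on which $SL_2=SL_2(\mathbb C)$ acts by $(A\cdot f)(u,v)=f(A^{-1}(u,v)^T)$. Identify $\mathbb P^3$ with the projectivization of the space of complex $2\times2$ matrices and $\mathbb P^6$ with $\mathbb P(V_6)$, with coordinates $[a_0:\dots:a_6]$ for $f=\sum_i\sqrt{\binom 6i}\,a_iu^{6-i}v^i$. Let $f_1:\mathbb P^3\dashrightarrow\mathbb P^6$ be the rational map $[A]\mapsto[A\cdot uv(u^4-v^4)]$, extended from $SL_2$ to all matrices by forms of degree $6$ in the entries (use the adjugate of $A$ in place of $A^{-1}$). Let $\mathcal V_5=\overline{PSL_2\cdot uv(u^4-v^4)}\subset\mathbb P^6$ be the Fano threefold. A *sextic curve* is a morphism $F:\mathbb P^1\to\mathcal V_5\subset\mathbb P^6$ of degree $6$. Let $S_4^*\subset SU(2)$ be the binary octahedral group, generated by $\mathrm{diag}(\xi,\xi^{-1})$, $\xi=e^{2\pi i/8}$, and $\frac1{\sqrt2}\begin{pmatrix}1&-1\\1&1\end{pmatrix}$. Let $\varphi:\mathbb P^1\to\mathbb P^1$ be a branched Galois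 covering of degree $d\ge1$, that is, a morphism of degree $d$ whose group of covering transformations $G=\{\sigma\in\mathrm{Aut}(\mathbb P^1):\varphi\circ\sigma=\varphi\}$ has order $d$, and assume $G\subset SO(3)=SU(2)/\{\pm1\}$. Let $G^*\subset SU(2)$ be the preimage of $G$. For a homomorphism $\phi_2:G^*\to S_4^*$, let $G^*$ act on $V_n\otimes\mathbb C^2$ by the inclusion $G^*\subset SL_2$ on $V_n$ and through $\phi_2$ on $\mathbb C^2$; writing $(p,q)$ for $p\otimes e_1+q\otimes e_2$, this is $t\cdot(p,q)=(t\cdot p,\,t\cdot q)\,\phi_2(t)^T$. For morphisms $g:\mathbb P^1\to\mathbb P^3$ and $F:\mathbb P^1\to\mathbb P^6$ consider the diagram $$F\circ\varphi=f_1\circ g,\qquad(\ast)$$ which means that the image of $g$ is not contained in the indeterminacy locus of $f_1$ and that equality holds wherever $f_1\circ g$ is defined. **Theorem.** Let $n\ge0$. 1. Let $F$ be a sextic curve not contained in the closed $2$-dimensional orbit $\overline{PSL_2\cdot u^5v}$, and let $g=\begin{bmatrix}a&b\\c&e\end{bmatrix}:\mathbb P^1\to\mathbb P^3$ be a rational Galois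 lift of $F$ of degree $n$: $a,b,c,e\in V_n$ have no common zero, $(\ast)$ holds, and $G$ is realized faithfully on $g$ (if $\sigma\in G$ and $g\circ\sigma=g$, then $\sigma=1$). Then there is an injective homomorphism $\phi_2:G^*\to S_4^*$ such that, for the corresponding action of $G^*$ on $V_n\otimes\mathbb C^2$, the rows $(a,b)$ and $(c,e)$ of $g$ are linearly independent and the lines that they span are $1$-dimensional irreducible subrepresentations isomorphic to each other. 2. Conversely, let $\phi_2:G^*\to S_4^*$ be a homomorphism, let $W$ be a $1$-dimensional representation of $G^*$, and let $kW$ ($k\ge2$) be the $W$-isotypic component of $V_n\otimes\mathbb C^2$, the sum of all subrepresentations isomorphic to $W$. Let $(a,b),(c,e)\in kW$ be linearly independent and such that $f_1\begin{pmatrix}a&b\\c&e\end{pmatrix}$ does not vanish identically. Let $g:\mathbb P^1\to\mathbb P^3$ be the morphism induced by $\begin{pmatrix}a&b\\c&e\end{pmatrix}$ (after common factors of the four forms are removed). Then there is a unique morphism $F:\mathbb P^1\to\mathbb P^6$ such that $(\ast)$ holds. -/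

import Mathlib

open scoped LinearAlgebra.Projectivization TensorProduct MatrixGroups

noncomputable section

namespace GaloisLift

/-- The complex projective line. -/
abbrev P1 : Type := ℙ ℂ (Fin 2 → ℂ)

/-- Projective `3`-space, as the projectivization of the space of `2 × 2` matrices. -/
abbrev P3 : Type := ℙ ℂ (Matrix (Fin 2) (Fin 2) ℂ)

/-- Projective `6`-space with homogeneous coordinates `[a₀ : ⋯ : a₆]`. -/
abbrev P6 : Type := ℙ ℂ (Fin 7 → ℂ)

/-- The usual (quotient) topology of `P6`. -/
instance : TopologicalSpace P6 :=
  TopologicalSpace.coinduced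
    (fun v : {v : Fin 7 → ℂ // v ≠ 0} => Projectivization.mk ℂ v.1 v.2) inferInstance

/-! ### Binary forms -/

/-- `V n`: the binary forms of degree `n`. -/
abbrev V (n : ℕ) : Submodule ℂ (MvPolynomial (Fin 2) ℂ) :=
  MvPolynomial.homogeneousSubmodule (Fin 2) ℂ n

/-- The linear substitution `f ↦ f (B (u, v)ᵀ)`. -/
def subst (B : Matrix (Fin 2) (Fin 2) ℂ) :
    MvPolynomial (Fin 2) ℂ →ₐ[ℂ] MvPolynomial (Fin 2) ℂ :=
  MvPolynomial.aeval fun i => ∑ j, MvPolynomial.C (B i j) * MvPolynomial.X j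

theorem subst_one : subst 1 = AlgHom.id ℂ _ := by
  ext i : 1
  simp [subst, Matrix.one_apply]

theorem subst_mul (A B : Matrix (Fin 2) (Fin 2) ℂ) :
    subst (A * B) = (subst B).comp (subst A) := by
  ext i : 1
  simp only [subst, MvPolynomial.aeval_X, AlgHom.comp_apply, map_mul,
    Matrix.mul_apply, Fin.sum_univ_two, map_add, MvPolynomial.algHom_C,
    MvPolynomial.algebraMap_eq]
  ring

theorem subst_mem (B : Matrix (Fin 2) (Fin 2) ℂ) {n : ℕ} {f : MvPolynomial (Fin 2) ℂ}
    (hf : f ∈ V n) : subst B f ∈ V n := by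
  rw [MvPolynomial.mem_homogeneousSubmodule] at hf ⊢
  have h := hf.aeval (fun i => ∑ j, MvPolynomial.C (B i j) * MvPolynomial.X j) (n := 1)
    fun i => MvPolynomial.IsHomogeneous.sum _ _ _ fun j _ => by
      simpa using (MvPolynomial.isHomogeneous_C (Fin 2) (B i j)).mul
        (MvPolynomial.isHomogeneous_X ℂ j)
  simpa [subst] using h

/-- The action of `SL₂` on binary forms of degree `n`, `(A · f)(u, v) = f (A⁻¹ (u, v)ᵀ)`. -/
def formRep (n : ℕ) : Representation ℂ SL(2, ℂ) (V n) where
  toFun A := (subst (A⁻¹ : SL(2, ℂ)).1).toLinearMap.restrict fun _ hf => subst_mem _ hf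
  map_one' := by
    ext f : 2
    simp [subst_one]
  map_mul' A B := by
    ext f : 2
    simp [mul_inv_rev, subst_mul]

/-- The standard representation of `SL₂` on column vectors. -/
def stdRep : Representation ℂ SL(2, ℂ) (Fin 2 → ℂ) where
  toFun A := Matrix.toLin' A.1
  map_one' := by simp; rfl
  map_mul' A B := by simp [Matrix.toLin'_mul]; rfl

/-! ### Morphisms from the projective line -/

/-- `F : P1 → ℙ(E)` is a morphism of degree `m`: in homogeneous coordinates it is given by binary
forms of degree `m` without common zeros. -/
def IsMorphismOfDegree {E : Type*} [AddCommGroup E] [Module ℂ E] (m : ℕ) (F : P1 → ℙ ℂ E) :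
    Prop :=
  ∃ Φ : (Fin 2 → ℂ) → E,
    (∀ ℓ : Module.Dual ℂ E, ∃ p ∈ V m, ∀ x, ℓ (Φ x) = MvPolynomial.eval x p) ∧
    ∀ (x : Fin 2 → ℂ) (hx : x ≠ 0), ∃ h : Φ x ≠ 0,
      F (Projectivization.mk ℂ x hx) = Projectivization.mk ℂ (Φ x) h

/-- A (parametrized rational) curve in `ℙ(E)`. -/
def IsCurve {E : Type*} [AddCommGroup E] [Module ℂ E] (F : P1 → ℙ ℂ E) : Prop :=
  ∃ m, IsMorphismOfDegree m F

/-! ### Galois coverings of the projective line -/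

/-- The action of `SL₂` on the projective line. Its range is `Aut(P1) = PSL₂`. -/
def moebius : SL(2, ℂ) →* Equiv.Perm P1 :=
  MulAction.toPermHom SL(2, ℂ) P1

/-- `SU(2)` as a subgroup of `SL₂`. -/
def SU2 : Subgroup SL(2, ℂ) where
  carrier := {A | A.1 ∈ Matrix.unitaryGroup (Fin 2) ℂ}
  one_mem' := by simp
  mul_mem' hA hB := by simpa using mul_mem hA hB
  inv_mem' {A} hA := by
    have h : (A⁻¹ : SL(2, ℂ)).1 = star A.1 := by
      have h1 : star A.1 * A.1 = 1 := (Matrix.mem_unitaryGroup_iff').1 hA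
      have h2 : A.1 * (A⁻¹ : SL(2, ℂ)).1 = 1 := by
        rw [← Matrix.SpecialLinearGroup.coe_mul]; simp
      exact (left_inv_eq_right_inv h1 h2).symm
    change (A⁻¹ : SL(2, ℂ)).1 ∈ Matrix.unitaryGroup (Fin 2) ℂ
    rw [h]
    exact Unitary.star_mem hA

/-- `SO(3) = SU(2) / {± 1}`, as the group of rotations of the Riemann sphere. -/
def SO3 : Subgroup (Equiv.Perm P1) :=
  SU2.map moebius

/-- The group of covering transformations `{σ ∈ Aut(P1) | φ ∘ σ = φ}`. -/
def deckGroup (φ : P1 → P1) : Subgroup (Equiv.Perm P1) where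
  carrier := {σ | σ ∈ moebius.range ∧ ∀ p, φ (σ p) = φ p}
  one_mem' := ⟨one_mem _, fun _ => rfl⟩
  mul_mem' hσ hτ := ⟨mul_mem hσ.1 hτ.1, fun p => by
    rw [Equiv.Perm.mul_apply, hσ.2, hτ.2]⟩
  inv_mem' {σ} hσ := ⟨inv_mem hσ.1, fun p => by
    rw [← hσ.2 (σ⁻¹ p)]; simp⟩

/-- `φ` is a branched Galois covering of degree `d`: a morphism of degree `d ≥ 1` with exactly `d`
covering transformations. -/
def IsGaloisCovering (d : ℕ) (φ : P1 → P1) : Prop :=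
  0 < d ∧ IsMorphismOfDegree d φ ∧ Nat.card (deckGroup φ) = d

/-- The binary group `G* ⊂ SU(2)` associated with a subgroup `G` of `SO(3)`: the preimage of `G`
under `SU(2) → SO(3)`. -/
def binaryGroup (G : Subgroup (Equiv.Perm P1)) : Subgroup SL(2, ℂ) :=
  SU2 ⊓ G.comap moebius

/-! ### The Fano threefold `V₅` and the map `f₁` -/

/-- The coordinates `(a₀, …, a₆)` of a binary sextic `f = ∑ √(6 choose i) aᵢ u^(6-i) v^i`. -/
def sexticCoord (f : MvPolynomial (Fin 2) ℂ) : Fin 7 → ℂ := fun i =>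
  MvPolynomial.coeff (Finsupp.single 0 (6 - (i : ℕ)) + Finsupp.single 1 (i : ℕ)) f /
    (Real.sqrt (Nat.choose 6 i) : ℂ)

/-- The `PSL₂`-orbit of `[f]` in `ℙ(V₆) = P6`. -/
def orbit (f : V 6) : Set P6 :=
  {p | ∃ (A : SL(2, ℂ)) (h : sexticCoord (formRep 6 A f) ≠ 0),
    p = Projectivization.mk ℂ (sexticCoord (formRep 6 A f)) h}

/-- The binary sextic `u v (u⁴ - v⁴)`. -/
def octahedralForm : V 6 :=
  ⟨MvPolynomial.X 0 * MvPolynomial.X 1 * (MvPolynomial.X 0 ^ 4 - MvPolynomial.X 1 ^ 4), by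
    rw [MvPolynomial.mem_homogeneousSubmodule]
    exact ((MvPolynomial.isHomogeneous_X ℂ 0).mul (MvPolynomial.isHomogeneous_X ℂ 1)).mul
      (((MvPolynomial.isHomogeneous_X ℂ 0).pow 4).sub ((MvPolynomial.isHomogeneous_X ℂ 1).pow 4))⟩

/-- The binary sextic `u⁵ v`. -/
def tangentForm : V 6 :=
  ⟨MvPolynomial.X 0 ^ 5 * MvPolynomial.X 1, by
    rw [MvPolynomial.mem_homogeneousSubmodule]
    exact ((MvPolynomial.isHomogeneous_X ℂ 0).pow 5).mul (MvPolynomial.isHomogeneous_X ℂ 1)⟩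

/-- The Fano threefold `V₅`, the closure of `PSL₂ · uv(u⁴ - v⁴)`. -/
def fanoV5 : Set P6 := closure (orbit octahedralForm)

/-- The closed two-dimensional orbit, the closure of `PSL₂ · u⁵v`. -/
def closedTwoDimOrbit : Set P6 := closure (orbit tangentForm)

/-- A sextic curve in `V₅`. -/
def IsSexticCurve (F : P1 → P6) : Prop :=
  IsMorphismOfDegree 6 F ∧ ∀ p, F p ∈ fanoV5

/-- The rational map `f₁ : P3 ⇢ P6`, `[A] ↦ [A · uv(u⁴ - v⁴)]`, in homogeneous coordinates. It is
extended from `SL₂` to all matrices by writing the adjugate in place of the inverse, so that its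
components are forms of degree `6` in the entries of `A`; it is defined at `[A]` when
`f₁ A ≠ 0`. -/
def f₁ (A : Matrix (Fin 2) (Fin 2) ℂ) : Fin 7 → ℂ :=
  sexticCoord (subst A.adjugate octahedralForm.1)

theorem f₁_coe (A : SL(2, ℂ)) : f₁ A.1 = sexticCoord (formRep 6 A octahedralForm) := by
  simp [f₁, formRep, Matrix.SpecialLinearGroup.coe_inv]

/-- The square with sides `g`, `f₁`, `φ`, `F` commutes: the composite `f₁ ∘ g` exists (the image
of `g` is not contained in the indeterminacy locus of `f₁`), and `F ∘ φ = f₁ ∘ g` at every point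
at which `f₁ ∘ g` is defined. -/
def Commutes (φ : P1 → P1) (g : P1 → P3) (F : P1 → P6) : Prop :=
  (∃ (p : P1) (A : Matrix (Fin 2) (Fin 2) ℂ) (hA : A ≠ 0),
    g p = Projectivization.mk ℂ A hA ∧ f₁ A ≠ 0) ∧
  ∀ (p : P1) (A : Matrix (Fin 2) (Fin 2) ℂ) (hA : A ≠ 0), g p = Projectivization.mk ℂ A hA →
    ∀ h : f₁ A ≠ 0, F (φ p) = Projectivization.mk ℂ (f₁ A) h

/-- `g` is a rational Galois lift of `F` with Galois covering `φ`: the square commutes, and the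
covering group is realized faithfully on `g`, that is, only the trivial covering transformation
`σ` satisfies `g ∘ σ = g`. -/
def IsGaloisLift (φ : P1 → P1) (g : P1 → P3) (F : P1 → P6) : Prop :=
  Commutes φ g F ∧ ∀ σ ∈ deckGroup φ, (∀ p, g (σ p) = g p) → σ = 1

/-- The value at `x` of the matrix of binary forms with rows `(a, b)` and `(c, e)`. -/
def formMatrix {n : ℕ} (a b c e : V n) (x : Fin 2 → ℂ) : Matrix (Fin 2) (Fin 2) ℂ :=
  !![MvPolynomial.eval x a.1, MvPolynomial.eval x b.1;
     MvPolynomial.eval x c.1, MvPolynomial.eval x e.1]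

/-- `g : P1 → P3` is the morphism of degree `n` given by the matrix of binary forms of degree `n`
with rows `(a, b)` and `(c, e)`; in particular the four forms have no common zero. -/
def IsGivenBy {n : ℕ} (g : P1 → P3) (a b c e : V n) : Prop :=
  ∀ (x : Fin 2 → ℂ) (hx : x ≠ 0), ∃ h : formMatrix a b c e x ≠ 0,
    g (Projectivization.mk ℂ x hx) = Projectivization.mk ℂ (formMatrix a b c e x) h

/-- `g : P1 → P3` is the curve induced by the matrix of binary forms with rows `(a, b)` and
`(c, e)`, which may have common zeros: the morphism that agrees with the matrix wherever the
matrix does not vanish. -/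
def IsInducedBy {n : ℕ} (g : P1 → P3) (a b c e : V n) : Prop :=
  IsCurve g ∧ ∀ (x : Fin 2 → ℂ) (hx : x ≠ 0) (h : formMatrix a b c e x ≠ 0),
    g (Projectivization.mk ℂ x hx) = Projectivization.mk ℂ (formMatrix a b c e x) h

/-! ### Representations of the binary groups -/

/-- The matrix `T₁₁ = diag(ξ, ξ⁻¹)`, `ξ = exp(2πi/8)`. -/
def T₁₁ : SL(2, ℂ) :=
  ⟨!![Complex.exp (2 * Real.pi * Complex.I / 8), 0;
      0, (Complex.exp (2 * Real.pi * Complex.I / 8))⁻¹], by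
    simp [Matrix.det_fin_two, Complex.exp_ne_zero]⟩

/-- The matrix `T₃₀ = (1/√2) (1, -1; 1, 1)`. -/
def T₃₀ : SL(2, ℂ) :=
  ⟨!![(Real.sqrt 2 : ℂ)⁻¹, -(Real.sqrt 2 : ℂ)⁻¹; (Real.sqrt 2 : ℂ)⁻¹, (Real.sqrt 2 : ℂ)⁻¹], by
    have h : (Real.sqrt 2 : ℂ) * (Real.sqrt 2 : ℂ) = 2 := by
      rw [← Complex.ofReal_mul, Real.mul_self_sqrt (by norm_num)]; norm_num
    rw [Matrix.det_fin_two_of, neg_mul, sub_neg_eq_add, ← mul_inv, h]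
    norm_num⟩

/-- The binary octahedral group `S₄* ⊂ SU(2)`, of order `48`. -/
def binaryOctahedral : Subgroup SL(2, ℂ) :=
  Subgroup.closure {T₁₁, T₃₀}

/-- The action of `H ⊂ SL₂` on `V n ⊗ ℂ²` given by the inclusion `H → SL₂` on `V n` and by a
homomorphism `φ₂ : H → S₄*` on `ℂ²`. -/
def tensorRep (n : ℕ) {H : Subgroup SL(2, ℂ)} (φ₂ : H →* binaryOctahedral) :
    Representation ℂ H (V n ⊗[ℂ] (Fin 2 → ℂ)) :=
  Representation.tprod ((formRep n).comp H.subtype)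
    (stdRep.comp (binaryOctahedral.subtype.comp φ₂))

/-- The row vector `(p, q) = p ⊗ e₁ + q ⊗ e₂`. -/
def row {n : ℕ} (p q : V n) : V n ⊗[ℂ] (Fin 2 → ℂ) :=
  p ⊗ₜ[ℂ] Pi.single 0 1 + q ⊗ₜ[ℂ] Pi.single 1 1

/-- The subrepresentation `S` is `1`-dimensional and irreducible (its only
subrepresentations are zero and itself; see `Representation.IsIrreducible`). -/
def IsOneDimIrreducible {H U : Type*} [Group H] [AddCommMonoid U] [Module ℂ U]
    {ρ : Representation ℂ H U} (S : Subrepresentation ρ) : Prop :=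
  Module.finrank ℂ S.toSubmodule = 1 ∧ IsSimpleOrder (Subrepresentation S.toRepresentation)

/-- The isotypic component of type `σ`: the sum of all subrepresentations of `ρ` isomorphic
to `σ`. -/
def isotypic {H U W : Type*} [Group H] [AddCommMonoid U] [Module ℂ U] [AddCommMonoid W]
    [Module ℂ W] (ρ : Representation ℂ H U) (σ : Representation ℂ H W) : Submodule ℂ U :=
  ⨆ (S : Subrepresentation ρ) (_ : Nonempty (S.toRepresentation.Equiv σ)), S.toSubmodule

end GaloisLift

end

open GaloisLift

noncomputable section

namespace GaloisLift

section

open MvPolynomial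

/-! ### Zeros and linear factors of binary forms -/

/-! Write `M` for the matrix of forms with rows `(a, b)` and `(c, e)`. The theorem rests on one
fact: invertible matrices with proportional images under `f₁` differ by a scalar and right
multiplication by an element of `S₄*`, because `S₄*` is the whole stabilizer in `SL₂` of the line
through `uv(u⁴ - v⁴)` (`binaryOctahedral_eq_stabilizer`, `exists_of_f₁_proportional`).

Part 1. If `det M` vanished identically, `f₁ ∘ g` would take values in sixth powers of linear forms,
which lie in the closed orbit, and by continuity so would `F` (`detForm_ne_zero`). For `t` in `G*`
the map `F ∘ φ` takes the same value at `x` and `t⁻¹x`, so generically `M(t⁻¹x)` and `M(x)` differ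
by an element of `S₄*` and a scalar. As `S₄*` is finite, one element serves for all `x`; as the
entries have no common zero, the scalar is constant (`exists_equivariant`). The pairs `(t, s)` that
arise form a group `E ⊂ G* × S₄*` over `G*`, in which `t = ±1` if and only if `s = ±1`: one
direction uses `det M ≠ 0`, the other faithfulness.

There remains a sign problem, since `s` is determined by `t` only up to sign. A character of `E`
with values `±1` that is nontrivial on `(-1, 1)` and on `(1, -1)` has as kernel the graph of an
injective homomorphism (`exists_injective_lift`). Transfer reduces the construction of this
character to a Sylow 2-subgroup (`exists_sign_character`). There all squares lie in a cyclic normal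
subgroup containing `(-1, -1)` but not `(-1, 1)` (`exists_cyclic_of_isPGroup`), and the quotient by
it is elementary abelian.

Part 2. Equivariance of the rows gives the seven components of `f₁(M)` a common character under
`G*`. Forms of a given degree and character are a common factor times forms in the two forms that
define `φ` (`exists_semiinvariant_generator`): a combination of two of them vanishes on a free
orbit, hence is divisible by the form of that fibre, and division lowers the degree. So `f₁ ∘ g`
factors through `φ`. Uniqueness holds because `φ` is surjective. -/

theorem eval_subst (B : Matrix (Fin 2) (Fin 2) ℂ) (p : MvPolynomial (Fin 2) ℂ) (x : Fin 2 → ℂ) :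
    eval x (subst B p) = eval (B.mulVec x) p := by
  have h : (eval x).comp (subst B : MvPolynomial (Fin 2) ℂ →+* MvPolynomial (Fin 2) ℂ) =
      eval (B.mulVec x) := by
    ext i
    · simp
    · fin_cases i <;> simp [subst]
  exact RingHom.congr_fun h p

theorem eq_add_of_mem_support {m : ℕ} {p : MvPolynomial (Fin 2) ℂ} (hp : p ∈ V m) {d : Fin 2 →₀ ℕ}
    (hd : d ∈ p.support) : m = d 0 + d 1 := by
  have h1 := ((mem_homogeneousSubmodule m p).1 hp).degree_eq_sum_deg_support hd
  change m = d.degree at h1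
  rwa [Finsupp.degree_eq_sum, Fin.sum_univ_two] at h1

theorem eval_smul_of_mem {m : ℕ} {p : MvPolynomial (Fin 2) ℂ} (hp : p ∈ V m) (c : ℂ)
    (x : Fin 2 → ℂ) : eval (c • x) p = c ^ m * eval x p := by
  rw [eval_eq', eval_eq', Finset.mul_sum]
  refine Finset.sum_congr rfl fun d hd => ?_
  have h1 := eq_add_of_mem_support hp hd
  simp only [Fin.prod_univ_two, Pi.smul_apply, smul_eq_mul, h1]
  ring

/-- The linear form vanishing at `y`. -/
def wedge (y : Fin 2 → ℂ) : MvPolynomial (Fin 2) ℂ := C (y 1) * X 0 - C (y 0) * X 1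

@[simp] theorem eval_wedge (x y : Fin 2 → ℂ) : eval x (wedge y) = y 1 * x 0 - y 0 * x 1 := by
  simp [wedge]

theorem coeff_eq_eval_of_mem {m : ℕ} {p : MvPolynomial (Fin 2) ℂ} (hp : p ∈ V m) :
    eval ![1, 0] p = coeff (Finsupp.single 0 m) p := by
  rw [eval_eq', Finset.sum_eq_single (Finsupp.single 0 m)]
  · simp
  · intro d hd hne
    have h1 := eq_add_of_mem_support hp hd
    have h2 : d 1 ≠ 0 := by
      intro h0
      apply hne
      ext i
      fin_cases i
      · simpa [h0] using h1.symm
      · simpa using h0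
    simp [h2]
  · intro h
    simp [notMem_support_iff.1 h]

/-- The value at `(1, 0)` is the coefficient of `u^m`, the only monomial of degree `m` not divisible
by `v`. For `m = 0` the truncated `m - 1` is harmless, since then `p = 0` and `r = 0`. -/
theorem exists_X_mul_of_eval_eq_zero {m : ℕ} {p : MvPolynomial (Fin 2) ℂ} (hp : p ∈ V m)
    (h0 : eval ![1, 0] p = 0) : ∃ r ∈ V (m - 1), p = X 1 * r := by
  have hhom := (mem_homogeneousSubmodule m p).1 hp
  rw [coeff_eq_eval_of_mem hp] at h0
  have hdvd : (X 1 : MvPolynomial (Fin 2) ℂ) ∣ p := by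
    rw [X_dvd_iff_modMonomial_eq_zero]
    ext d
    by_cases hd : Finsupp.single 1 1 ≤ d
    · rw [coeff_modMonomial_of_le _ hd, coeff_zero]
    · rw [coeff_modMonomial_of_not_le _ hd, coeff_zero]
      by_contra hne
      apply hne
      have h1 := eq_add_of_mem_support hp (mem_support_iff.2 hne)
      have h2 : d 1 = 0 := by
        by_contra h3
        apply hd
        rw [Finsupp.single_le_iff]
        omega
      have h3 : d = Finsupp.single 0 m := by
        ext i
        fin_cases i
        · simpa [h2] using h1.symm
        · simpa using h2
      rw [h3, h0]
  obtain ⟨r, rfl⟩ := hdvd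
  refine ⟨r, ?_, rfl⟩
  rw [mem_homogeneousSubmodule]
  intro d hd
  have h1 : coeff (Finsupp.single 1 1 + d) (X 1 * r) ≠ 0 := by rwa [coeff_X_mul]
  have h2 := hhom h1
  rw [map_add] at h2
  simp only [Finsupp.weight_single, Pi.one_apply, smul_eq_mul, mul_one] at h2
  omega

/-- A linear change of coordinates moving `(1, 0)` to `y` reduces this to divisibility by `v`. -/
theorem exists_wedge_mul {m : ℕ} {p : MvPolynomial (Fin 2) ℂ} (hp : p ∈ V m) {y : Fin 2 → ℂ}
    (hy : y ≠ 0) (h0 : eval y p = 0) : ∃ r ∈ V (m - 1), p = wedge y * r := by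
  set D : ℂ := y 0 * star (y 0) + y 1 * star (y 1) with hD
  have hD0 : D ≠ 0 := by
    intro h
    apply hy
    have h1 : ((Complex.normSq (y 0) + Complex.normSq (y 1) : ℝ) : ℂ) = 0 := by
      push_cast
      rw [← Complex.mul_conj, ← Complex.mul_conj]
      exact h
    have h2 : Complex.normSq (y 0) + Complex.normSq (y 1) = 0 := by exact_mod_cast h1
    have h3 := Complex.normSq_nonneg (y 0)
    have h4 := Complex.normSq_nonneg (y 1)
    ext i
    fin_cases i
    · exact Complex.normSq_eq_zero.1 (show Complex.normSq (y 0) = 0 by linarith)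
    · exact Complex.normSq_eq_zero.1 (show Complex.normSq (y 1) = 0 by linarith)
  -- The first column is `y`, the second is orthogonal to it, and the determinant is `D = |y|²`. The
  -- inverse `B'` carries `v` to `-wedge y / D`, whence the constant `-1 / D` below.
  set B : Matrix (Fin 2) (Fin 2) ℂ := !![y 0, -star (y 1); y 1, star (y 0)] with hB
  set B' : Matrix (Fin 2) (Fin 2) ℂ :=
    !![star (y 0) / D, star (y 1) / D; -y 1 / D, y 0 / D] with hB'
  have hBB : B * B' = 1 := by
    ext i j
    fin_cases i <;> fin_cases j <;> simp [B, B', Matrix.mul_apply] <;> field_simp <;>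
      simp [hD] <;> ring
  obtain ⟨r, hr, hpr⟩ := exists_X_mul_of_eval_eq_zero (subst_mem B hp) (by
    have h1 : B.mulVec ![1, 0] = y := by
      ext i
      fin_cases i <;> simp [B, Matrix.mulVec, dotProduct]
    rw [eval_subst, h1, h0])
  refine ⟨C (-1 / D) * subst B' r, ?_, ?_⟩
  · exact ((mem_homogeneousSubmodule _ _).1 (subst_mem B' hr)).C_mul _
  · have h1 : p = subst B' (subst B p) := by
      rw [← AlgHom.comp_apply, ← subst_mul, hBB, subst_one]; rfl
    rw [h1, hpr, map_mul, ← mul_assoc]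
    have h2 : subst B' (X 1) = wedge y * C (-1 / D) := by
      have e1 : B' 1 0 = y 1 * (-1 / D) := by simp [B']; ring
      have e2 : B' 1 1 = - (y 0 * (-1 / D)) := by simp [B']; ring
      simp only [subst, aeval_X, Fin.sum_univ_two, e1, e2, wedge, map_mul, map_neg]
      ring
    rw [h2]

theorem mem_of_degree_zero {p : MvPolynomial (Fin 2) ℂ} (hp : p ∈ V 0) : ∃ c, p = C c := by
  rw [mem_homogeneousSubmodule] at hp
  exact ⟨_, (totalDegree_eq_zero_iff_eq_C.1 (by
    exact Nat.le_zero.1 hp.totalDegree_le))⟩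

/-- A binary form of positive degree has a nontrivial zero. -/
theorem exists_zero_of_pos {m : ℕ} (hm : 0 < m) {p : MvPolynomial (Fin 2) ℂ} (hp : p ∈ V m) :
    ∃ y : Fin 2 → ℂ, y ≠ 0 ∧ eval y p = 0 := by
  by_cases h0 : eval ![1, 0] p = 0
  · exact ⟨![1, 0], fun h => by simpa using congrFun h 0, h0⟩
  rw [coeff_eq_eval_of_mem hp] at h0
  -- Dehomogenize at `v = 1`. Without zeros `q` is constant, so homogenizing it back to degree `m >
  -- 0` gives no `u^m` term, against `p(1, 0) ≠ 0`.
  set q : Polynomial ℂ := aeval ![Polynomial.X, 1] p with hq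
  have heval : ∀ z : ℂ, q.eval z = eval ![z, 1] p := by
    intro z
    have h : (Polynomial.evalRingHom z).comp
        (aeval ![Polynomial.X, 1] : MvPolynomial (Fin 2) ℂ →ₐ[ℂ] Polynomial ℂ).toRingHom =
        eval ![z, 1] := by
      ext i
      · simp
      · fin_cases i <;> simp
    exact RingHom.congr_fun h p
  by_contra! hcon
  have hdeg : q.degree = 0 := by
    by_contra hne
    obtain ⟨z, hz⟩ := IsAlgClosed.exists_root q hne
    refine hcon ![z, 1] (fun h => by simpa using congrFun h 1) ?_
    rw [← heval]; exact hz
  have hqp : q.homogenize m = p :=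
    Polynomial.homogenize_eq_of_isHomogeneous ((mem_homogeneousSubmodule _ _).1 hp) hq.symm
  have hc := Polynomial.coeff_homogenize q m (Finsupp.single 0 m)
  rw [hqp] at hc
  apply h0
  rw [hc]
  have : q.coeff m = 0 := Polynomial.coeff_eq_zero_of_degree_lt (by rw [hdeg]; exact_mod_cast hm)
  simp [this]

theorem exists_eval_ne_zero {p : MvPolynomial (Fin 2) ℂ} (hp : p ≠ 0) : ∃ x, eval x p ≠ 0 := by
  by_contra! h
  exact hp (MvPolynomial.funext fun x => by simpa using h x)

theorem eq_zero_of_eval {p : MvPolynomial (Fin 2) ℂ} (h : ∀ x, eval x p = 0) : p = 0 :=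
  MvPolynomial.funext fun x => by simpa using h x

theorem wedge_ne_zero {y : Fin 2 → ℂ} (hy : y ≠ 0) : wedge y ≠ 0 := by
  intro h
  apply hy
  have h1 := eval_wedge ![1, 0] y
  have h2 := eval_wedge ![0, 1] y
  rw [h] at h1 h2
  ext i
  fin_cases i
  · simpa using h2.symm
  · simpa using h1.symm

theorem pos_of_eval_eq_zero {m : ℕ} {p : MvPolynomial (Fin 2) ℂ} (hp : p ∈ V m) (hp0 : p ≠ 0)
    {y : Fin 2 → ℂ} (h : eval y p = 0) : 0 < m := by
  rcases Nat.eq_zero_or_pos m with rfl | h1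
  · obtain ⟨c, rfl⟩ := mem_of_degree_zero hp
    simp at h
    simp [h] at hp0
  · exact h1

/-- A form vanishing at pairwise non-proportional points is divisible by the product of the
corresponding linear forms. -/
theorem exists_prod_wedge_mul {ι : Type*} (s : Finset ι) (y : ι → Fin 2 → ℂ)
    (hy : ∀ i ∈ s, y i ≠ 0)
    (hpair : ∀ i ∈ s, ∀ j ∈ s, i ≠ j → eval (y i) (wedge (y j)) ≠ 0) :
    ∀ {m : ℕ} {p : MvPolynomial (Fin 2) ℂ}, p ∈ V m → p ≠ 0 → (∀ i ∈ s, eval (y i) p = 0) →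
      s.card ≤ m ∧ ∃ r ∈ V (m - s.card), p = (∏ i ∈ s, wedge (y i)) * r := by
  classical
  induction s using Finset.induction_on with
  | empty => intro m p hp _ _; exact ⟨by simp, p, by simpa using hp, by simp⟩
  | insert i s hi ih =>
    intro m p hp hp0 hv
    have hiv := hv i (Finset.mem_insert_self _ _)
    obtain ⟨r, hr, rfl⟩ := exists_wedge_mul hp (hy i (Finset.mem_insert_self _ _)) hiv
    have hm := pos_of_eval_eq_zero hp hp0 hiv
    have hr0 : r ≠ 0 := right_ne_zero_of_mul hp0
    obtain ⟨h1, r', hr', rfl⟩ := ih (fun j hj => hy j (Finset.mem_insert_of_mem hj))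
      (fun j hj k hk => hpair j (Finset.mem_insert_of_mem hj) k (Finset.mem_insert_of_mem hk))
      hr hr0 (fun j hj => by
        have h2 := hv j (Finset.mem_insert_of_mem hj)
        rw [map_mul] at h2
        refine (mul_eq_zero.1 h2).resolve_left (hpair j (Finset.mem_insert_of_mem hj) i
          (Finset.mem_insert_self _ _) ?_)
        rintro rfl
        exact hi hj)
    rw [Finset.card_insert_of_notMem hi]
    refine ⟨by omega, r', ?_, ?_⟩
    · rwa [show m - (s.card + 1) = m - 1 - s.card by omega]
    · rw [Finset.prod_insert hi, mul_assoc]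

/-- A family of forms of the same degree that do not all vanish has a greatest common divisor:
dividing by it leaves forms without common zero. -/
theorem exists_common_factor {ι : Type*} : ∀ {m : ℕ} (p : ι → MvPolynomial (Fin 2) ℂ),
    (∀ i, p i ∈ V m) → (∃ i, p i ≠ 0) →
    ∃ (k : ℕ) (γ : MvPolynomial (Fin 2) ℂ) (q : ι → MvPolynomial (Fin 2) ℂ),
      γ ≠ 0 ∧ (∀ i, q i ∈ V k) ∧ (∀ i, p i = γ * q i) ∧
      ∀ y : Fin 2 → ℂ, y ≠ 0 → ∃ i, eval y (q i) ≠ 0 := by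
  intro m
  induction m with
  | zero =>
    rintro p hp ⟨i, hi⟩
    refine ⟨0, 1, p, one_ne_zero, hp, by simp, fun y _ => ⟨i, fun h => ?_⟩⟩
    exact lt_irrefl _ (pos_of_eval_eq_zero (hp i) hi h)
  | succ m ih =>
    rintro p hp ⟨i, hi⟩
    by_cases hz : ∀ y : Fin 2 → ℂ, y ≠ 0 → ∃ i, eval y (p i) ≠ 0
    · exact ⟨m + 1, 1, p, one_ne_zero, hp, by simp, hz⟩
    push Not at hz
    obtain ⟨y, hy, hyp⟩ := hz
    choose r hr hpr using fun i => exists_wedge_mul (hp i) hy (hyp i)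
    obtain ⟨k, γ, q, hγ, hq, hrq, hz⟩ := ih r hr ⟨i, fun h => hi (by rw [hpr i, h, mul_zero])⟩
    exact ⟨k, wedge y * γ, q, mul_ne_zero (wedge_ne_zero hy) hγ, hq,
      fun i => by rw [hpr i, hrq i, mul_assoc], hz⟩

/-- At a zero of `h` some `q i` is nonzero, so `p` vanishes there. Cancelling this linear factor
from `h` and `p` preserves the relations, and induction on the degree of `h` shows that `h` divides
`p`. -/
theorem exists_factor_of_mul_eq {ι : Type*} (q r : ι → MvPolynomial (Fin 2) ℂ)
    (hq : ∀ y : Fin 2 → ℂ, y ≠ 0 → ∃ i, eval y (q i) ≠ 0) :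
    ∀ {k : ℕ} {m : ℕ} {h p : MvPolynomial (Fin 2) ℂ}, h ∈ V k → h ≠ 0 → p ∈ V m →
      (∀ i, p * q i = h * r i) → ∃ μ ∈ V (m - k), p = μ * h := by
  intro k
  induction k with
  | zero =>
    intro m h p hh h0 hp _
    obtain ⟨c, rfl⟩ := mem_of_degree_zero hh
    have hc : c ≠ 0 := fun hc => h0 (by simp [hc])
    refine ⟨C c⁻¹ * p, ?_, ?_⟩
    · exact ((mem_homogeneousSubmodule _ _).1 hp).C_mul _
    · rw [mul_right_comm, ← C_mul, inv_mul_cancel₀ hc, C_1, one_mul]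
  | succ k ih =>
    intro m h p hh h0 hp hpq
    obtain ⟨y, hy, hyh⟩ := exists_zero_of_pos (Nat.succ_pos k) hh
    obtain ⟨h', hh', rfl⟩ := exists_wedge_mul hh hy hyh
    obtain ⟨i, hi⟩ := hq y hy
    have hpy : eval y p = 0 := by
      have h2 := congrArg (eval y) (hpq i)
      rw [map_mul, map_mul, hyh, zero_mul] at h2
      exact (mul_eq_zero.1 h2).resolve_right hi
    obtain ⟨p', hp', rfl⟩ := exists_wedge_mul hp hy hpy
    obtain ⟨μ, hμ, rfl⟩ := ih hh' (right_ne_zero_of_mul h0) hp' (fun j =>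
      mul_left_cancel₀ (wedge_ne_zero hy) (by rw [← mul_assoc, hpq j, mul_assoc]))
    refine ⟨μ, ?_, by ring⟩
    rwa [show m - (k + 1) = m - 1 - k by omega]

/-- Two projectively equal families of forms of the same degree, the first without common zero,
differ by a constant factor. -/
theorem exists_C_mul_of_proportional {ι : Type*} {m : ℕ} (p q : ι → MvPolynomial (Fin 2) ℂ)
    (hp : ∀ i, p i ∈ V m) (hq : ∀ i, q i ∈ V m)
    (hqz : ∀ y : Fin 2 → ℂ, y ≠ 0 → ∃ i, eval y (q i) ≠ 0)
    (hpq : ∀ i j, p i * q j = p j * q i) : ∃ c : ℂ, ∀ i, p i = C c * q i := by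
  obtain ⟨i, hi⟩ := hqz ![1, 0] (fun h => by simpa using congrFun h 0)
  have hi0 : q i ≠ 0 := fun h => hi (by simp [h])
  -- The relations `p i * q j = q i * p j` for all `j` show that `q i` divides `p i`. The degrees
  -- agree, so the quotient is a constant.
  obtain ⟨μ, hμ, h⟩ := exists_factor_of_mul_eq q p hqz (hq i) hi0 (hp i)
    (fun j => by rw [hpq i j, mul_comm])
  rw [Nat.sub_self] at hμ
  obtain ⟨c, rfl⟩ := mem_of_degree_zero hμ
  refine ⟨c, fun j => mul_right_cancel₀ hi0 ?_⟩
  rw [hpq j i, h]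
  ring

/-! ### The stabilizer of the octahedral form -/

theorem eval_octahedralForm (x : Fin 2 → ℂ) :
    eval x octahedralForm.1 = x 0 * x 1 * (x 0 ^ 4 - x 1 ^ 4) := by
  simp [octahedralForm]

/-- The primitive eighth root of unity `exp(2πi/8)`. -/
def xi : ℂ := Complex.exp (2 * Real.pi * Complex.I / 8)

theorem xi_primitive : IsPrimitiveRoot xi 8 := by
  simpa [xi] using Complex.isPrimitiveRoot_exp 8 (by norm_num)

theorem xi_ne_zero : xi ≠ 0 := Complex.exp_ne_zero _

theorem xi_pow_four : xi ^ 4 = -1 := by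
  rw [xi, ← Complex.exp_nat_mul, ← Complex.exp_pi_mul_I]
  congr 1
  push_cast
  ring

theorem coe_T₁₁ : T₁₁.1 = !![xi, 0; 0, xi⁻¹] := rfl

theorem coe_T₁₁_pow (k : ℕ) : (T₁₁ ^ k).1 = !![xi ^ k, 0; 0, (xi ^ k)⁻¹] := by
  induction k with
  | zero => ext i j; fin_cases i <;> fin_cases j <;> simp
  | succ k ih =>
    rw [pow_succ, Matrix.SpecialLinearGroup.coe_mul, ih, coe_T₁₁]
    ext i j
    fin_cases i <;> fin_cases j <;> simp [pow_succ, mul_comm]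

theorem sqrt_two_mul_self : (Real.sqrt 2 : ℂ) * (Real.sqrt 2 : ℂ) = 2 := by
  rw [← Complex.ofReal_mul, Real.mul_self_sqrt (by norm_num)]; norm_num

theorem coe_T₃₀ : T₃₀.1 = !![(Real.sqrt 2 : ℂ)⁻¹, -(Real.sqrt 2 : ℂ)⁻¹;
    (Real.sqrt 2 : ℂ)⁻¹, (Real.sqrt 2 : ℂ)⁻¹] := rfl

/-- The stabilizer in `SL₂` of the octahedral form up to scalars. -/
def octahedralStabilizer : Subgroup SL(2, ℂ) where
  carrier := {A | ∃ ε : ℂ, ε ≠ 0 ∧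
    ∀ x, eval (A.1.mulVec x) octahedralForm.1 = ε * eval x octahedralForm.1}
  one_mem' := ⟨1, one_ne_zero, fun x => by simp⟩
  mul_mem' := by
    rintro A B ⟨ε, hε, hA⟩ ⟨δ, hδ, hB⟩
    refine ⟨ε * δ, mul_ne_zero hε hδ, fun x => ?_⟩
    rw [Matrix.SpecialLinearGroup.coe_mul, ← Matrix.mulVec_mulVec, hA, hB, mul_assoc]
  inv_mem' := by
    rintro A ⟨ε, hε, hA⟩
    refine ⟨ε⁻¹, inv_ne_zero hε, fun x => ?_⟩
    have h := hA ((A⁻¹ : SL(2, ℂ)).1.mulVec x)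
    rw [Matrix.mulVec_mulVec, ← Matrix.SpecialLinearGroup.coe_mul, mul_inv_cancel,
      Matrix.SpecialLinearGroup.coe_one, Matrix.one_mulVec] at h
    rw [h, inv_mul_cancel_left₀ hε]

/-- Both generators change the sign of the form, which is why stability is asked only up to scalars.
-/
theorem binaryOctahedral_le_stabilizer : binaryOctahedral ≤ octahedralStabilizer := by
  rw [binaryOctahedral, Subgroup.closure_le]
  rintro A (rfl | rfl)
  · refine ⟨-1, by norm_num, fun x => ?_⟩
    have h4 := xi_pow_four
    have h0 := xi_ne_zero
    simp only [eval_octahedralForm, coe_T₁₁, Matrix.mulVec, dotProduct, Fin.sum_univ_two]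
    simp only [Matrix.of_apply, Matrix.cons_val', Matrix.cons_val_zero, Matrix.cons_val_one,
      Matrix.cons_val_fin_one, zero_mul, add_zero, zero_add, mul_pow, inv_pow, h4]
    field_simp
    ring
  · refine ⟨-1, by norm_num, fun x => ?_⟩
    have h2 : ((Real.sqrt 2 : ℂ)⁻¹) ^ 2 = 2⁻¹ := by
      rw [inv_pow, sq, sqrt_two_mul_self]
    set s := (Real.sqrt 2 : ℂ)⁻¹
    have h6 : s ^ 6 = 8⁻¹ := by
      rw [show s ^ 6 = (s ^ 2) ^ 3 by ring, h2]; norm_num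
    simp only [eval_octahedralForm, coe_T₃₀, Matrix.mulVec, dotProduct, Fin.sum_univ_two]
    simp only [Matrix.of_apply, Matrix.cons_val', Matrix.cons_val_zero, Matrix.cons_val_one,
      Matrix.cons_val_fin_one]
    linear_combination (-8 * (x 0 * x 1 * (x 0 ^ 4 - x 1 ^ 4))) * h6

theorem T₁₁_mem : T₁₁ ∈ binaryOctahedral := Subgroup.subset_closure (by simp)

theorem T₃₀_mem : T₃₀ ∈ binaryOctahedral := Subgroup.subset_closure (by simp)

theorem coe_T₃₀_sq : (T₃₀ ^ 2).1 = !![0, -1; 1, 0] := by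
  have h2 : (Real.sqrt 2 : ℂ)⁻¹ * (Real.sqrt 2 : ℂ)⁻¹ = 2⁻¹ := by
    rw [← mul_inv, sqrt_two_mul_self]
  rw [sq, Matrix.SpecialLinearGroup.coe_mul, coe_T₃₀]
  ext i j
  fin_cases i <;> fin_cases j <;> simp [h2] <;> norm_num

/-- The hypothesis says that `A` fixes the root `[1 : 0]`. The absence of a `u⁴v²` term makes `A`
diagonal, and the ratio of the two remaining terms gives `α⁴ = δ⁴`; with `αδ = 1` this is `α⁸ = 1`.
-/
theorem eq_T₁₁_pow_of_entry_eq_zero {A : SL(2, ℂ)} (hA : A ∈ octahedralStabilizer)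
    (h10 : A.1 1 0 = 0) : ∃ k < 8, A = T₁₁ ^ k := by
  obtain ⟨ε, hε, h⟩ := hA
  have hdet := A.2
  rw [Matrix.det_fin_two, h10, mul_zero, sub_zero] at hdet
  set α := A.1 0 0 with hα
  set β := A.1 0 1 with hβ
  set δ := A.1 1 1 with hδ
  have key : ∀ u v : ℂ, (α * u + β * v) * (δ * v) * ((α * u + β * v) ^ 4 - (δ * v) ^ 4) =
      ε * (u * v * (u ^ 4 - v ^ 4)) := by
    intro u v
    have h1 := h ![u, v]
    simp only [eval_octahedralForm, Matrix.mulVec, dotProduct, Fin.sum_univ_two] at h1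
    simpa [h10, ← hα, ← hβ, ← hδ] using h1
  have hα0 : α ≠ 0 := left_ne_zero_of_mul_eq_one hdet
  have hδ0 : δ ≠ 0 := right_ne_zero_of_mul_eq_one hdet
  -- compare the coefficients of `u⁴v²` and `u⁵v`
  have e1 := key 1 1
  have e2 := key (-1) 1
  have e3 := key 2 1
  have e4 := key (-2) 1
  have hβ0 : 5 * (α ^ 4 * δ) * β = 0 := by
    have e0 := key 0 1
    -- In `u`, both sides have degree at most five at `v = 1`. Their fourth central difference at
    -- `0`, divided by `4!`, is the coefficient of `u⁴`.
    linear_combination (1/4) * e0 - (1/6) * (e1 + e2) + (1/24) * (e3 + e4)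
  have hβ0 : β = 0 := by
    have : (5 : ℂ) * (α ^ 4 * δ) ≠ 0 :=
      mul_ne_zero (by norm_num) (mul_ne_zero (pow_ne_zero 4 hα0) hδ0)
    exact (mul_eq_zero.1 hβ0).resolve_left this
  have hα8 : α ^ 8 = 1 := by
    rw [hβ0] at key
    have k1 := key 1 1
    have k3 : α * δ * (α ^ 4 - δ ^ 4) = 0 := by linear_combination k1
    rw [hdet, one_mul] at k3
    have : α ^ 4 * δ ^ 4 = 1 := by rw [← mul_pow, hdet, one_pow]
    linear_combination α ^ 4 * k3 + this
  obtain ⟨k, hk, hk'⟩ := xi_primitive.eq_pow_of_pow_eq_one hα8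
  refine ⟨k, hk, ?_⟩
  apply Subtype.ext
  rw [coe_T₁₁_pow, hk']
  have hδ' : δ = α⁻¹ := (inv_eq_of_mul_eq_one_right hdet).symm
  ext i j
  fin_cases i <;> fin_cases j
  · rfl
  · exact hβ0
  · exact h10
  · exact hδ'

/-- An element of the stabilizer sends `[1 : 0]` to one of the six roots `[1 : 0]`, `[0 : 1]`, `[1 :
i^j]`. An element of `S₄*` brings this root back to `[1 : 0]`, and what is left is a power of `T₁₁`.
This gives `8 + 8 + 32` normal forms. -/
theorem exists_rep_of_mem_stabilizer {A : SL(2, ℂ)} (hA : A ∈ octahedralStabilizer) :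
    (∃ k < 8, A = T₁₁ ^ k) ∨ (∃ k < 8, A = (T₃₀ ^ 2)⁻¹ * T₁₁ ^ k) ∨
      ∃ j < 4, ∃ k < 8, A = (T₁₁ ^ j)⁻¹ * T₃₀ * T₁₁ ^ k := by
  have hroot : A.1 0 0 * A.1 1 0 * (A.1 0 0 ^ 4 - A.1 1 0 ^ 4) = 0 := by
    obtain ⟨ε, hε, h⟩ := hA
    have h1 := h ![1, 0]
    simp only [eval_octahedralForm, Matrix.mulVec, dotProduct, Fin.sum_univ_two] at h1
    simpa using h1
  have hT1 := binaryOctahedral_le_stabilizer T₁₁_mem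
  have hT3 := binaryOctahedral_le_stabilizer T₃₀_mem
  by_cases h10 : A.1 1 0 = 0
  · exact Or.inl (eq_T₁₁_pow_of_entry_eq_zero hA h10)
  by_cases h00 : A.1 0 0 = 0
  · right; left
    obtain ⟨k, hk, h⟩ := eq_T₁₁_pow_of_entry_eq_zero (mul_mem (pow_mem hT3 2) hA) (by
      rw [Matrix.SpecialLinearGroup.coe_mul, coe_T₃₀_sq]
      simp [Matrix.mul_apply, h00])
    exact ⟨k, hk, by rw [← h, inv_mul_cancel_left]⟩
  · right; right
    have h4 : A.1 0 0 ^ 4 = A.1 1 0 ^ 4 :=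
      sub_eq_zero.1 ((mul_eq_zero.1 hroot).resolve_left (mul_ne_zero h00 h10))
    have hprim : IsPrimitiveRoot (xi ^ 2) 4 := xi_primitive.pow (by norm_num) (by norm_num)
    obtain ⟨j, hj, hj'⟩ := hprim.eq_pow_of_pow_eq_one (ξ := A.1 1 0 / A.1 0 0) (by
      rw [div_pow, h4, div_self (pow_ne_zero _ h10)])
    have hrel : A.1 1 0 = xi ^ j * xi ^ j * A.1 0 0 := by
      rw [eq_div_iff h00] at hj'
      rw [← hj']; ring
    obtain ⟨k, hk, h⟩ := eq_T₁₁_pow_of_entry_eq_zero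
      (mul_mem (inv_mem hT3) (mul_mem (pow_mem hT1 j) hA)) (by
        have hx := pow_ne_zero j xi_ne_zero
        rw [Matrix.SpecialLinearGroup.coe_mul, Matrix.SpecialLinearGroup.coe_mul, coe_T₁₁_pow,
          Matrix.SpecialLinearGroup.coe_inv, coe_T₃₀, Matrix.adjugate_fin_two_of]
        simp [Matrix.mul_apply, Matrix.vecMul, dotProduct, hrel]
        field_simp
        ring)
    refine ⟨j, hj, k, hk, ?_⟩
    rw [← h]
    group

theorem binaryOctahedral_eq_stabilizer : binaryOctahedral = octahedralStabilizer := by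
  refine le_antisymm binaryOctahedral_le_stabilizer fun A hA => ?_
  have h1 := T₁₁_mem
  have h3 := T₃₀_mem
  rcases exists_rep_of_mem_stabilizer hA with ⟨k, -, rfl⟩ | ⟨k, -, rfl⟩ | ⟨j, -, k, -, rfl⟩
  · exact pow_mem h1 k
  · exact mul_mem (inv_mem (pow_mem h3 2)) (pow_mem h1 k)
  · exact mul_mem (mul_mem (inv_mem (pow_mem h1 j)) h3) (pow_mem h1 k)

instance finite_binaryOctahedral : Finite binaryOctahedral := by
  have h1 : (Set.range fun k : Fin 8 => T₁₁ ^ (k : ℕ)).Finite := Set.finite_range _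
  have h2 : (Set.range fun k : Fin 8 => (T₃₀ ^ 2)⁻¹ * T₁₁ ^ (k : ℕ)).Finite := Set.finite_range _
  have h3 : (Set.range fun jk : Fin 4 × Fin 8 =>
    (T₁₁ ^ (jk.1 : ℕ))⁻¹ * T₃₀ * T₁₁ ^ (jk.2 : ℕ)).Finite := Set.finite_range _
  refine Set.Finite.to_subtype (((h1.union h2).union h3).subset fun A hA => ?_)
  rcases exists_rep_of_mem_stabilizer (binaryOctahedral_le_stabilizer hA) with
    ⟨k, hk, rfl⟩ | ⟨k, hk, rfl⟩ | ⟨j, hj, k, hk, rfl⟩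
  · exact Or.inl (Or.inl ⟨⟨k, hk⟩, rfl⟩)
  · exact Or.inl (Or.inr ⟨⟨k, hk⟩, rfl⟩)
  · exact Or.inr ⟨(⟨j, hj⟩, ⟨k, hk⟩), rfl⟩

/-- Rows transform by `φ₂(t)ᵀ`, while `f₁` sees right multiplication by `S₄*`, so the two have to be
exchanged. `T₁₁` is symmetric and the transpose of `T₃₀` is its inverse. -/
theorem transpose_mem_binaryOctahedral {A : SL(2, ℂ)} (hA : A ∈ binaryOctahedral) :
    A.transpose ∈ binaryOctahedral := by
  induction hA using Subgroup.closure_induction with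
  | mem A h =>
    rcases h with rfl | rfl
    · have : T₁₁.transpose = T₁₁ := by
        apply Subtype.ext
        ext i j
        fin_cases i <;> fin_cases j <;> simp [coe_T₁₁, Matrix.SpecialLinearGroup.transpose]
      rw [this]; exact T₁₁_mem
    · have : T₃₀.transpose = T₃₀⁻¹ := by
        apply Subtype.ext
        rw [Matrix.SpecialLinearGroup.coe_inv]
        ext i j
        fin_cases i <;> fin_cases j <;>
          simp [coe_T₃₀, Matrix.SpecialLinearGroup.transpose, Matrix.adjugate_fin_two]
      rw [this]; exact inv_mem T₃₀_mem
  | one =>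
    convert one_mem binaryOctahedral
    apply Subtype.ext
    simp [Matrix.SpecialLinearGroup.transpose]
  | mul A B _ _ hA hB =>
    convert mul_mem hB hA
    exact Subtype.ext (show (A * B).1.transpose = B.1.transpose * A.1.transpose by simp)
  | inv A _ hA =>
    convert inv_mem hA
    exact Subtype.ext (show (A⁻¹).1.transpose = A.1.transpose.adjugate by
      rw [Matrix.SpecialLinearGroup.coe_inv, Matrix.adjugate_transpose])

/-! ### Monomial matrices -/

/-- The subgroup of `S₄*` of diagonal and antidiagonal matrices, of index `3`. -/
def monomialSubgroup : Subgroup binaryOctahedral where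
  carrier := {A | (A.1.1 0 1 = 0 ∧ A.1.1 1 0 = 0) ∨ (A.1.1 0 0 = 0 ∧ A.1.1 1 1 = 0)}
  one_mem' := by simp
  mul_mem' := by
    rintro A B (⟨h1, h2⟩ | ⟨h1, h2⟩) (⟨h3, h4⟩ | ⟨h3, h4⟩) <;>
      simp [Matrix.mul_apply, h1, h2, h3, h4]
  inv_mem' := by
    rintro A (⟨h1, h2⟩ | ⟨h1, h2⟩) <;>
      simp [Matrix.SpecialLinearGroup.coe_inv, Matrix.adjugate_fin_two, h1, h2]

/-! ### The map `f₁` -/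

/-- The coefficients of the octahedral form after the substitution `u ↦ αu + βv`,
`v ↦ γu + δv`. -/
def octCoeff {R : Type*} [CommRing R] (α β γ δ : R) : Fin 7 → R :=
  ![α ^ 5 * γ - γ ^ 5 * α,
    5 * (α ^ 4 * β * γ) + α ^ 5 * δ - (5 * (γ ^ 4 * δ * α) + γ ^ 5 * β),
    10 * (α ^ 3 * β ^ 2 * γ) + 5 * (α ^ 4 * β * δ) -
      (10 * (γ ^ 3 * δ ^ 2 * α) + 5 * (γ ^ 4 * δ * β)),
    10 * (α ^ 2 * β ^ 3 * γ) + 10 * (α ^ 3 * β ^ 2 * δ) -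
      (10 * (γ ^ 2 * δ ^ 3 * α) + 10 * (γ ^ 3 * δ ^ 2 * β)),
    5 * (α * β ^ 4 * γ) + 10 * (α ^ 2 * β ^ 3 * δ) -
      (5 * (γ * δ ^ 4 * α) + 10 * (γ ^ 2 * δ ^ 3 * β)),
    β ^ 5 * γ + 5 * (α * β ^ 4 * δ) - (δ ^ 5 * α + 5 * (γ * δ ^ 4 * β)),
    β ^ 5 * δ - δ ^ 5 * β]

/-- Naturality in the ring lets the same seven expressions serve for complex entries and, in
`exists_f₁_formMatrix`, for entries that are forms. -/
theorem map_octCoeff {R S : Type*} [CommRing R] [CommRing S] (f : R →+* S) (α β γ δ : R)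
    (i : Fin 7) : f (octCoeff α β γ δ i) = octCoeff (f α) (f β) (f γ) (f δ) i := by
  have h5 : f 5 = 5 := map_ofNat f 5
  have h10 : f 10 = 10 := map_ofNat f 10
  fin_cases i <;> simp [octCoeff, h5, h10]

theorem subst_octahedralForm (B : Matrix (Fin 2) (Fin 2) ℂ) :
    subst B octahedralForm.1 = ∑ i : Fin 7,
      C (octCoeff (B 0 0) (B 0 1) (B 1 0) (B 1 1) i) * (X 0 ^ (6 - (i : ℕ)) * X 1 ^ (i : ℕ)) := by
  simp only [map_octCoeff C]
  simp only [subst, octahedralForm, map_mul, map_sub, map_pow, aeval_X, Fin.sum_univ_two]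
  simp [Fin.sum_univ_succ, octCoeff]
  ring

theorem sqrt_choose_ne_zero (i : Fin 7) : (Real.sqrt (Nat.choose 6 i) : ℂ) ≠ 0 := by
  rw [Ne, Complex.ofReal_eq_zero, Real.sqrt_eq_zero (by positivity), Nat.cast_eq_zero]
  exact (Nat.choose_pos (by omega)).ne'

theorem sexticCoord_sum (c : Fin 7 → ℂ) (i : Fin 7) :
    sexticCoord (∑ j : Fin 7, C (c j) * (X 0 ^ (6 - (j : ℕ)) * X 1 ^ (j : ℕ))) i =
      c i / (Real.sqrt (Nat.choose 6 i) : ℂ) := by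
  rw [sexticCoord, coeff_sum, Finset.sum_eq_single i]
  · congr 1
    rw [X_pow_eq_monomial, X_pow_eq_monomial, monomial_mul, C_mul_monomial, coeff_monomial,
      if_pos rfl]
    simp
  · intro j _ hj
    rw [X_pow_eq_monomial, X_pow_eq_monomial, monomial_mul, C_mul_monomial, coeff_monomial,
      if_neg]
    intro h
    have := DFunLike.congr_fun h 1
    simp at this
    exact hj (Fin.ext this)
  · simp

theorem f₁_apply (A : Matrix (Fin 2) (Fin 2) ℂ) (i : Fin 7) :
    f₁ A i = octCoeff (A 1 1) (-A 0 1) (-A 1 0) (A 0 0) i /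
      (Real.sqrt (Nat.choose 6 i) : ℂ) := by
  rw [f₁, subst_octahedralForm, sexticCoord_sum]
  simp [Matrix.adjugate_fin_two]

theorem sexticCoord_C_mul (c : ℂ) (p : MvPolynomial (Fin 2) ℂ) :
    sexticCoord (C c * p) = c • sexticCoord p := by
  ext i
  simp [sexticCoord, coeff_C_mul, mul_div_assoc]

theorem sexticCoord_add (p q : MvPolynomial (Fin 2) ℂ) :
    sexticCoord (p + q) = sexticCoord p + sexticCoord q := by
  ext i
  simp [sexticCoord, add_div]

theorem eq_zero_of_sexticCoord_eq_zero {p : MvPolynomial (Fin 2) ℂ} (hp : p ∈ V 6)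
    (h : sexticCoord p = 0) : p = 0 := by
  ext d
  by_contra hne
  have h1 := eq_add_of_mem_support hp (mem_support_iff.2 hne)
  have h2 := congrFun h ⟨d 1, by omega⟩
  have h3 : (Finsupp.single 0 (6 - d 1) + Finsupp.single 1 (d 1) : Fin 2 →₀ ℕ) = d := by
    ext i
    fin_cases i
    · simp; omega
    · simp
  simp only [sexticCoord, Pi.zero_apply, div_eq_zero_iff, h3] at h2
  exact h2.elim hne (sqrt_choose_ne_zero ⟨d 1, by omega⟩)

theorem f₁_smul (c : ℂ) (A : Matrix (Fin 2) (Fin 2) ℂ) : f₁ (c • A) = c ^ 6 • f₁ A := by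
  ext i
  simp only [f₁_apply, Pi.smul_apply, Matrix.smul_apply, smul_eq_mul, ← mul_div_assoc]
  congr 1
  fin_cases i <;> simp [octCoeff] <;> ring

/-- If `f₁ B` is a multiple of `f₁ A`, so are the sextics they represent. -/
theorem eval_subst_adjugate_eq {A B : Matrix (Fin 2) (Fin 2) ℂ} {k : ℂ}
    (h : f₁ B = k • f₁ A) (x : Fin 2 → ℂ) :
    eval (B.adjugate.mulVec x) octahedralForm.1 =
      k * eval (A.adjugate.mulVec x) octahedralForm.1 := by
  have h1 : subst B.adjugate octahedralForm.1 - C k * subst A.adjugate octahedralForm.1 = 0 := by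
    apply eq_zero_of_sexticCoord_eq_zero
    · exact Submodule.sub_mem _ (subst_mem _ octahedralForm.2)
        (((mem_homogeneousSubmodule _ _).1 (subst_mem _ octahedralForm.2)).C_mul _)
    · rw [sub_eq_add_neg, ← neg_mul, ← C_neg, sexticCoord_add, sexticCoord_C_mul]
      change f₁ B + -k • f₁ A = 0
      rw [h]
      simp
  have h2 := congrArg (eval x) h1
  simp only [map_sub, map_mul, eval_subst, eval_C, map_zero] at h2
  linear_combination h2

theorem octahedralForm_ne_zero : octahedralForm.1 ≠ 0 := by
  intro h
  have h1 := eval_octahedralForm ![2, 1]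
  rw [h] at h1
  norm_num at h1

/-- Matrices with proportional images under `f₁` differ by an element of `S₄*`, up to a scalar. -/
theorem exists_of_f₁_proportional {A B : Matrix (Fin 2) (Fin 2) ℂ} (hA : A.det ≠ 0)
    (hB : B.det ≠ 0) {k : ℂ} (h : f₁ B = k • f₁ A) :
    ∃ s ∈ binaryOctahedral, ∃ c : ℂ, c ≠ 0 ∧ B = c • (A * s.1) := by
  -- This square root normalizes `B.adjugate * A` to determinant `1`.
  obtain ⟨δ, hδ⟩ := IsAlgClosed.exists_pow_nat_eq (B.det * A.det) (n := 2) (by norm_num)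
  have hδ0 : δ ≠ 0 := by
    rintro rfl
    exact mul_ne_zero hB hA (by rw [← hδ]; norm_num)
  have hval := eval_subst_adjugate_eq h
  -- If `k = 0`, evaluating at `B x` gives `det(B)⁶` times the octahedral form at `x`, which would
  -- vanish for every `x`.
  have hk : k ≠ 0 := by
    rintro rfl
    apply octahedralForm_ne_zero
    apply eq_zero_of_eval
    intro x
    have h1 := hval (B.mulVec x)
    rw [Matrix.mulVec_mulVec, Matrix.adjugate_mul, Matrix.smul_mulVec, Matrix.one_mulVec,
      eval_smul_of_mem octahedralForm.2, zero_mul] at h1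
    exact (mul_eq_zero.1 h1).resolve_left (pow_ne_zero _ hB)
  let N : SL(2, ℂ) := ⟨δ⁻¹ • (B.adjugate * A), by
    rw [Matrix.det_smul, Matrix.det_mul, Matrix.det_adjugate]
    simp only [Fintype.card_fin]
    rw [pow_one, ← hδ, inv_pow, inv_mul_cancel₀ (pow_ne_zero 2 hδ0)]⟩
  -- Evaluating the proportionality at `A x` cancels `A.adjugate` against `A`, so `N` preserves the
  -- octahedral form up to a scalar.
  have hN : N ∈ binaryOctahedral := by
    rw [binaryOctahedral_eq_stabilizer]
    refine ⟨δ⁻¹ ^ 6 * (k * A.det ^ 6), mul_ne_zero (pow_ne_zero _ (inv_ne_zero hδ0))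
      (mul_ne_zero hk (pow_ne_zero _ hA)), fun x => ?_⟩
    change eval ((δ⁻¹ • (B.adjugate * A)).mulVec x) _ = _
    rw [Matrix.smul_mulVec, eval_smul_of_mem octahedralForm.2, ← Matrix.mulVec_mulVec, hval,
      Matrix.mulVec_mulVec, Matrix.adjugate_mul, Matrix.smul_mulVec, Matrix.one_mulVec,
      eval_smul_of_mem octahedralForm.2]
    ring
  refine ⟨N⁻¹, inv_mem hN, δ / A.det, div_ne_zero hδ0 hA, ?_⟩
  have hadj : B.adjugate.adjugate = B := by
    ext i j
    fin_cases i <;> fin_cases j <;> simp [Matrix.adjugate_fin_two]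
  rw [Matrix.SpecialLinearGroup.coe_inv]
  change B = (δ / A.det) • (A * (δ⁻¹ • (B.adjugate * A)).adjugate)
  rw [Matrix.adjugate_smul, Matrix.adjugate_mul_distrib, hadj, Matrix.mul_smul, ← mul_assoc,
    Matrix.mul_adjugate, Matrix.smul_mul, one_mul, smul_smul, smul_smul]
  have : δ / A.det * δ⁻¹ ^ (Fintype.card (Fin 2) - 1) * A.det = 1 := by
    rw [show Fintype.card (Fin 2) - 1 = 1 from rfl, pow_one]
    field_simp
  rw [this, one_smul]

theorem f₁_mul_of_mem {s : SL(2, ℂ)} (hs : s ∈ binaryOctahedral) :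
    ∃ ε : ℂ, ∀ A : Matrix (Fin 2) (Fin 2) ℂ, f₁ (A * s.1) = ε • f₁ A := by
  obtain ⟨ε, hε, h⟩ := binaryOctahedral_le_stabilizer (inv_mem hs)
  refine ⟨ε, fun A => ?_⟩
  have h1 : subst (s⁻¹ : SL(2, ℂ)).1 octahedralForm.1 = C ε * octahedralForm.1 :=
    MvPolynomial.funext fun x => by rw [eval_subst, h, map_mul, eval_C]
  rw [Matrix.SpecialLinearGroup.coe_inv] at h1
  have h2 : subst (A * s.1).adjugate octahedralForm.1 =
      C ε * subst A.adjugate octahedralForm.1 := by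
    rw [Matrix.adjugate_mul_distrib, subst_mul, AlgHom.comp_apply, h1, map_mul]
    have h3 := (subst A.adjugate).commutes ε
    rw [algebraMap_eq] at h3
    rw [h3]
  unfold f₁
  rw [h2, sexticCoord_C_mul]

theorem octCoeff_mem {n : ℕ} {α β γ δ : MvPolynomial (Fin 2) ℂ} (hα : α ∈ V n) (hβ : β ∈ V n)
    (hγ : γ ∈ V n) (hδ : δ ∈ V n) (i : Fin 7) : octCoeff α β γ δ i ∈ V (6 * n) := by
  -- Each monomial of `octCoeff` has degree six and involves at most three of the entries; an
  -- exponent `0` pads those that involve only two.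
  have tm : ∀ (k a b c : ℕ) {p q r : MvPolynomial (Fin 2) ℂ}, p ∈ V n → q ∈ V n → r ∈ V n →
      a + b + c = 6 → (k : MvPolynomial (Fin 2) ℂ) * (p ^ a * q ^ b * r ^ c) ∈ V (6 * n) := by
    intro k a b c p q r hp hq hr habc
    rw [← nsmul_eq_mul]
    refine Submodule.smul_of_tower_mem _ k ?_
    rw [mem_homogeneousSubmodule] at hp hq hr ⊢
    convert ((hp.pow a).mul (hq.pow b)).mul (hr.pow c) using 1
    rw [← habc]
    ring
  fin_cases i
  · exact sub_mem (by simpa using tm 1 5 1 0 hα hγ hα rfl) (by simpa using tm 1 5 1 0 hγ hα hα rfl)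
  · exact sub_mem
      (add_mem (by simpa using tm 5 4 1 1 hα hβ hγ rfl) (by simpa using tm 1 5 1 0 hα hδ hα rfl))
      (add_mem (by simpa using tm 5 4 1 1 hγ hδ hα rfl) (by simpa using tm 1 5 1 0 hγ hβ hα rfl))
  · exact sub_mem
      (add_mem (by simpa using tm 10 3 2 1 hα hβ hγ rfl) (by simpa using tm 5 4 1 1 hα hβ hδ rfl))
      (add_mem (by simpa using tm 10 3 2 1 hγ hδ hα rfl) (by simpa using tm 5 4 1 1 hγ hδ hβ rfl))
  · exact sub_mem
      (add_mem (by simpa using tm 10 2 3 1 hα hβ hγ rfl) (by simpa using tm 10 3 2 1 hα hβ hδ rfl))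
      (add_mem (by simpa using tm 10 2 3 1 hγ hδ hα rfl) (by simpa using tm 10 3 2 1 hγ hδ hβ rfl))
  · exact sub_mem
      (add_mem (by simpa using tm 5 1 4 1 hα hβ hγ rfl) (by simpa using tm 10 2 3 1 hα hβ hδ rfl))
      (add_mem (by simpa using tm 5 1 4 1 hγ hδ hα rfl) (by simpa using tm 10 2 3 1 hγ hδ hβ rfl))
  · exact sub_mem
      (add_mem (by simpa using tm 1 5 1 0 hβ hγ hα rfl) (by simpa using tm 5 1 4 1 hα hβ hδ rfl))
      (add_mem (by simpa using tm 1 5 1 0 hδ hα hα rfl) (by simpa using tm 5 1 4 1 hγ hδ hβ rfl))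
  · exact sub_mem (by simpa using tm 1 5 1 0 hβ hδ hα rfl) (by simpa using tm 1 5 1 0 hδ hβ hα rfl)

/-- The components of `f₁` along a matrix of forms are forms. -/
theorem exists_f₁_formMatrix {n : ℕ} (a b c e : V n) :
    ∃ ψ : Fin 7 → MvPolynomial (Fin 2) ℂ, (∀ i, ψ i ∈ V (6 * n)) ∧
      ∀ x i, eval x (ψ i) = f₁ (formMatrix a b c e x) i := by
  refine ⟨fun i => C ((Real.sqrt (Nat.choose 6 i) : ℂ))⁻¹ * octCoeff e.1 (-b.1) (-c.1) a.1 i,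
    fun i => ?_, fun x i => ?_⟩
  · exact ((mem_homogeneousSubmodule _ _).1
      (octCoeff_mem e.2 (neg_mem b.2) (neg_mem c.2) a.2 i)).C_mul _
  · rw [map_mul, eval_C, map_octCoeff, f₁_apply, div_eq_inv_mul]
    simp [formMatrix]

end

/-! ### The index of the monomial subgroup -/

theorem mem_monomialSubgroup {A : binaryOctahedral} : A ∈ monomialSubgroup ↔
    (A.1.1 0 1 = 0 ∧ A.1.1 1 0 = 0) ∨ (A.1.1 0 0 = 0 ∧ A.1.1 1 1 = 0) := Iff.rfl

theorem xi_sq_mul_self : xi ^ 2 * xi ^ 2 = -1 := by rw [← pow_add, xi_pow_four]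

theorem xi_sq_ne_one : xi ^ 2 ≠ 1 := by
  intro h
  have := xi_sq_mul_self
  rw [h] at this
  norm_num at this

theorem xi_sq_ne_neg_one : xi ^ 2 ≠ -1 := by
  intro h
  have := xi_sq_mul_self
  rw [h] at this
  norm_num at this

theorem T₁₁_pow_mem_monomial (k : ℕ) (h : T₁₁ ^ k ∈ binaryOctahedral) :
    (⟨T₁₁ ^ k, h⟩ : binaryOctahedral) ∈ monomialSubgroup := by
  rw [mem_monomialSubgroup]
  left
  simp only [coe_T₁₁_pow]
  simp

/-- Used for `j = 1`, where the conjugate is not monomial, and for `j = 2`, where `ξ² + ξ⁻² = 0`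
makes it antidiagonal. -/
theorem coe_conj_T₁₁ (j : ℕ) : (T₃₀⁻¹ * T₁₁ ^ j * T₃₀).1 =
    !![(xi ^ j + (xi ^ j)⁻¹) / 2, ((xi ^ j)⁻¹ - xi ^ j) / 2;
      ((xi ^ j)⁻¹ - xi ^ j) / 2, (xi ^ j + (xi ^ j)⁻¹) / 2] := by
  have h2 : (Real.sqrt 2 : ℂ)⁻¹ * (Real.sqrt 2 : ℂ)⁻¹ = 2⁻¹ := by
    rw [← mul_inv, sqrt_two_mul_self]
  rw [Matrix.SpecialLinearGroup.coe_mul, Matrix.SpecialLinearGroup.coe_mul, coe_T₁₁_pow,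
    Matrix.SpecialLinearGroup.coe_inv, coe_T₃₀, Matrix.adjugate_fin_two_of]
  set s := (Real.sqrt 2 : ℂ)⁻¹
  ext i j'
  fin_cases i <;> fin_cases j' <;>
    simp only [Matrix.mul_apply, Fin.sum_univ_two] <;> simp
  · linear_combination (xi ^ j + (xi ^ j)⁻¹) * h2
  · linear_combination ((xi ^ j)⁻¹ - xi ^ j) * h2
  · linear_combination ((xi ^ j)⁻¹ - xi ^ j) * h2
  · linear_combination (xi ^ j + (xi ^ j)⁻¹) * h2

/-- Monomial matrices preserve the pair of opposite vertices `{0, ∞}` of the octahedron, and the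
cosets correspond to its three axes. Algebraically, in the normal form `T₁₁^(-j) T₃₀ T₁₁^k` the last
factor is monomial and `j` matters only modulo `2`, because `T₃₀⁻¹ T₁₁² T₃₀` is monomial. -/
theorem card_quotient_monomialSubgroup : Nat.card (binaryOctahedral ⧸ monomialSubgroup) = 3 := by
  let t : binaryOctahedral := ⟨T₁₁, T₁₁_mem⟩
  let r : binaryOctahedral := ⟨T₃₀, T₃₀_mem⟩
  have ht : ∀ k : ℕ, t ^ k ∈ monomialSubgroup := fun k =>
    T₁₁_pow_mem_monomial k (pow_mem T₁₁_mem k)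
  have hr : r ∉ monomialSubgroup := by
    rw [mem_monomialSubgroup]
    simp only [r, coe_T₃₀]
    simp
  have hr2 : r ^ 2 ∈ monomialSubgroup := by
    rw [mem_monomialSubgroup]
    right
    change (T₃₀ ^ 2).1 0 0 = 0 ∧ (T₃₀ ^ 2).1 1 1 = 0
    rw [coe_T₃₀_sq]
    simp
  have htr : r⁻¹ * t * r ∉ monomialSubgroup := by
    have h := coe_conj_T₁₁ 1
    rw [pow_one, pow_one] at h
    rw [mem_monomialSubgroup]
    change ¬ (((T₃₀⁻¹ * T₁₁ * T₃₀).1 0 1 = 0 ∧ _) ∨ ((T₃₀⁻¹ * T₁₁ * T₃₀).1 0 0 = 0 ∧ _))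
    rw [h]
    have h0 := xi_ne_zero
    rintro (⟨h1, -⟩ | ⟨h1, -⟩)
    · apply xi_sq_ne_one
      simp at h1
      field_simp at h1
      linear_combination -h1
    · apply xi_sq_ne_neg_one
      simp at h1
      field_simp at h1
      linear_combination h1
  have ht2r : r⁻¹ * t ^ 2 * r ∈ monomialSubgroup := by
    rw [mem_monomialSubgroup]
    right
    change (T₃₀⁻¹ * T₁₁ ^ 2 * T₃₀).1 0 0 = 0 ∧ (T₃₀⁻¹ * T₁₁ ^ 2 * T₃₀).1 1 1 = 0
    rw [coe_conj_T₁₁]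
    have h0 : xi ^ 2 + (xi ^ 2)⁻¹ = 0 := by
      have := xi_ne_zero
      field_simp
      rw [xi_pow_four]
      norm_num
    simp [h0]
  let F : Fin 3 → binaryOctahedral ⧸ monomialSubgroup :=
    ![QuotientGroup.mk 1, QuotientGroup.mk r, QuotientGroup.mk (t⁻¹ * r)]
  have h01 : (QuotientGroup.mk 1 : binaryOctahedral ⧸ monomialSubgroup) ≠ QuotientGroup.mk r := by
    rw [Ne, QuotientGroup.eq]; simpa using hr
  have h02 : (QuotientGroup.mk 1 : binaryOctahedral ⧸ monomialSubgroup) ≠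
      QuotientGroup.mk (t⁻¹ * r) := by
    rw [Ne, QuotientGroup.eq, inv_one, one_mul]
    intro h
    exact hr ((Subgroup.mul_mem_cancel_left _ (inv_mem (by simpa using ht 1))).1 h)
  have h12 : (QuotientGroup.mk r : binaryOctahedral ⧸ monomialSubgroup) ≠
      QuotientGroup.mk (t⁻¹ * r) := by
    rw [Ne, QuotientGroup.eq]
    intro h
    apply htr
    have := inv_mem h
    simpa [mul_assoc] using this
  have hF : Function.Bijective F := by
    constructor
    · intro i j hij
      fin_cases i <;> fin_cases j <;> first | rfl | skip
      · exact absurd hij h01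
      · exact absurd hij h02
      · exact absurd hij.symm h01
      · exact absurd hij h12
      · exact absurd hij.symm h02
      · exact absurd hij.symm h12
    · intro q
      obtain ⟨A, rfl⟩ := QuotientGroup.mk_surjective q
      rcases exists_rep_of_mem_stabilizer (binaryOctahedral_le_stabilizer A.2) with
        ⟨k, -, h⟩ | ⟨k, -, h⟩ | ⟨j, hj, k, -, h⟩
      · have hA : A = t ^ k := Subtype.ext h
        refine ⟨0, QuotientGroup.eq.2 ?_⟩
        rw [hA, inv_one, one_mul]
        exact ht k
      · have hA : A = (r ^ 2)⁻¹ * t ^ k := Subtype.ext h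
        refine ⟨0, QuotientGroup.eq.2 ?_⟩
        rw [hA, inv_one, one_mul]
        exact mul_mem (inv_mem hr2) (ht k)
      · have hA : A = (t ^ j)⁻¹ * r * t ^ k := Subtype.ext h
        rcases Nat.even_or_odd' j with ⟨i, rfl | rfl⟩
        · refine ⟨1, QuotientGroup.eq.2 ?_⟩
          rw [hA, show r⁻¹ * ((t ^ (2 * i))⁻¹ * r * t ^ k) = (r⁻¹ * t ^ 2 * r)⁻¹ ^ i * t ^ k by
            rw [mul_inv_rev, mul_inv_rev, inv_inv, ← mul_assoc r⁻¹, ← mul_assoc r⁻¹]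
            congr 1
            rw [← mul_assoc, show r⁻¹ * (t ^ 2)⁻¹ * r = r⁻¹ * (t ^ 2)⁻¹ * r⁻¹⁻¹ by rw [inv_inv],
              conj_pow, inv_inv, inv_pow, ← pow_mul]]
          exact mul_mem (pow_mem (inv_mem ht2r) i) (ht k)
        · refine ⟨2, QuotientGroup.eq.2 ?_⟩
          rw [hA, show (t⁻¹ * r)⁻¹ * ((t ^ (2 * i + 1))⁻¹ * r * t ^ k) =
              (r⁻¹ * t ^ 2 * r)⁻¹ ^ i * t ^ k by
            rw [mul_inv_rev, mul_inv_rev, mul_inv_rev, inv_inv, inv_inv, ← mul_assoc (r⁻¹ * t),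
              ← mul_assoc (r⁻¹ * t)]
            congr 1
            rw [← mul_assoc r⁻¹, show r⁻¹ * (t ^ 2)⁻¹ * r = r⁻¹ * (t ^ 2)⁻¹ * r⁻¹⁻¹ by
              rw [inv_inv], conj_pow, inv_inv, inv_pow, ← pow_mul]
            congr 1
            rw [pow_succ', mul_inv_rev]
            group]
          exact mul_mem (pow_mem (inv_mem ht2r) i) (ht k)
  rw [← Nat.card_eq_of_bijective F hF]
  simp

/-- A `2`-subgroup of `S₄*` is conjugate to a group of monomial matrices. -/
theorem exists_conj_mem_monomialSubgroup {S : Type*} [Group S] (hS : IsPGroup 2 S)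
    (f : S →* binaryOctahedral) : ∃ h, ∀ s, h⁻¹ * f s * h ∈ monomialSubgroup := by
  -- A 2-group acting on three cosets fixes one of them.
  let _ : MulAction S (binaryOctahedral ⧸ monomialSubgroup) := MulAction.compHom _ f
  obtain ⟨q, hq⟩ := hS.nonempty_fixed_point_of_prime_not_dvd_card
    (binaryOctahedral ⧸ monomialSubgroup) (by rw [card_quotient_monomialSubgroup]; norm_num)
  obtain ⟨h, rfl⟩ := QuotientGroup.mk_surjective q
  refine ⟨h, fun s => ?_⟩
  have h1 : QuotientGroup.mk (f s * h) = (QuotientGroup.mk h : binaryOctahedral ⧸ monomialSubgroup) :=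
    hq s
  have h2 := QuotientGroup.eq.1 h1.symm
  rwa [mul_assoc]

/-! ### Sign characters -/

theorem mul_eq_one_of_ne_one {u v : rootsOfUnity 2 ℂ} (hu : u ≠ 1) (hv : v ≠ 1) : u * v = 1 := by
  have key : ∀ w : rootsOfUnity 2 ℂ, w ≠ 1 → ((w : ℂˣ) : ℂ) = -1 := by
    intro w hw
    have h := (mem_rootsOfUnity' 2 (w : ℂˣ)).1 w.2
    rw [sq] at h
    rcases mul_self_eq_one_iff.1 h with h | h
    · exact absurd (Subtype.ext (Units.ext h)) hw
    · exact h
  apply Subtype.ext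
  apply Units.ext
  push_cast
  rw [key u hu, key v hv]
  norm_num

/-- If all squares of a finite group lie in a cyclic normal subgroup, then every element outside
of this subgroup is detected by a sign character that is trivial on it. -/
theorem exists_sign_character_of_sq_mem {S : Type*} [Group S] [Finite S] (z a : S)
    (hconj : ∀ g : S, g * z * g⁻¹ ∈ Subgroup.zpowers z) (hsq : ∀ g : S, g ^ 2 ∈ Subgroup.zpowers z)
    (ha : a ∉ Subgroup.zpowers z) :
    ∃ χ : S →* rootsOfUnity 2 ℂ, χ a ≠ 1 ∧ χ z = 1 := by
  have hN : (Subgroup.zpowers z).Normal := by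
    refine ⟨fun x hx g => ?_⟩
    obtain ⟨n, rfl⟩ := Subgroup.mem_zpowers_iff.1 hx
    rw [← conj_zpow]
    exact Subgroup.zpow_mem _ (hconj g) n
  have hsq' : ∀ q : S ⧸ Subgroup.zpowers z, q * q = 1 := by
    intro q
    obtain ⟨g, rfl⟩ := QuotientGroup.mk_surjective q
    rw [← QuotientGroup.mk_mul, QuotientGroup.eq_one_iff, ← sq]
    exact hsq g
  -- A group in which every square is trivial is abelian, so its characters separate points, and
  -- their values are square roots of `1`.
  let _ : CommGroup (S ⧸ Subgroup.zpowers z) :=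
    { (inferInstance : Group (S ⧸ Subgroup.zpowers z)) with
      mul_comm := fun p q => by
        have h1 : ∀ x : S ⧸ Subgroup.zpowers z, x⁻¹ = x := fun x => inv_eq_of_mul_eq_one_right (hsq' x)
        rw [← h1 (p * q), mul_inv_rev, h1, h1] }
  have : NeZero (Monoid.exponent (S ⧸ Subgroup.zpowers z)) :=
    ⟨Monoid.exponent_ne_zero_of_finite⟩
  obtain ⟨χ, hχ⟩ := CommGroup.exists_apply_ne_one_of_hasEnoughRootsOfUnity
    (S ⧸ Subgroup.zpowers z) ℂ (a := (a : S ⧸ Subgroup.zpowers z))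
    (by rwa [Ne, QuotientGroup.eq_one_iff])
  refine ⟨(χ.comp (QuotientGroup.mk' _)).codRestrict (rootsOfUnity 2 ℂ) fun g => ?_, ?_, ?_⟩
  · rw [mem_rootsOfUnity, MonoidHom.comp_apply, ← map_pow, sq, hsq', map_one]
  · intro h
    exact hχ (congrArg Subtype.val h)
  · apply Subtype.ext
    change χ (z : S ⧸ Subgroup.zpowers z) = 1
    rw [(QuotientGroup.eq_one_iff z).2 (Subgroup.mem_zpowers z), map_one]

/-! ### Signs and squares in groups of pairs `(t, s)`. -/

theorem neg_one_ne_one : (-1 : SL(2, ℂ)) ≠ 1 := by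
  intro h
  have := congrArg (fun A : SL(2, ℂ) => A.1 0 0) h
  norm_num at this

/-- With determinant `1`, trace zero would force `t² = -1`. So the trace is nonzero, and the
off-diagonal entries of `t² = 1` show that `t` is diagonal. -/
theorem eq_one_or_neg_one_of_sq_eq_one {t : SL(2, ℂ)} (h : t ^ 2 = 1) : t = 1 ∨ t = -1 := by
  have hdet := t.2
  rw [Matrix.det_fin_two] at hdet
  have hent : ∀ i j, (t.1 * t.1) i j = (1 : Matrix (Fin 2) (Fin 2) ℂ) i j := by
    intro i j
    rw [← Matrix.SpecialLinearGroup.coe_mul, ← sq, h, Matrix.SpecialLinearGroup.coe_one]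
  have h00 := hent 0 0
  have h01 := hent 0 1
  have h10 := hent 1 0
  simp only [Matrix.mul_apply, Fin.sum_univ_two, Matrix.one_apply] at h00 h01 h10
  norm_num at h00 h01 h10
  have htr : t.1 0 0 + t.1 1 1 ≠ 0 := by
    intro h0
    have : (2 : ℂ) = 0 := by linear_combination t.1 0 0 * h0 - h00 - hdet
    norm_num at this
  have e01 : t.1 0 1 = 0 := by
    refine (mul_eq_zero.1 (?_ : t.1 0 1 * (t.1 0 0 + t.1 1 1) = 0)).resolve_right htr
    linear_combination h01
  have e10 : t.1 1 0 = 0 := by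
    refine (mul_eq_zero.1 (?_ : t.1 1 0 * (t.1 0 0 + t.1 1 1) = 0)).resolve_right htr
    linear_combination h10
  rw [e01, zero_mul, add_zero] at h00
  rw [e01, zero_mul, sub_zero] at hdet
  rcases mul_self_eq_one_iff.1 h00 with h1 | h1
  · left
    rw [h1, one_mul] at hdet
    apply Subtype.ext
    ext i j
    fin_cases i <;> fin_cases j <;> simp [h1, e01, e10, hdet]
  · right
    rw [h1, neg_one_mul, neg_eq_iff_eq_neg] at hdet
    apply Subtype.ext
    ext i j
    fin_cases i <;> fin_cases j <;> simp [h1, e01, e10, hdet]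

theorem T₁₁_pow_four : T₁₁ ^ 4 = -1 := by
  apply Subtype.ext
  rw [coe_T₁₁_pow, xi_pow_four]
  ext i j
  fin_cases i <;> fin_cases j <;> simp [inv_neg]

theorem T₁₁_pow_eight : T₁₁ ^ 8 = 1 := by
  rw [show 8 = 4 * 2 by norm_num, pow_mul, T₁₁_pow_four, neg_sq, one_pow]

theorem neg_one_mem_binaryOctahedral : (-1 : SL(2, ℂ)) ∈ binaryOctahedral :=
  T₁₁_pow_four ▸ pow_mem T₁₁_mem 4

/-- An element of the monomial group is a power of `T₁₁` or squares to `-1`. -/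
theorem eq_pow_or_sq_eq_neg_one {A : binaryOctahedral} (hA : A ∈ monomialSubgroup) :
    (∃ k : ℕ, A.1 = T₁₁ ^ k) ∨ A.1 ^ 2 = -1 := by
  rcases hA with ⟨h1, h2⟩ | ⟨h1, h2⟩
  · obtain ⟨k, -, h⟩ := eq_T₁₁_pow_of_entry_eq_zero (binaryOctahedral_le_stabilizer A.2) h2
    exact Or.inl ⟨k, h⟩
  · right
    have hdet := A.1.2
    rw [Matrix.det_fin_two, h1, zero_mul, zero_sub] at hdet
    apply Subtype.ext
    rw [sq, Matrix.SpecialLinearGroup.coe_mul]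
    ext i j
    fin_cases i <;> fin_cases j <;> simp [Matrix.mul_apply, h1, h2]
    · linear_combination -hdet
    · linear_combination -hdet

/-- The second component of `e²` is `-1`, so its first component is a sign. If that sign were `1`,
then `e.1 = ±1`, hence `e.2 = ±1` and `e.2² = 1`. -/
theorem sq_fst_eq_neg_one {E : Subgroup (SL(2, ℂ) × SL(2, ℂ))}
    (hE : ∀ e ∈ E, (e.1 = 1 ∨ e.1 = -1) ↔ (e.2 = 1 ∨ e.2 = -1))
    {e : SL(2, ℂ) × SL(2, ℂ)} (he : e ∈ E) (h : e.2 ^ 2 = -1) : e.1 ^ 2 = -1 := by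
  rcases (hE (e ^ 2) (pow_mem he 2)).2 (Or.inr h) with h1 | h1
  · exfalso
    rcases (hE e he).1 (eq_one_or_neg_one_of_sq_eq_one h1) with h2 | h2
    · rw [h2, one_pow] at h
      exact neg_one_ne_one h.symm
    · rw [h2, neg_sq, one_pow] at h
      exact neg_one_ne_one h.symm
  · exact h1

theorem sq_fst_eq_one {E : Subgroup (SL(2, ℂ) × SL(2, ℂ))}
    (hE : ∀ e ∈ E, (e.1 = 1 ∨ e.1 = -1) ↔ (e.2 = 1 ∨ e.2 = -1))
    {e : SL(2, ℂ) × SL(2, ℂ)} (he : e ∈ E) (h : e.2 ^ 2 = 1) : e.1 ^ 2 = 1 := by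
  rcases (hE e he).2 (eq_one_or_neg_one_of_sq_eq_one h) with h1 | h1 <;> simp [h1]

/-- In a `2`-group `S` of pairs `(t, s)`, with `s ∈ S₄*` and such that `t = ±1` if and only if
`s = ±1`, all squares lie in a cyclic normal subgroup that contains `(-1, -1)` but
not `(-1, 1)`. -/
theorem exists_cyclic_of_isPGroup {S : Subgroup (SL(2, ℂ) × SL(2, ℂ))} (hS : IsPGroup 2 S)
    (hO : ∀ e ∈ S, e.2 ∈ binaryOctahedral)
    (hE : ∀ e ∈ S, (e.1 = 1 ∨ e.1 = -1) ↔ (e.2 = 1 ∨ e.2 = -1)) (hab : (-1, -1) ∈ S) :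
    ∃ z : S, (∀ g : S, g * z * g⁻¹ ∈ Subgroup.zpowers z) ∧ (∀ g : S, g ^ 2 ∈ Subgroup.zpowers z) ∧
      (⟨(-1, -1), hab⟩ : S) ∈ Subgroup.zpowers z ∧
      ∀ ha : (-1, 1) ∈ S, (⟨(-1, 1), ha⟩ : S) ∉ Subgroup.zpowers z := by
  let f : S →* binaryOctahedral :=
    ((MonoidHom.snd _ _).comp S.subtype).codRestrict binaryOctahedral fun e => hO e.1 e.2
  obtain ⟨h, hh⟩ := exists_conj_mem_monomialSubgroup hS f
  set m : S := ⟨(-1, -1), hab⟩ with hm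
  have hpow : ∀ (e : S) (n : ℕ), e.1.2 ^ n = h.1 * (h⁻¹ * f e * h).1 ^ n * h.1⁻¹ := by
    intro e n
    rw [← conj_pow]
    congr 1
    change e.1.2 = h.1 * (h.1⁻¹ * e.1.2 * h.1) * h.1⁻¹
    group
  have hneg : ∀ e : S, e.1.2 ^ 2 = -1 → e ^ 2 = m := fun e he =>
    Subtype.ext (Prod.ext (sq_fst_eq_neg_one hE e.2 he) he)
  have hone : ∀ e : S, e.1.2 ^ 2 = 1 → e ^ 2 = 1 := fun e he =>
    Subtype.ext (Prod.ext (sq_fst_eq_one hE e.2 he) he)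
  have hm2 : m ^ 2 = 1 := Subtype.ext (Prod.ext (by simp [hm]) (by simp [hm]))
  have heven : ∀ e : S, (∃ i : ℕ, (h⁻¹ * f e * h).1 = T₁₁ ^ (2 * i)) → e ^ 2 = 1 ∨ e ^ 2 = m := by
    rintro e ⟨i, hi⟩
    have h1 := hpow e 2
    rw [hi, ← pow_mul, show 2 * i * 2 = 4 * i by ring, pow_mul, T₁₁_pow_four] at h1
    rcases neg_one_pow_eq_or SL(2, ℂ) i with h2 | h2
    · left; apply hone; rw [h1, h2]; group
    · right; apply hneg; rw [h1, h2]; simp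
  have hanti : ∀ e : S, (h⁻¹ * f e * h).1 ^ 2 = -1 → e ^ 2 = m := by
    intro e he
    apply hneg
    rw [hpow e 2, he]
    simp
  -- If no element is conjugated to an odd power of `T₁₁`, all squares are `1` or `m = (-1, -1)`,
  -- and `m` generates the desired subgroup. Otherwise `e₀ ^ 2` does, whose square is `m`.
  by_cases hodd : ∃ (e₀ : S) (k₀ : ℕ), Odd k₀ ∧ (h⁻¹ * f e₀ * h).1 = T₁₁ ^ k₀
  · obtain ⟨e₀, k₀, hk₀, he₀⟩ := hodd
    have hz2 : (e₀ ^ 2) ^ 2 = m := by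
      apply hneg
      change (e₀.1.2 ^ 2) ^ 2 = -1
      rw [← pow_mul, hpow, he₀, ← pow_mul, show k₀ * (2 * 2) = 4 * k₀ by ring, pow_mul,
        T₁₁_pow_four, hk₀.neg_one_pow]
      simp
    have hmz : m ∈ Subgroup.zpowers (e₀ ^ 2) := hz2 ▸ pow_mem (Subgroup.mem_zpowers _) 2
    have hsq : ∀ g : S, g ^ 2 ∈ Subgroup.zpowers (e₀ ^ 2) := by
      intro g
      rcases eq_pow_or_sq_eq_neg_one (hh g) with ⟨k, hk⟩ | hk
      · rcases Nat.even_or_odd' k with ⟨i, rfl | rfl⟩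
        · rcases heven g ⟨i, hk⟩ with h1 | h1 <;> rw [h1]
          · exact one_mem _
          · exact hmz
        · set k := 2 * i + 1
          -- `g` and `e₀ ^ (k₀ * k)` have the same second component
          have h8 : T₁₁ ^ k = T₁₁ ^ (k₀ * (k₀ * k)) := by
            obtain ⟨l, rfl⟩ := hk₀
            obtain ⟨r, hr⟩ := Nat.even_mul_succ_self l
            have h9 : (2 * l + 1) * ((2 * l + 1) * k) = 8 * (r * k) + k := by
              linear_combination 4 * k * hr
            rw [h9, pow_add T₁₁ (8 * (r * k)), pow_mul T₁₁ 8, T₁₁_pow_eight, one_pow, one_mul]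
          have hsnd : g.1.2 = e₀.1.2 ^ (k₀ * k) := by
            have h10 := hpow g 1
            rw [pow_one, pow_one, hk, h8] at h10
            rw [h10, hpow, he₀, ← pow_mul]
          -- The discrepancy `c` has second component `1`, hence first component `±1`. It is
          -- therefore central of square `1` and drops out of `g²`.
          set c : S := g * (e₀ ^ (k₀ * k))⁻¹ with hc
          have hc2 : c.1.2 = 1 := by
            change g.1.2 * (e₀.1.2 ^ (k₀ * k))⁻¹ = 1
            rw [hsnd, mul_inv_cancel]
          have hcomm : Commute c (e₀ ^ (k₀ * k)) := by
            refine Subtype.ext (Prod.ext ?_ ?_)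
            · change c.1.1 * (e₀ ^ (k₀ * k)).1.1 = (e₀ ^ (k₀ * k)).1.1 * c.1.1
              rcases (hE c.1 c.2).2 (Or.inl hc2) with h1 | h1 <;> rw [h1] <;> simp
            · change c.1.2 * (e₀ ^ (k₀ * k)).1.2 = (e₀ ^ (k₀ * k)).1.2 * c.1.2
              rw [hc2, one_mul, mul_one]
          have hg : g = c * e₀ ^ (k₀ * k) := by rw [hc]; group
          rw [hg, hcomm.mul_pow, hone c (by rw [hc2, one_pow]), one_mul, ← pow_mul,
            mul_comm (k₀ * k), pow_mul]
          exact pow_mem (Subgroup.mem_zpowers _) _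
      · rw [hanti g hk]
        exact hmz
    refine ⟨e₀ ^ 2, fun g => ?_, hsq, hmz, fun ha hmem => ?_⟩
    · rw [← conj_pow]
      exact hsq _
    · obtain ⟨n, hn⟩ := Subgroup.mem_zpowers_iff.1 hmem
      -- Even powers of `e₀ ^ 2` are powers of `(-1, -1)` and have equal components; odd powers
      -- square to `(-1, -1)`, whereas `(-1, 1)` squares to `1`.
      rcases Int.even_or_odd' n with ⟨i, rfl | rfl⟩
      · rw [zpow_mul, zpow_ofNat, hz2] at hn
        have h1 := congrArg (fun e : S => e.1.1) hn
        have h2 := congrArg (fun e : S => e.1.2) hn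
        simp only [hm] at h1 h2
        exact neg_one_ne_one (h1.symm.trans h2)
      · have h2 : ((e₀ ^ 2) ^ (2 * i + 1)) ^ 2 = m := by
          rw [← zpow_natCast, ← zpow_mul, mul_comm, zpow_mul, zpow_natCast, hz2, zpow_add, zpow_mul,
            zpow_ofNat, hm2, one_zpow, one_mul, zpow_one]
        rw [hn] at h2
        have h3 := congrArg (fun e : S => e.1.2) h2
        simp only [hm] at h3
        refine neg_one_ne_one (h3.symm.trans ?_)
        change (1 : SL(2, ℂ)) ^ 2 = 1
        simp
  · refine ⟨m, fun g => ?_, fun g => ?_, Subgroup.mem_zpowers m, fun ha hmem => ?_⟩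
    · have : g * m * g⁻¹ = m := by
        refine Subtype.ext (Prod.ext ?_ ?_)
        · change g.1.1 * (-1) * g.1.1⁻¹ = -1
          simp
        · change g.1.2 * (-1) * g.1.2⁻¹ = -1
          simp
      rw [this]
      exact Subgroup.mem_zpowers m
    · rcases eq_pow_or_sq_eq_neg_one (hh g) with ⟨k, hk⟩ | hk
      · rcases Nat.even_or_odd' k with ⟨i, rfl | rfl⟩
        · rcases heven g ⟨i, hk⟩ with h1 | h1 <;> rw [h1]
          · exact one_mem _
          · exact Subgroup.mem_zpowers m
        · exact absurd ⟨g, _, ⟨i, rfl⟩, hk⟩ hodd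
      · rw [hanti g hk]
        exact Subgroup.mem_zpowers m
    · obtain ⟨n, hn⟩ := Subgroup.mem_zpowers_iff.1 hmem
      have h1 := congrArg (fun e : S => e.1.1) hn
      have h2 := congrArg (fun e : S => e.1.2) hn
      exact neg_one_ne_one (h1.symm.trans h2)

/-- A group `E` of pairs `(t, s)`, with `s ∈ S₄*` and such that `t = ±1` if and only if `s = ±1`,
has a sign character that is nontrivial on `(-1, 1)` and on `(1, -1)`. -/
theorem exists_sign_character {E : Subgroup (SL(2, ℂ) × SL(2, ℂ))} [Finite E]
    (hO : ∀ e ∈ E, e.2 ∈ binaryOctahedral)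
    (hE : ∀ e ∈ E, (e.1 = 1 ∨ e.1 = -1) ↔ (e.2 = 1 ∨ e.2 = -1))
    (ha : (-1, 1) ∈ E) (hb : (1, -1) ∈ E) :
    ∃ ε : E →* rootsOfUnity 2 ℂ, ε ⟨(-1, 1), ha⟩ ≠ 1 ∧ ε ⟨(1, -1), hb⟩ ≠ 1 := by
  set a : E := ⟨(-1, 1), ha⟩ with hadef
  set b : E := ⟨(1, -1), hb⟩ with hbdef
  -- Transfer to `P` sends a central element to its power of exponent the index of `P`. The index is
  -- odd, so the involutions `a` and `b` equal these powers: they lie in `P`, and a character of `P`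
  -- keeps its values on them.
  obtain ⟨P⟩ : Nonempty (Sylow 2 E) := inferInstance
  have hodd : Odd (P : Subgroup E).index :=
    Nat.not_even_iff_odd.1 fun h => P.not_dvd_index (even_iff_two_dvd.1 h)
  have hcentral : ∀ x : E, (x = a ∨ x = b) → ∀ (k : ℕ) (g : E), g⁻¹ * x ^ k * g = x ^ k := by
    intro x hx k g
    have hc : Commute (x ^ k) g := by
      apply Commute.pow_left
      refine Subtype.ext (Prod.ext ?_ ?_)
      · change x.1.1 * g.1.1 = g.1.1 * x.1.1
        rcases hx with rfl | rfl <;> simp [hadef, hbdef]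
      · change x.1.2 * g.1.2 = g.1.2 * x.1.2
        rcases hx with rfl | rfl <;> simp [hadef, hbdef]
    rw [mul_assoc, hc.eq, inv_mul_cancel_left]
  have hpow : ∀ x : E, (x = a ∨ x = b) → x ^ (P : Subgroup E).index = x := by
    intro x hx
    have hx2 : x ^ 2 = 1 := by
      refine Subtype.ext (Prod.ext ?_ ?_)
      · change x.1.1 ^ 2 = 1
        rcases hx with rfl | rfl <;> simp [hadef, hbdef]
      · change x.1.2 ^ 2 = 1
        rcases hx with rfl | rfl <;> simp [hadef, hbdef]
    obtain ⟨i, hi⟩ := hodd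
    rw [hi, pow_succ, pow_mul, hx2, one_pow, one_mul]
  have hmem : ∀ x : E, (x = a ∨ x = b) → x ∈ (P : Subgroup E) := fun x hx =>
    hpow x hx ▸ MonoidHom.transfer_eq_pow_aux x fun k g _ => hcentral x hx k g
  let S : Subgroup (SL(2, ℂ) × SL(2, ℂ)) := (P : Subgroup E).map E.subtype
  have hSE : S ≤ E := Subgroup.map_subtype_le _
  let i : (P : Subgroup E) ≃* S :=
    (P : Subgroup E).equivMapOfInjective E.subtype E.subtype_injective
  have hS : IsPGroup 2 S := P.2.of_equiv i
  have haS : ((-1, 1) : SL(2, ℂ) × SL(2, ℂ)) ∈ S := ⟨a, hmem a (Or.inl rfl), rfl⟩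
  have habS : ((-1, -1) : SL(2, ℂ) × SL(2, ℂ)) ∈ S :=
    ⟨a * b, mul_mem (hmem a (Or.inl rfl)) (hmem b (Or.inr rfl)), by simp [hadef, hbdef]⟩
  have : Finite S := Finite.of_equiv _ i.toEquiv
  obtain ⟨z, hconj, hsq, hmz, haz⟩ := exists_cyclic_of_isPGroup hS (fun e he => hO e (hSE he))
    (fun e he => hE e (hSE he)) habS
  obtain ⟨χ, hχa, hχz⟩ := exists_sign_character_of_sq_mem z _ hconj hsq (haz haS)
  -- Since `χ` is trivial on `ab = (-1, -1)` and nontrivial on `a`, it is nontrivial on `b` too.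
  have hχab : χ ⟨_, habS⟩ = 1 := by
    obtain ⟨n, hn⟩ := Subgroup.mem_zpowers_iff.1 hmz
    rw [← hn, map_zpow, hχz, one_zpow]
  let ψ : (P : Subgroup E) →* rootsOfUnity 2 ℂ := χ.comp i.toMonoidHom
  have htr : ∀ (x : E) (hx : x = a ∨ x = b),
      MonoidHom.transfer ψ x = ψ ⟨x, hmem x hx⟩ := by
    intro x hx
    rw [MonoidHom.transfer_eq_pow ψ x fun k g _ => hcentral x hx k g]
    congr 1
    exact Subtype.ext (hpow x hx)
  refine ⟨MonoidHom.transfer ψ, ?_, ?_⟩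
  · rw [htr a (Or.inl rfl)]
    exact hχa
  · rw [htr b (Or.inr rfl)]
    intro h
    apply hχa
    have h1 : χ (i ⟨b, hmem b (Or.inr rfl)⟩) = 1 := h
    have h2 : (⟨(-1, 1), haS⟩ : S) = ⟨(-1, -1), habS⟩ * (i ⟨b, hmem b (Or.inr rfl)⟩) := by
      refine Subtype.ext (Prod.ext ?_ ?_)
      · change (-1 : SL(2, ℂ)) = -1 * 1
        rw [mul_one]
      · change (1 : SL(2, ℂ)) = -1 * -1
        simp
    rw [h2, map_mul, hχab, h1, mul_one]

/-- A correspondence `E` between `H ⊂ SL₂` and `S₄*` that is one-to-one up to signs contains the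
graph of an injective homomorphism. -/
theorem exists_injective_lift {H : Subgroup SL(2, ℂ)} [Finite H]
    (E : Subgroup (SL(2, ℂ) × SL(2, ℂ))) (hH : ∀ e ∈ E, e.1 ∈ H)
    (hO : ∀ e ∈ E, e.2 ∈ binaryOctahedral)
    (hE : ∀ e ∈ E, (e.1 = 1 ∨ e.1 = -1) ↔ (e.2 = 1 ∨ e.2 = -1))
    (ha : (-1, 1) ∈ E) (hb : (1, -1) ∈ E) (hsurj : ∀ t ∈ H, ∃ s, (t, s) ∈ E) :
    ∃ φ₂ : H →* binaryOctahedral, Function.Injective φ₂ ∧ ∀ t : H, (t.1, (φ₂ t).1) ∈ E := by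
  have : Finite E := by
    refine Finite.of_injective
      (fun e : E => ((⟨e.1.1, hH _ e.2⟩, ⟨e.1.2, hO _ e.2⟩) : H × binaryOctahedral)) ?_
    intro e e' h
    simp only [Prod.mk.injEq, Subtype.mk.injEq] at h
    exact Subtype.ext (Prod.ext h.1 h.2)
  obtain ⟨ε, hεa, hεb⟩ := exists_sign_character hO hE ha hb
  -- The kernel of `ε` meets the fibre over each `t` exactly once: two elements of a fibre differ by
  -- `(1, ±1)`, and `(1, -1)` is not in the kernel. Multiplication by `(1, -1)` moves any element of
  -- the fibre into it.
  have huniq : ∀ {t s s' : SL(2, ℂ)} (h : (t, s) ∈ E) (h' : (t, s') ∈ E), ε ⟨_, h⟩ = 1 →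
      ε ⟨_, h'⟩ = 1 → s = s' := by
    intro t s s' h h' h1 h1'
    have hq : (1, s⁻¹ * s') ∈ E := by simpa using mul_mem (inv_mem h) h'
    have hq1 : ε ⟨_, hq⟩ = 1 := by
      have : (⟨_, hq⟩ : E) = ⟨_, h⟩⁻¹ * ⟨_, h'⟩ := Subtype.ext (by simp)
      rw [this, map_mul, map_inv, h1, h1', inv_one, mul_one]
    rcases (hE _ hq).1 (Or.inl rfl) with h2 | h2
    · exact inv_mul_eq_one.1 h2
    · exfalso
      apply hεb
      rw [← hq1]
      congr 1
      exact Subtype.ext (Prod.ext rfl h2.symm)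
  have hex : ∀ t : H, ∃ s, ∃ h : (t.1, s) ∈ E, ε ⟨_, h⟩ = 1 := by
    intro t
    obtain ⟨s, hs⟩ := hsurj t.1 t.2
    by_cases h1 : ε ⟨_, hs⟩ = 1
    · exact ⟨s, hs, h1⟩
    · have hs' : (t.1, s * -1) ∈ E := by simpa using mul_mem hs hb
      refine ⟨s * -1, hs', ?_⟩
      have : (⟨_, hs'⟩ : E) = ⟨_, hs⟩ * ⟨_, hb⟩ := Subtype.ext (by simp)
      rw [this, map_mul]
      exact mul_eq_one_of_ne_one h1 hεb
  choose s hs hs1 using hex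
  refine ⟨MonoidHom.mk' (fun t => ⟨s t, hO _ (hs t)⟩) fun t t' => Subtype.ext ?_, ?_, hs⟩
  · have hm : ((t * t' : H).1, s t * s t') ∈ E := mul_mem (hs t) (hs t')
    refine huniq (hs (t * t')) hm (hs1 _) ?_
    have : (⟨_, hm⟩ : E) = ⟨_, hs t⟩ * ⟨_, hs t'⟩ := Subtype.ext (by simp)
    exact (congrArg ε this).trans (by rw [map_mul, hs1, hs1, one_mul])
  · rw [injective_iff_map_eq_one]
    intro t ht
    have ht1 : s t = 1 := congrArg Subtype.val ht
    rcases (hE _ (hs t)).2 (Or.inl ht1) with h2 | h2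
    · exact Subtype.ext h2
    · exfalso
      apply hεa
      rw [← hs1 t]
      congr 1
      exact Subtype.ext (Prod.ext h2.symm ht1.symm)

section

open MvPolynomial

/-! ### Morphisms given by forms -/

theorem mul_eq_mul_of_mk_eq {ι : Type*} {v w : ι → ℂ} {hv : v ≠ 0} {hw : w ≠ 0}
    (h : Projectivization.mk ℂ v hv = Projectivization.mk ℂ w hw) (i j : ι) :
    v i * w j = v j * w i := by
  obtain ⟨a, rfl⟩ := (Projectivization.mk_eq_mk_iff' ℂ _ _ _ _).1 h
  simp only [Pi.smul_apply, smul_eq_mul]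
  ring

theorem mk_eq_mk_of_mul_eq {ι : Type*} {v w : ι → ℂ} (hv : v ≠ 0) (hw : w ≠ 0)
    (h : ∀ i j, v i * w j = v j * w i) :
    Projectivization.mk ℂ v hv = Projectivization.mk ℂ w hw := by
  obtain ⟨j, hj⟩ := Function.ne_iff.1 hw
  rw [Projectivization.mk_eq_mk_iff']
  refine ⟨v j / w j, ?_⟩
  ext i
  rw [Pi.smul_apply, smul_eq_mul, div_mul_eq_mul_div, div_eq_iff hj, h i j]

theorem exists_forms {k m : ℕ} {F : P1 → ℙ ℂ (Fin k → ℂ)} (hF : IsMorphismOfDegree m F) :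
    ∃ p : Fin k → MvPolynomial (Fin 2) ℂ, (∀ i, p i ∈ V m) ∧
      ∀ (x : Fin 2 → ℂ) (hx : x ≠ 0), ∃ h : (fun i => eval x (p i)) ≠ 0,
        F (Projectivization.mk ℂ x hx) = Projectivization.mk ℂ (fun i => eval x (p i)) h := by
  obtain ⟨Φ, hΦ, hF⟩ := hF
  choose p hp hpe using fun i => hΦ (LinearMap.proj i)
  have h1 : ∀ x, Φ x = fun i => eval x (p i) := fun x => funext fun i => hpe i x
  refine ⟨p, hp, fun x hx => ?_⟩
  obtain ⟨h, hF⟩ := hF x hx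
  rw [← h1]
  exact ⟨h, hF⟩

/-- Linear functionals detect that `Φ` is homogeneous of degree `m`, so its class does not depend on
the representative of a point. -/
theorem exists_morphism {E : Type*} [AddCommGroup E] [Module ℂ E] {m : ℕ} (Φ : (Fin 2 → ℂ) → E)
    (hΦ : ∀ ℓ : Module.Dual ℂ E, ∃ p ∈ V m, ∀ x, ℓ (Φ x) = eval x p)
    (h0 : ∀ x, x ≠ 0 → Φ x ≠ 0) :
    ∃ F : P1 → ℙ ℂ E, IsMorphismOfDegree m F ∧ ∀ (x : Fin 2 → ℂ) (hx : x ≠ 0),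
      F (Projectivization.mk ℂ x hx) = Projectivization.mk ℂ (Φ x) (h0 x hx) := by
  have hsm : ∀ (c : ℂ) x, Φ (c • x) = c ^ m • Φ x := by
    intro c x
    rw [← sub_eq_zero, ← Module.forall_dual_apply_eq_zero_iff ℂ]
    intro ℓ
    obtain ⟨p, hp, hpe⟩ := hΦ ℓ
    rw [map_sub, map_smul, hpe, hpe, eval_smul_of_mem hp, smul_eq_mul, sub_self]
  have hF : ∀ (x : Fin 2 → ℂ) (hx : x ≠ 0),
      Projectivization.mk ℂ (Φ (Projectivization.mk ℂ x hx).rep)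
        (h0 _ (Projectivization.rep_nonzero _)) = Projectivization.mk ℂ (Φ x) (h0 x hx) := by
    intro x hx
    obtain ⟨a, ha⟩ := Projectivization.exists_smul_eq_mk_rep ℂ x hx
    rw [Projectivization.mk_eq_mk_iff']
    refine ⟨(a : ℂ) ^ m, ?_⟩
    rw [← hsm, ← ha]
    rfl
  exact ⟨fun q => Projectivization.mk ℂ (Φ q.rep) (h0 _ q.rep_nonzero),
    ⟨Φ, hΦ, fun x hx => ⟨h0 x hx, hF x hx⟩⟩, hF⟩

theorem exists_form_of_dual {ι : Type*} [Fintype ι] {E : Type*} [AddCommGroup E] [Module ℂ E]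
    {m : ℕ} (b : Module.Basis ι ℂ E) (Φ : (Fin 2 → ℂ) → E) (p : ι → MvPolynomial (Fin 2) ℂ)
    (hp : ∀ i, p i ∈ V m) (hpe : ∀ x i, b.repr (Φ x) i = eval x (p i)) (ℓ : Module.Dual ℂ E) :
    ∃ p ∈ V m, ∀ x, ℓ (Φ x) = eval x p := by
  refine ⟨∑ i, C (ℓ (b i)) * p i, Submodule.sum_mem _ fun i _ =>
    ((mem_homogeneousSubmodule _ _).1 (hp i)).C_mul _, fun x => ?_⟩
  rw [← b.sum_repr (Φ x)]
  simp [hpe, mul_comm]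

/-! ### The covering -/

theorem moebius_mk (t : SL(2, ℂ)) (x : Fin 2 → ℂ) (hx : x ≠ 0) :
    ∃ h : t.1.mulVec x ≠ 0,
      moebius t (Projectivization.mk ℂ x hx) = Projectivization.mk ℂ (t.1.mulVec x) h :=
  ⟨(smul_ne_zero_iff_ne t).mpr hx, rfl⟩

theorem mulVec_inv_mulVec (t : SL(2, ℂ)) (x : Fin 2 → ℂ) :
    t.1.mulVec ((t⁻¹ : SL(2, ℂ)).1.mulVec x) = x := by
  rw [Matrix.mulVec_mulVec, ← Matrix.SpecialLinearGroup.coe_mul, mul_inv_cancel,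
    Matrix.SpecialLinearGroup.coe_one, Matrix.one_mulVec]

theorem mulVec_ne_zero (t : SL(2, ℂ)) {x : Fin 2 → ℂ} (hx : x ≠ 0) : t.1.mulVec x ≠ 0 :=
  (smul_ne_zero_iff_ne t).mpr hx

theorem eq_one_or_neg_one_of_scalar {t : SL(2, ℂ)} {c : ℂ} (h : t.1 = c • 1) :
    t = 1 ∨ t = -1 := by
  have hdet := t.2
  rw [h, Matrix.det_smul, Matrix.det_one, mul_one, Fintype.card_fin, sq] at hdet
  rcases mul_self_eq_one_iff.1 hdet with rfl | rfl
  · exact Or.inl (Subtype.ext (by rw [h]; simp))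
  · exact Or.inr (Subtype.ext (by rw [h]; simp))

/-- The form `x ↦ y ∧ t y` vanishes only if `t` acts trivially. -/
theorem eq_one_or_neg_one_of_fixed {t : SL(2, ℂ)}
    (h : ∀ y : Fin 2 → ℂ, eval (t.1.mulVec y) (wedge y) = 0) : t = 1 ∨ t = -1 := by
  have h1 := h ![1, 0]
  have h2 := h ![0, 1]
  have h3 := h ![1, 1]
  simp only [eval_wedge, Matrix.mulVec, dotProduct, Fin.sum_univ_two] at h1 h2 h3
  simp at h1 h2 h3
  rw [h1, h2] at h3
  apply eq_one_or_neg_one_of_scalar (c := t.1 0 0)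
  ext i j
  fin_cases i <;> fin_cases j <;> simp [h1, h2]
  linear_combination -h3

theorem eq_one_or_neg_one_of_moebius_eq_one {t : SL(2, ℂ)} (h : moebius t = 1) :
    t = 1 ∨ t = -1 := by
  refine eq_one_or_neg_one_of_fixed fun y => ?_
  by_cases hy : y = 0
  · rw [eval_wedge]; simp [hy]
  obtain ⟨h1, h2⟩ := moebius_mk t y hy
  rw [h, Equiv.Perm.one_apply] at h2
  have h3 := mul_eq_mul_of_mk_eq h2 1 0
  rw [eval_wedge, h3, sub_self]

theorem moebius_neg_one : moebius (-1) = 1 := by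
  ext q
  induction q using Projectivization.ind with
  | h x hx =>
    obtain ⟨h1, h2⟩ := moebius_mk (-1) x hx
    rw [h2, Equiv.Perm.one_apply, Projectivization.mk_eq_mk_iff']
    refine ⟨-1, ?_⟩
    rw [Matrix.SpecialLinearGroup.coe_neg, Matrix.SpecialLinearGroup.coe_one, Matrix.neg_mulVec,
      Matrix.one_mulVec, neg_one_smul]

theorem neg_one_mem_binaryGroup (G : Subgroup (Equiv.Perm P1)) : -1 ∈ binaryGroup G := by
  refine ⟨?_, ?_⟩
  · change (-1 : SL(2, ℂ)).1 ∈ Matrix.unitaryGroup (Fin 2) ℂ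
    rw [Matrix.mem_unitaryGroup_iff]
    simp
  · change moebius (-1) ∈ G
    rw [moebius_neg_one]
    exact one_mem _

/-- The kernel of `moebius` is `±1`, so each covering transformation has at most two preimages. -/
theorem finite_binaryGroup (G : Subgroup (Equiv.Perm P1)) [Finite G] : Finite (binaryGroup G) := by
  have h : (moebius ⁻¹' (G : Set (Equiv.Perm P1))).Finite := by
    refine Set.Finite.preimage' (Set.toFinite _) fun b _ => ?_
    by_cases hb : ∃ t, moebius t = b
    · obtain ⟨t, rfl⟩ := hb
      refine (Set.toFinite {t, t * -1}).subset fun t' ht' => ?_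
      have h1 : moebius (t⁻¹ * t') = 1 := by
        rw [map_mul, map_inv, show moebius t' = moebius t from ht', inv_mul_cancel]
      rcases eq_one_or_neg_one_of_moebius_eq_one h1 with h2 | h2
      · exact Or.inl (inv_mul_eq_one.1 h2).symm
      · exact Or.inr (by rw [← h2]; simp)
    · convert Set.finite_empty
      ext t
      exact ⟨fun ht => hb ⟨t, ht⟩, fun ht => ht.elim⟩
  exact Set.Finite.to_subtype (h.subset fun t ht => ht.2)

theorem apply_moebius_of_mem {φ : P1 → P1} {t : SL(2, ℂ)} (ht : t ∈ binaryGroup (deckGroup φ))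
    (p : P1) : φ (moebius t p) = φ p := ht.2.2 p

/-- A morphism of positive degree of the projective line to itself is surjective. -/
theorem surjective_of_isMorphismOfDegree {d : ℕ} (hd : 0 < d) {φ : P1 → P1}
    (hφ : IsMorphismOfDegree d φ) : Function.Surjective φ := by
  intro q
  induction q using Projectivization.ind with
  | h y hy =>
    obtain ⟨p, hp, hφ⟩ := exists_forms hφ
    -- This form cuts out the fibre over `y`, and its degree is positive.
    obtain ⟨x, hx, hx0⟩ := exists_zero_of_pos hd (p := C (y 1) * p 0 - C (y 0) * p 1)
      (Submodule.sub_mem _ (((mem_homogeneousSubmodule _ _).1 (hp 0)).C_mul _)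
        (((mem_homogeneousSubmodule _ _).1 (hp 1)).C_mul _))
    obtain ⟨h, h1⟩ := hφ x hx
    refine ⟨Projectivization.mk ℂ x hx, ?_⟩
    rw [h1]
    apply mk_eq_mk_of_mul_eq
    simp only [map_sub, map_mul, eval_C] at hx0
    intro i j
    fin_cases i <;> fin_cases j <;> simp
    · linear_combination hx0
    · linear_combination -hx0

/-- The forms defining a covering are semi-invariant under the covering group. -/
theorem exists_semiinvariant {d : ℕ} {φ : P1 → P1} {p : Fin 2 → MvPolynomial (Fin 2) ℂ}
    (hp : ∀ i, p i ∈ V d)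
    (hφ : ∀ (x : Fin 2 → ℂ) (hx : x ≠ 0), ∃ h : (fun i => eval x (p i)) ≠ 0,
        φ (Projectivization.mk ℂ x hx) = Projectivization.mk ℂ (fun i => eval x (p i)) h)
    {t : SL(2, ℂ)} (ht : t ∈ binaryGroup (deckGroup φ)) :
    ∃ c : ℂ, c ≠ 0 ∧ ∀ i, subst t.1 (p i) = C c * p i := by
  have hz : ∀ y : Fin 2 → ℂ, y ≠ 0 → ∃ i, eval y (p i) ≠ 0 := by
    intro y hy
    obtain ⟨h, -⟩ := hφ y hy
    exact Function.ne_iff.1 h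
  obtain ⟨c, hc⟩ := exists_C_mul_of_proportional (fun i => subst t.1 (p i)) p
    (fun i => subst_mem _ (hp i)) hp hz (by
      intro i j
      refine MvPolynomial.funext fun x => ?_
      simp only [map_mul, eval_subst]
      by_cases hx : x = 0
      · simp [hx, mul_comm]
      obtain ⟨h1, h2⟩ := hφ x hx
      obtain ⟨h3, h4⟩ := hφ _ (mulVec_ne_zero t hx)
      obtain ⟨h5, h6⟩ := moebius_mk t x hx
      rw [← h6, apply_moebius_of_mem ht, h2] at h4
      have := mul_eq_mul_of_mk_eq h4 i j
      linear_combination -this)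
  refine ⟨c, ?_, hc⟩
  rintro rfl
  have hx : (![1, 0] : Fin 2 → ℂ) ≠ 0 := fun h => by simpa using congrFun h 0
  obtain ⟨i, hi⟩ := hz _ (mulVec_ne_zero t hx)
  apply hi
  rw [← eval_subst, hc i]
  simp

/-! ### Eigenvectors in `V n ⊗ ℂ²` -/

/-- The action of `SL₂ × SL₂` on `V n ⊗ ℂ²`. -/
def pairRep (n : ℕ) : Representation ℂ (SL(2, ℂ) × SL(2, ℂ)) (V n ⊗[ℂ] (Fin 2 → ℂ)) :=
  Representation.tprod ((formRep n).comp (MonoidHom.fst _ _)) (stdRep.comp (MonoidHom.snd _ _))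

theorem row_inj {n : ℕ} {p q p' q' : V n} : row p q = row p' q' ↔ p = p' ∧ q = q' := by
  refine ⟨fun h => ?_, fun h => by rw [h.1, h.2]⟩
  have h1 := congrArg (TensorProduct.piScalarRight ℂ ℂ (V n) (Fin 2)) h
  simp only [row, map_add, TensorProduct.piScalarRight_apply,
    TensorProduct.piScalarRightHom_tmul] at h1
  have h2 := congrFun h1 0
  have h3 := congrFun h1 1
  simp at h2 h3
  exact ⟨h2, h3⟩

theorem smul_row {n : ℕ} (k : ℂ) (p q : V n) : k • row p q = row (k • p) (k • q) := by
  simp [row, TensorProduct.smul_tmul']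

theorem row_add {n : ℕ} (p q p' q' : V n) : row p q + row p' q' = row (p + p') (q + q') := by
  simp only [row, TensorProduct.add_tmul]
  abel

theorem pairRep_row {n : ℕ} (t s : SL(2, ℂ)) (p q : V n) : pairRep n (t, s) (row p q) =
    row (s.1 0 0 • formRep n t p + s.1 0 1 • formRep n t q)
      (s.1 1 0 • formRep n t p + s.1 1 1 • formRep n t q) := by
  have hs : ∀ i, stdRep s (Pi.single i 1) =
      s.1 0 i • Pi.single 0 1 + s.1 1 i • (Pi.single 1 1 : Fin 2 → ℂ) := by
    intro i
    ext j
    fin_cases j <;> fin_cases i <;> simp [stdRep]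
  simp only [row, pairRep, map_add]
  change formRep n t p ⊗ₜ stdRep s (Pi.single 0 1) + formRep n t q ⊗ₜ stdRep s (Pi.single 1 1) = _
  rw [hs, hs]
  simp only [TensorProduct.tmul_add, TensorProduct.add_tmul, TensorProduct.tmul_smul,
    TensorProduct.smul_tmul']
  abel

theorem eval_formRep {n : ℕ} (t : SL(2, ℂ)) (p : V n) (x : Fin 2 → ℂ) :
    eval x (formRep n t p).1 = eval ((t⁻¹ : SL(2, ℂ)).1.mulVec x) p.1 := by
  rw [← eval_subst]
  rfl

theorem eigen_row_iff {n : ℕ} (t s : SL(2, ℂ)) (p q : V n) (k : ℂ) :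
    pairRep n (t, s) (row p q) = k • row p q ↔ ∀ x,
      s.1 0 0 * eval ((t⁻¹ : SL(2, ℂ)).1.mulVec x) p.1 +
        s.1 0 1 * eval ((t⁻¹ : SL(2, ℂ)).1.mulVec x) q.1 = k * eval x p.1 ∧
      s.1 1 0 * eval ((t⁻¹ : SL(2, ℂ)).1.mulVec x) p.1 +
        s.1 1 1 * eval ((t⁻¹ : SL(2, ℂ)).1.mulVec x) q.1 = k * eval x q.1 := by
  rw [pairRep_row, smul_row, row_inj, forall_and]
  have key : ∀ (p' q' r : V n) (a b : ℂ), a • p' + b • q' = k • r ↔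
      ∀ x, a * eval x p'.1 + b * eval x q'.1 = k * eval x r.1 := by
    intro p' q' r a b
    constructor
    · intro h x
      have h1 := congrArg (fun v : V n => eval x v.1) h
      simpa [smul_eval] using h1
    · intro h
      refine Subtype.ext (MvPolynomial.funext fun x => ?_)
      simpa [smul_eval] using h x
  rw [key, key]
  simp only [eval_formRep]

/-- Both rows of a matrix of forms are eigenvectors of `(t, s)` for the same eigenvalue `k` if and
only if the matrix is equivariant up to the factor `k`. -/
theorem eigen_rows_iff {n : ℕ} (t s : SL(2, ℂ)) (a b c e : V n) (k : ℂ) :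
    (pairRep n (t, s) (row a b) = k • row a b ∧ pairRep n (t, s) (row c e) = k • row c e) ↔
      ∀ x, formMatrix a b c e ((t⁻¹ : SL(2, ℂ)).1.mulVec x) * s.1.transpose =
        k • formMatrix a b c e x := by
  rw [eigen_row_iff, eigen_row_iff, ← forall_and]
  refine forall_congr' fun x => ?_
  rw [← Matrix.ext_iff, Fin.forall_fin_two, Fin.forall_fin_two, Fin.forall_fin_two]
  simp only [formMatrix, Matrix.mul_apply, Fin.sum_univ_two, Matrix.transpose_apply,
    Matrix.smul_apply]
  simp [mul_comm]

/-! ### Sixth powers lie in the closed orbit -/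

theorem continuous_mk_P6 {X : Type*} [TopologicalSpace X] {v : X → Fin 7 → ℂ} (hv : Continuous v)
    (h0 : ∀ x, v x ≠ 0) : Continuous fun x => (Projectivization.mk ℂ (v x) (h0 x) : P6) := by
  have h1 : Continuous
      (fun v : {v : Fin 7 → ℂ // v ≠ 0} => (Projectivization.mk ℂ v.1 v.2 : P6)) :=
    continuous_coinduced_rng
  exact h1.comp (hv.subtype_mk h0)

/-- The linear form with coefficients `ℓ`. -/
def linForm (ℓ : Fin 2 → ℂ) : MvPolynomial (Fin 2) ℂ := C (ℓ 0) * X 0 + C (ℓ 1) * X 1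

theorem linForm_mem (ℓ : Fin 2 → ℂ) : linForm ℓ ∈ V 1 :=
  Submodule.add_mem _ ((isHomogeneous_X ℂ 0).C_mul _) ((isHomogeneous_X ℂ 1).C_mul _)

theorem linForm_ne_zero {ℓ : Fin 2 → ℂ} (hℓ : ℓ ≠ 0) : linForm ℓ ≠ 0 := by
  intro h
  apply hℓ
  have h1 := congrArg (eval ![1, 0]) h
  have h2 := congrArg (eval ![0, 1]) h
  simp [linForm] at h1 h2
  ext i
  fin_cases i
  · exact h1
  · exact h2

theorem linForm_pow_five_mul_mem (ℓ m : Fin 2 → ℂ) : linForm ℓ ^ 5 * linForm m ∈ V 6 := by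
  have h1 := linForm_mem ℓ
  have h2 := linForm_mem m
  rw [mem_homogeneousSubmodule] at h1 h2 ⊢
  exact (h1.pow 5).mul h2

theorem sexticCoord_linForm_ne_zero {ℓ m : Fin 2 → ℂ} (hℓ : ℓ ≠ 0) (hm : m ≠ 0) :
    sexticCoord (linForm ℓ ^ 5 * linForm m) ≠ 0 := fun h =>
  mul_ne_zero (pow_ne_zero 5 (linForm_ne_zero hℓ)) (linForm_ne_zero hm)
    (eq_zero_of_sexticCoord_eq_zero (linForm_pow_five_mul_mem ℓ m) h)

theorem linForm_smul_add (ε : ℂ) (ℓ m : Fin 2 → ℂ) :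
    linForm (ε • ℓ + m) = C ε * linForm ℓ + linForm m := by
  simp only [linForm, Pi.add_apply, Pi.smul_apply, smul_eq_mul, map_add, map_mul]
  ring

theorem mk_linForm_mem_orbit {ℓ m : Fin 2 → ℂ} (hdet : ℓ 0 * m 1 - ℓ 1 * m 0 = 1)
    (h : sexticCoord (linForm ℓ ^ 5 * linForm m) ≠ 0) :
    (Projectivization.mk ℂ _ h : P6) ∈ orbit tangentForm := by
  let B : SL(2, ℂ) := ⟨!![ℓ 0, ℓ 1; m 0, m 1], by rw [Matrix.det_fin_two_of, hdet]⟩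
  have h1 : (formRep 6 B⁻¹ tangentForm).1 = linForm ℓ ^ 5 * linForm m := by
    change subst (B⁻¹⁻¹ : SL(2, ℂ)).1 tangentForm.1 = _
    rw [inv_inv]
    simp [subst, tangentForm, B, linForm]
  refine ⟨B⁻¹, by rwa [h1], ?_⟩
  simp only [h1]

/-- With `det(ℓ, m) = 1`, `ℓ⁶` is the limit of `ℓ⁵(εm + ℓ)` as `ε → 0`. For `ε ≠ 0` this is a
multiple of `ℓ⁵(m + ε⁻¹ℓ)`, and the pair `(ℓ, m + ε⁻¹ℓ)` is still unimodular, so the point lies in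
the orbit of `u⁵v`. -/
theorem mk_linForm_pow_six_mem {ℓ : Fin 2 → ℂ} (hℓ : ℓ ≠ 0)
    (h : sexticCoord (linForm ℓ ^ 5 * linForm ℓ) ≠ 0) :
    (Projectivization.mk ℂ _ h : P6) ∈ closedTwoDimOrbit := by
  obtain ⟨m, hm⟩ : ∃ m : Fin 2 → ℂ, ℓ 0 * m 1 - ℓ 1 * m 0 = 1 := by
    by_cases h0 : ℓ 0 = 0
    · have h1 : ℓ 1 ≠ 0 := fun h1 => hℓ (by ext i; fin_cases i <;> simp [h0, h1])
      exact ⟨![-(ℓ 1)⁻¹, 0], by simp [h0, h1]⟩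
    · exact ⟨![0, (ℓ 0)⁻¹], by simp [h0]⟩
  have hne : ∀ ε : ℂ, ε • m + ℓ ≠ 0 := by
    intro ε h1
    have e0 := congrFun h1 0
    have e1 := congrFun h1 1
    simp at e0 e1
    have : (1 : ℂ) = 0 := by linear_combination -hm + m 1 * e0 - m 0 * e1
    norm_num at this
  have hv : ∀ ε : ℂ, sexticCoord (linForm ℓ ^ 5 * linForm (ε • m + ℓ)) ≠ 0 := fun ε =>
    sexticCoord_linForm_ne_zero hℓ (hne ε)
  have hcont : Continuous fun ε : ℂ =>
      (Projectivization.mk ℂ (sexticCoord (linForm ℓ ^ 5 * linForm (ε • m + ℓ))) (hv ε) : P6) := by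
    apply continuous_mk_P6
    have h1 : (fun ε : ℂ => sexticCoord (linForm ℓ ^ 5 * linForm (ε • m + ℓ))) = fun ε =>
        ε • sexticCoord (linForm ℓ ^ 5 * linForm m) +
          sexticCoord (linForm ℓ ^ 5 * linForm ℓ) := by
      funext ε
      rw [← sexticCoord_C_mul, ← sexticCoord_add, linForm_smul_add]
      congr 1
      ring
    rw [h1]
    fun_prop
  have h0 : (0 : ℂ) ∈ closure ({0}ᶜ : Set ℂ) := by
    rw [(dense_compl_singleton (0 : ℂ)).closure_eq]; trivial
  have h2 := map_mem_closure hcont h0 (t := orbit tangentForm) (fun ε hε => by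
    have hε : ε ≠ 0 := hε
    have hd : ℓ 0 * (m + ε⁻¹ • ℓ) 1 - ℓ 1 * (m + ε⁻¹ • ℓ) 0 = 1 := by
      simp only [Pi.add_apply, Pi.smul_apply, smul_eq_mul]
      linear_combination hm
    have hs : sexticCoord (linForm ℓ ^ 5 * linForm (ε • m + ℓ)) =
        ε • sexticCoord (linForm ℓ ^ 5 * linForm (m + ε⁻¹ • ℓ)) := by
      rw [← sexticCoord_C_mul, add_comm m, linForm_smul_add, linForm_smul_add]
      congr 1
      have : (C ε * C ε⁻¹ : MvPolynomial (Fin 2) ℂ) = 1 := by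
        rw [← C_mul, mul_inv_cancel₀ hε, C_1]
      linear_combination -(linForm ℓ ^ 5 * linForm ℓ) * this
    have hn : sexticCoord (linForm ℓ ^ 5 * linForm (m + ε⁻¹ • ℓ)) ≠ 0 := fun h0 =>
      hv ε (by rw [hs, h0, smul_zero])
    have h3 := mk_linForm_mem_orbit hd hn
    convert h3 using 1
    rw [Projectivization.mk_eq_mk_iff']
    exact ⟨ε, hs.symm⟩)
  simp only [zero_smul, zero_add] at h2
  exact h2

theorem exists_rank_one {B : Matrix (Fin 2) (Fin 2) ℂ} (hB : B.det = 0) :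
    ∃ w ℓ : Fin 2 → ℂ, ∀ i j, B i j = w i * ℓ j := by
  rw [Matrix.det_fin_two] at hB
  by_cases h0 : B 0 0 = 0
  · by_cases h1 : B 0 1 = 0
    · exact ⟨![0, 1], B 1, fun i j => by fin_cases i <;> fin_cases j <;> simp [h0, h1]⟩
    · refine ⟨![1, B 1 1 / B 0 1], B 0, fun i j => ?_⟩
      have h2 : B 1 0 = 0 := by
        rw [h0, zero_mul, zero_sub, neg_eq_zero] at hB
        exact (mul_eq_zero.1 hB).resolve_left h1
      fin_cases i <;> fin_cases j <;> simp [h0, h1, h2]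
  · refine ⟨![1, B 1 0 / B 0 0], B 0, fun i j => ?_⟩
    fin_cases i <;> fin_cases j <;> simp [h0]
    field_simp
    linear_combination hB

/-- The adjugate has rank at most one, so it is `x ↦ ℓ(x) w`, and substituting it in the octahedral
form gives a constant times `ℓ⁶`. -/
theorem mk_f₁_mem_of_det_eq_zero {A : Matrix (Fin 2) (Fin 2) ℂ} (hA : A.det = 0) (h : f₁ A ≠ 0) :
    (Projectivization.mk ℂ (f₁ A) h : P6) ∈ closedTwoDimOrbit := by
  obtain ⟨w, ℓ, hw⟩ := exists_rank_one (B := A.adjugate) (by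
    rw [Matrix.det_adjugate, hA, Fintype.card_fin]; simp)
  have h1 : f₁ A = eval w octahedralForm.1 • sexticCoord (linForm ℓ ^ 5 * linForm ℓ) := by
    rw [← sexticCoord_C_mul]
    unfold f₁
    congr 1
    refine MvPolynomial.funext fun x => ?_
    rw [eval_subst, eval_octahedralForm]
    simp only [Matrix.mulVec, dotProduct, Fin.sum_univ_two, hw, map_mul, eval_C, map_pow,
      eval_octahedralForm]
    simp only [linForm, map_add, map_mul, eval_C, eval_X]
    ring
  have h2 : sexticCoord (linForm ℓ ^ 5 * linForm ℓ) ≠ 0 := fun h0 => h (by rw [h1, h0, smul_zero])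
  have hℓ : ℓ ≠ 0 := by
    rintro rfl
    apply h2
    ext i
    simp [linForm, sexticCoord]
  have h3 := mk_linForm_pow_six_mem hℓ h2
  convert h3 using 1
  rw [Projectivization.mk_eq_mk_iff']
  exact ⟨_, h1.symm⟩

theorem f₁_ne_zero {A : Matrix (Fin 2) (Fin 2) ℂ} (hA : A.det ≠ 0) : f₁ A ≠ 0 := by
  intro h
  have h1 := eval_subst_adjugate_eq (A := A) (B := A) (k := 0) (by rw [h, zero_smul])
  apply octahedralForm_ne_zero
  apply eq_zero_of_eval
  intro x
  have h2 := h1 (A.mulVec x)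
  rw [Matrix.mulVec_mulVec, Matrix.adjugate_mul, Matrix.smul_mulVec, Matrix.one_mulVec,
    eval_smul_of_mem octahedralForm.2, zero_mul] at h2
  exact (mul_eq_zero.1 h2).resolve_left (pow_ne_zero _ hA)

/-! ### Density of the nonvanishing locus -/

/-- On the line from `x` to a point where `r ≠ 0`, the form is a nonzero polynomial in one variable;
its finitely many roots have dense complement, so `x` is a limit of points where `r ≠ 0`. -/
theorem dense_eval_ne_zero {r : MvPolynomial (Fin 2) ℂ} (hr : r ≠ 0) :
    Dense {x : Fin 2 → ℂ | eval x r ≠ 0} := by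
  intro x
  obtain ⟨y, hy⟩ := exists_eval_ne_zero hr
  let q : Polynomial ℂ :=
    aeval (fun i => Polynomial.C (x i) + Polynomial.X * Polynomial.C (y i - x i)) r
  have hq : ∀ s : ℂ, q.eval s = eval (fun i => x i + s * (y i - x i)) r := by
    intro s
    have h : (Polynomial.evalRingHom s).comp
        (aeval (fun i => Polynomial.C (x i) + Polynomial.X * Polynomial.C (y i - x i)) :
          MvPolynomial (Fin 2) ℂ →ₐ[ℂ] Polynomial ℂ).toRingHom =
        eval (fun i => x i + s * (y i - x i)) := by
      ext i
      · simp
      · simp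
    exact RingHom.congr_fun h r
  have hq0 : q ≠ 0 := by
    intro h
    apply hy
    have h1 := hq 1
    rw [h, Polynomial.eval_zero] at h1
    simpa using h1.symm
  have hd : Dense {s : ℂ | q.eval s ≠ 0} := by
    have h1 : {s : ℂ | q.eval s ≠ 0} = {s : ℂ | q.IsRoot s}ᶜ := rfl
    rw [h1]
    exact (Set.Finite.countable (Polynomial.finite_setOfPred_isRoot hq0)).dense_compl ℂ
  have hcont : Continuous fun s : ℂ => (fun i => x i + s * (y i - x i)) := by fun_prop
  have h2 := map_mem_closure hcont (hd 0) (t := {x : Fin 2 → ℂ | eval x r ≠ 0}) (fun s hs => by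
    change eval _ r ≠ 0
    rw [← hq]
    exact hs)
  simpa using h2

/-! ### Equivariance of Galois lifts -/

section lift

variable {n : ℕ} {φ : P1 → P1} {F : P1 → P6} {g : P1 → P3} {a b c e : V n}

theorem apply_eq_mk_f₁ (hg : IsGivenBy g a b c e) (hc : Commutes φ g F) (x : Fin 2 → ℂ)
    (hx : x ≠ 0) (h : f₁ (formMatrix a b c e x) ≠ 0) :
    F (φ (Projectivization.mk ℂ x hx)) = Projectivization.mk ℂ _ h := by
  obtain ⟨h1, h2⟩ := hg x hx
  exact hc.2 _ _ h1 h2 h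

/-- The determinant of a matrix of forms, as a form. -/
def detForm (a b c e : V n) : MvPolynomial (Fin 2) ℂ := a.1 * e.1 - b.1 * c.1

theorem eval_detForm (x : Fin 2 → ℂ) :
    eval x (detForm a b c e) = (formMatrix a b c e x).det := by
  simp [detForm, formMatrix, Matrix.det_fin_two]

theorem exists_f₁_ne_zero (hg : IsGivenBy g a b c e) (hc : Commutes φ g F) :
    ∃ x, f₁ (formMatrix a b c e x) ≠ 0 := by
  obtain ⟨⟨p, A, hA, hp, hf⟩, -⟩ := hc
  induction p using Projectivization.ind with
  | h x hx =>
    refine ⟨x, fun h => hf ?_⟩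
    obtain ⟨h1, h2⟩ := hg x hx
    rw [h2, eq_comm, Projectivization.mk_eq_mk_iff'] at hp
    obtain ⟨k, rfl⟩ := hp
    rw [f₁_smul, h, smul_zero]

/-- The determinant of a lift of a curve outside of the closed orbit does not vanish
identically. -/
theorem detForm_ne_zero {d m : ℕ} (hd : 0 < d) (hφ : IsMorphismOfDegree d φ)
    (hF : IsMorphismOfDegree m F) (hF2 : ¬ ∀ p, F p ∈ closedTwoDimOrbit)
    (hg : IsGivenBy g a b c e) (hc : Commutes φ g F) : detForm a b c e ≠ 0 := by
  intro hdet
  apply hF2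
  obtain ⟨x₀, hx₀⟩ := exists_f₁_ne_zero hg hc
  obtain ⟨i, hi⟩ := Function.ne_iff.1 hx₀
  obtain ⟨ψ, hψ, hψe⟩ := exists_f₁_formMatrix a b c e
  obtain ⟨p, hp, hφp⟩ := exists_forms hφ
  obtain ⟨q, hq, hFq⟩ := exists_forms hF
  have hr : ψ i * X 0 ≠ 0 := mul_ne_zero
    (fun h => hi (by rw [← hψe, h]; simp)) (X_ne_zero 0)
  let U := {x : Fin 2 → ℂ // x ≠ 0}
  let v : U → Fin 7 → ℂ := fun x j => eval (fun k => eval x.1 (p k)) (q j)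
  have hv : ∀ x : U, ∃ h : v x ≠ 0,
      F (φ (Projectivization.mk ℂ x.1 x.2)) = Projectivization.mk ℂ (v x) h := by
    intro x
    obtain ⟨h1, h2⟩ := hφp x.1 x.2
    rw [h2]
    exact hFq _ h1
  choose hv0 hvF using hv
  have hcont : Continuous fun x : U => (Projectivization.mk ℂ (v x) (hv0 x) : P6) := by
    apply continuous_mk_P6
    refine continuous_pi fun j => (MvPolynomial.continuous_eval (q j)).comp
      (continuous_pi fun k => (MvPolynomial.continuous_eval (p k)).comp continuous_subtype_val)
  have hopen : IsOpen {x : Fin 2 → ℂ | x ≠ 0} := isOpen_ne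
  have hdense := (dense_eval_ne_zero hr).preimage hopen.isOpenMap_subtype_val
  -- Where `f₁ ∘ g` is defined, `F ∘ φ` equals it and lies in the closed orbit because `det M = 0`.
  -- These points are dense, and `F ∘ φ` is continuous.
  have hall : ∀ x : U, (Projectivization.mk ℂ (v x) (hv0 x) : P6) ∈ closedTwoDimOrbit := by
    intro x
    have h1 := map_mem_closure hcont (hdense x) (t := closedTwoDimOrbit) (fun y hy => by
      have hy : eval y.1 (ψ i * X 0) ≠ 0 := hy
      have hf : f₁ (formMatrix a b c e y.1) ≠ 0 := by
        intro h
        apply hy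
        rw [map_mul, hψe, h]
        simp
      rw [← hvF, apply_eq_mk_f₁ hg hc y.1 y.2 hf]
      exact mk_f₁_mem_of_det_eq_zero (by rw [← eval_detForm, hdet, map_zero]) hf)
    rwa [show closure closedTwoDimOrbit = closedTwoDimOrbit from closure_closure] at h1
  intro P
  obtain ⟨Q, rfl⟩ := surjective_of_isMorphismOfDegree hd hφ P
  induction Q using Projectivization.ind with
  | h x hx =>
    rw [hvF ⟨x, hx⟩]
    exact hall _

/-- The matrix of a lift is equivariant, up to a constant, for every covering transformation and
a suitable element of `S₄*`. -/
theorem exists_equivariant (hdet : detForm a b c e ≠ 0) (hg : IsGivenBy g a b c e)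
    (hc : Commutes φ g F) {t : SL(2, ℂ)} (ht : t ∈ binaryGroup (deckGroup φ)) :
    ∃ s ∈ binaryOctahedral, ∃ k : ℂ, k ≠ 0 ∧ ∀ x,
      formMatrix a b c e ((t⁻¹ : SL(2, ℂ)).1.mulVec x) * s.1.transpose =
        k • formMatrix a b c e x := by
  classical
  let m : Fin 2 → Fin 2 → MvPolynomial (Fin 2) ℂ := ![![a.1, b.1], ![c.1, e.1]]
  have hm : ∀ i j, m i j ∈ V n := by
    intro i j
    fin_cases i <;> fin_cases j
    exacts [a.2, b.2, c.2, e.2]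
  have hmx : ∀ x i j, formMatrix a b c e x i j = eval x (m i j) := by
    intro x i j
    fin_cases i <;> fin_cases j <;> rfl
  let τ := (t⁻¹ : SL(2, ℂ)).1
  let p : SL(2, ℂ) → Fin 2 × Fin 2 → MvPolynomial (Fin 2) ℂ := fun s ij =>
    C (s.1 ij.2 0) * subst τ (m ij.1 0) + C (s.1 ij.2 1) * subst τ (m ij.1 1)
  let q : Fin 2 × Fin 2 → MvPolynomial (Fin 2) ℂ := fun ij => m ij.1 ij.2
  have hpe : ∀ s ij x, eval x (p s ij) =
      (formMatrix a b c e (τ.mulVec x) * s.1.transpose) ij.1 ij.2 := by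
    intro s ij x
    simp only [p, map_add, map_mul, eval_C, eval_subst, Matrix.mul_apply, Fin.sum_univ_two,
      Matrix.transpose_apply, hmx]
    ring
  have hdett : subst τ (detForm a b c e) ≠ 0 := by
    obtain ⟨y, hy⟩ := exists_eval_ne_zero hdet
    intro h
    apply hy
    have h1 := congrArg (eval (t.1.mulVec y)) h
    rw [eval_subst, map_zero] at h1
    have h2 := mulVec_inv_mulVec t⁻¹ y
    rw [inv_inv] at h2
    rwa [show τ.mulVec (t.1.mulVec y) = y from h2] at h1
  -- If each of the finitely many `s` violated some cross relation, the product of these nonzero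
  -- polynomials and of both determinants would be nonzero at some `x`. But at this `x` the two
  -- values of `M` are invertible with proportional images under `f₁`, which yields an `s`
  -- satisfying all relations there.
  have hex : ∃ s : binaryOctahedral, ∀ I J, p s I * q J = p s J * q I := by
    by_contra! hcon
    choose I J hIJ using hcon
    have : Fintype binaryOctahedral := Fintype.ofFinite _
    have hprod : (∏ s : binaryOctahedral, (p s (I s) * q (J s) - p s (J s) * q (I s))) *
        (detForm a b c e * subst τ (detForm a b c e) * X 0) ≠ 0 :=
      mul_ne_zero (Finset.prod_ne_zero_iff.2 fun s _ => sub_ne_zero.2 (hIJ s))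
        (mul_ne_zero (mul_ne_zero hdet hdett) (X_ne_zero 0))
    obtain ⟨x, hx⟩ := exists_eval_ne_zero hprod
    rw [map_mul, map_mul, map_mul, map_prod, eval_X, eval_subst, eval_detForm, eval_detForm] at hx
    have hx1 := left_ne_zero_of_mul hx
    have hx2 := right_ne_zero_of_mul hx
    have hx0 : x ≠ 0 := by
      rintro rfl
      exact right_ne_zero_of_mul hx2 rfl
    have hA := left_ne_zero_of_mul (left_ne_zero_of_mul hx2)
    have hB := right_ne_zero_of_mul (left_ne_zero_of_mul hx2)
    have hFA := apply_eq_mk_f₁ hg hc x hx0 (f₁_ne_zero hA)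
    obtain ⟨h5, h6⟩ := moebius_mk t⁻¹ x hx0
    have hFB := apply_eq_mk_f₁ hg hc _ h5 (f₁_ne_zero hB)
    rw [← h6, apply_moebius_of_mem (inv_mem ht), hFA, eq_comm,
      Projectivization.mk_eq_mk_iff'] at hFB
    obtain ⟨k, hk⟩ := hFB
    obtain ⟨s, hs, l, hl, hBA⟩ := exists_of_f₁_proportional hA hB hk.symm
    -- From `B = l • (A * s)` follows `B * s⁻¹ = l • A`; equivariance is written with a transpose,
    -- so `s'` is the transpose of `s⁻¹`.
    let s' : binaryOctahedral := ⟨(s⁻¹).transpose, transpose_mem_binaryOctahedral (inv_mem hs)⟩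
    have hs' : formMatrix a b c e (τ.mulVec x) * s'.1.1.transpose =
        l • formMatrix a b c e x := by
      change formMatrix a b c e (τ.mulVec x) * (s⁻¹).1.transpose.transpose = _
      rw [Matrix.transpose_transpose, hBA, Matrix.smul_mul, mul_assoc,
        ← Matrix.SpecialLinearGroup.coe_mul, mul_inv_cancel, Matrix.SpecialLinearGroup.coe_one,
        mul_one]
    rw [Finset.prod_ne_zero_iff] at hx1
    apply hx1 s' (Finset.mem_univ _)
    rw [map_sub, map_mul, map_mul, hpe, hpe, hs']
    simp only [q, ← hmx, Matrix.smul_apply, smul_eq_mul]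
    ring
  obtain ⟨s, hs⟩ := hex
  obtain ⟨k, hk⟩ := exists_C_mul_of_proportional (m := n) (p s) q (fun ij => by
    have h1 := subst_mem τ (hm ij.1 0)
    have h2 := subst_mem τ (hm ij.1 1)
    rw [mem_homogeneousSubmodule] at h1 h2
    exact Submodule.add_mem _ (h1.C_mul _) (h2.C_mul _)) (fun ij => hm _ _) (by
    intro y hy
    obtain ⟨h1, -⟩ := hg y hy
    by_contra! h2
    apply h1
    ext i j
    rw [hmx]
    exact h2 (i, j)) hs
  have hmat : ∀ x, formMatrix a b c e (τ.mulVec x) * s.1.1.transpose =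
      k • formMatrix a b c e x := by
    intro x
    ext i j
    rw [← hpe s (i, j) x, hk, map_mul, eval_C, Matrix.smul_apply, hmx, smul_eq_mul]
  refine ⟨s.1, s.2, k, ?_, hmat⟩
  rintro rfl
  obtain ⟨x, hx⟩ := exists_eval_ne_zero hdett
  apply hx
  have h1 := congrArg Matrix.det (hmat x)
  rw [Matrix.det_mul, Matrix.det_transpose, s.1.2, mul_one, zero_smul,
    Matrix.det_zero] at h1
  rw [eval_subst, eval_detForm, h1]

end lift

/-! ### Galois lifts as pairs of eigenvectors -/

theorem isOneDimIrreducible_of_span {H U : Type*} [Group H] [AddCommGroup U] [Module ℂ U]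
    {ρ : Representation ℂ H U} {S : Subrepresentation ρ} {v : U} (hv : v ≠ 0)
    (hS : S.toSubmodule = Submodule.span ℂ {v}) : IsOneDimIrreducible S := by
  have h1 : Module.finrank ℂ S.toSubmodule = 1 := by rw [hS, finrank_span_singleton hv]
  refine ⟨h1, ?_⟩
  have h2 : IsSimpleModule ℂ S.toSubmodule := isSimpleModule_iff_finrank_eq_one.2 h1
  have h3 : IsSimpleOrder (Submodule ℂ S.toSubmodule) := h2.toIsSimpleOrder
  have hnt : Nontrivial (Subrepresentation S.toRepresentation) :=
    ⟨⊥, ⊤, fun h => bot_ne_top (α := Submodule ℂ S.toSubmodule)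
      (congrArg Subrepresentation.toSubmodule h)⟩
  refine { eq_bot_or_eq_top := fun T => ?_ }
  rcases eq_bot_or_eq_top T.toSubmodule with h | h
  · exact Or.inl (Subrepresentation.toSubmodule_injective h)
  · exact Or.inr (Subrepresentation.toSubmodule_injective h)

/-- The line spanned by a common eigenvector. -/
def eigenline {H U : Type*} [Group H] [AddCommGroup U] [Module ℂ U] (ρ : Representation ℂ H U)
    (χ : H → ℂ) (v : U) (h : ∀ t, ρ t v = χ t • v) : Subrepresentation ρ where
  toSubmodule := Submodule.span ℂ {v}
  apply_mem_toSubmodule t w hw := by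
    obtain ⟨k, rfl⟩ := Submodule.mem_span_singleton.1 hw
    rw [map_smul, h, smul_smul]
    exact Submodule.smul_mem _ _ (Submodule.mem_span_singleton_self v)

/-- The group acts on both lines by the same scalars, so any linear isomorphism intertwines. -/
theorem nonempty_equiv_eigenline {H U : Type*} [Group H] [AddCommGroup U] [Module ℂ U]
    (ρ : Representation ℂ H U) (χ : H → ℂ) {v w : U} (hv0 : v ≠ 0) (hw0 : w ≠ 0)
    (hv : ∀ t, ρ t v = χ t • v) (hw : ∀ t, ρ t w = χ t • w) :
    Nonempty ((eigenline ρ χ v hv).toRepresentation.Equiv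
      (eigenline ρ χ w hw).toRepresentation) := by
  have key : ∀ (u : U) (hu : ∀ t, ρ t u = χ t • u) (t : H) (x : Submodule.span ℂ {u}),
      (eigenline ρ χ u hu).toRepresentation t x = χ t • x := by
    rintro u hu t ⟨x, hx⟩
    obtain ⟨k, rfl⟩ := Submodule.mem_span_singleton.1 hx
    apply Subtype.ext
    change ρ t (k • u) = χ t • k • u
    rw [map_smul, hu, smul_comm]
  let f : Submodule.span ℂ {v} ≃ₗ[ℂ] Submodule.span ℂ {w} :=
    (LinearEquiv.toSpanNonzeroSingleton ℂ U v hv0).symm.trans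
      (LinearEquiv.toSpanNonzeroSingleton ℂ U w hw0)
  refine ⟨Representation.Equiv.mk f fun t => LinearMap.ext fun x => ?_⟩
  exact (congrArg f (key v hv t x)).trans ((map_smul f _ _).trans (key w hw t (f x)).symm)

/-- Two linearly independent common eigenvectors with the same eigenvalues span isomorphic
subrepresentations. -/
theorem exists_eigenlines {H U : Type*} [Group H] [AddCommGroup U] [Module ℂ U]
    (ρ : Representation ℂ H U) (v w : U)
    (hvw : ∀ α β : ℂ, α • v + β • w = 0 → α = 0 ∧ β = 0)
    (h : ∀ t, ∃ k : ℂ, ρ t v = k • v ∧ ρ t w = k • w) :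
    ∃ U₁ U₂ : Subrepresentation ρ,
      U₁.toSubmodule = Submodule.span ℂ {v} ∧ U₂.toSubmodule = Submodule.span ℂ {w} ∧
      IsOneDimIrreducible U₁ ∧ IsOneDimIrreducible U₂ ∧
      Nonempty (U₁.toRepresentation.Equiv U₂.toRepresentation) ∧
      LinearIndependent ℂ ![v, w] := by
  choose χ hv hw using h
  have hind : LinearIndependent ℂ ![v, w] := LinearIndependent.pair_iff.2 hvw
  have hv0 : v ≠ 0 := hind.ne_zero 0
  have hw0 : w ≠ 0 := hind.ne_zero 1
  exact ⟨eigenline ρ χ v hv, eigenline ρ χ w hw, rfl, rfl,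
    isOneDimIrreducible_of_span hv0 rfl, isOneDimIrreducible_of_span hw0 rfl,
    nonempty_equiv_eigenline ρ χ hv0 hw0 hv hw, hind⟩

theorem eq_zero_of_smul_rows {n : ℕ} {a b c e : V n} (hdet : detForm a b c e ≠ 0) (α β : ℂ)
    (h : α • row a b + β • row c e = 0) : α = 0 ∧ β = 0 := by
  obtain ⟨x, hx⟩ := exists_eval_ne_zero hdet
  have h0 : (0 : V n ⊗[ℂ] (Fin 2 → ℂ)) = row 0 0 := by simp [row]
  rw [smul_row, smul_row, row_add, h0, row_inj] at h
  have h1 := congrArg (fun v : V n => eval x v.1) h.1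
  have h2 := congrArg (fun v : V n => eval x v.1) h.2
  simp [smul_eval] at h1 h2
  simp only [detForm, map_sub, map_mul] at hx
  constructor
  · refine (mul_eq_zero.1 ?_).resolve_right hx
    linear_combination eval x e.1 * h1 - eval x c.1 * h2
  · refine (mul_eq_zero.1 ?_).resolve_right hx
    linear_combination eval x a.1 * h2 - eval x b.1 * h1

/-- The pairs in `SL₂ × SL₂` for which two given vectors are eigenvectors with the same
eigenvalue. -/
def eigenSubgroup {n : ℕ} (v w : V n ⊗[ℂ] (Fin 2 → ℂ)) : Subgroup (SL(2, ℂ) × SL(2, ℂ)) where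
  carrier := {u | ∃ k : ℂ, k ≠ 0 ∧ pairRep n u v = k • v ∧ pairRep n u w = k • w}
  one_mem' := ⟨1, one_ne_zero, by simp, by simp⟩
  mul_mem' := by
    rintro u u' ⟨k, hk, h1, h2⟩ ⟨k', hk', h1', h2'⟩
    refine ⟨k * k', mul_ne_zero hk hk', ?_, ?_⟩
    · rw [map_mul, Module.End.mul_apply, h1', map_smul, h1, smul_smul, mul_comm]
    · rw [map_mul, Module.End.mul_apply, h2', map_smul, h2, smul_smul, mul_comm]
  inv_mem' := by
    rintro u ⟨k, hk, h1, h2⟩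
    have key : ∀ v, pairRep n u v = k • v → pairRep n u⁻¹ v = k⁻¹ • v := by
      intro v hv
      have h3 : pairRep n u⁻¹ (pairRep n u v) = v := by
        rw [← Module.End.mul_apply, ← map_mul, inv_mul_cancel, map_one, Module.End.one_apply]
      rw [hv, map_smul] at h3
      rw [← h3, smul_smul, inv_mul_cancel₀ hk, one_smul, h3]
    exact ⟨k⁻¹, inv_ne_zero hk, key v h1, key w h2⟩

theorem mem_eigenSubgroup_rows {n : ℕ} {a b c e : V n} {t s : SL(2, ℂ)} :
    (t, s) ∈ eigenSubgroup (row a b) (row c e) ↔ ∃ k : ℂ, k ≠ 0 ∧ ∀ x,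
      formMatrix a b c e ((t⁻¹ : SL(2, ℂ)).1.mulVec x) * s.1.transpose =
        k • formMatrix a b c e x :=
  exists_congr fun k => and_congr_right fun _ => eigen_rows_iff t s a b c e k

theorem formMatrix_smul {n : ℕ} (a b c e : V n) (k : ℂ) (x : Fin 2 → ℂ) :
    formMatrix a b c e (k • x) = k ^ n • formMatrix a b c e x := by
  ext i j
  fin_cases i <;> fin_cases j
  · exact eval_smul_of_mem a.2 k x
  · exact eval_smul_of_mem b.2 k x
  · exact eval_smul_of_mem c.2 k x
  · exact eval_smul_of_mem e.2 k x

theorem coe_of_eq_one_or_neg_one {s : SL(2, ℂ)} (h : s = 1 ∨ s = -1) :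
    ∃ k : ℂ, k ≠ 0 ∧ s.1 = k • 1 ∧ (s⁻¹).1 = k • 1 := by
  rcases h with rfl | rfl
  · exact ⟨1, one_ne_zero, by simp, by simp⟩
  · exact ⟨-1, by norm_num, by simp, by simp⟩

/-- A sign `t = l` acts on `M` by the scalar `l ^ n`. Cancelling an invertible value of `M` leaves
`s` scalar of determinant `1`. -/
theorem eq_one_or_neg_one_of_equivariant {n : ℕ} {a b c e : V n} (hdet : detForm a b c e ≠ 0)
    {t s : SL(2, ℂ)} (ht : t = 1 ∨ t = -1) {k : ℂ} (hk : ∀ x,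
      formMatrix a b c e ((t⁻¹ : SL(2, ℂ)).1.mulVec x) * s.1.transpose =
        k • formMatrix a b c e x) : s = 1 ∨ s = -1 := by
  obtain ⟨l, hl, -, h2⟩ := coe_of_eq_one_or_neg_one ht
  obtain ⟨x, hx⟩ := exists_eval_ne_zero hdet
  rw [eval_detForm] at hx
  have h3 := hk x
  rw [h2, Matrix.smul_mulVec, Matrix.one_mulVec, formMatrix_smul, Matrix.smul_mul] at h3
  have hln : l ^ n ≠ 0 := pow_ne_zero n hl
  have h4 : formMatrix a b c e x * s.1.transpose =
      formMatrix a b c e x * ((l ^ n)⁻¹ * k) • 1 := by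
    rw [Matrix.mul_smul, mul_one, mul_smul, ← h3, smul_smul, inv_mul_cancel₀ hln, one_smul]
  have hunit : IsUnit (formMatrix a b c e x) :=
    (Matrix.isUnit_iff_isUnit_det _).2 (isUnit_iff_ne_zero.2 hx)
  have h5 := hunit.mul_left_cancel h4
  have h6 := congrArg Matrix.transpose h5
  rw [Matrix.transpose_transpose, Matrix.transpose_smul, Matrix.transpose_one] at h6
  exact eq_one_or_neg_one_of_scalar h6

/-- A scalar `s` is invisible projectively, so `g` is invariant under `t⁻¹`, and faithfulness makes
`t` act trivially on the line. -/
theorem eq_one_or_neg_one_of_faithful {n : ℕ} {φ : P1 → P1} {g : P1 → P3} {a b c e : V n}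
    (hg : IsGivenBy g a b c e) (hfaith : ∀ σ ∈ deckGroup φ, (∀ p, g (σ p) = g p) → σ = 1)
    {t s : SL(2, ℂ)} (ht : t ∈ binaryGroup (deckGroup φ)) (hs : s = 1 ∨ s = -1) {k : ℂ}
    (hk : ∀ x, formMatrix a b c e ((t⁻¹ : SL(2, ℂ)).1.mulVec x) * s.1.transpose =
      k • formMatrix a b c e x) : t = 1 ∨ t = -1 := by
  obtain ⟨l, hl, h1, -⟩ := coe_of_eq_one_or_neg_one hs
  have h3 : moebius t⁻¹ = 1 := by
    refine hfaith _ (inv_mem ht : t⁻¹ ∈ binaryGroup (deckGroup φ)).2 fun p => ?_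
    induction p using Projectivization.ind with
    | h x hx =>
      obtain ⟨h4, h5⟩ := moebius_mk t⁻¹ x hx
      obtain ⟨h6, h7⟩ := hg x hx
      obtain ⟨h8, h9⟩ := hg _ h4
      rw [h5, h7, h9, Projectivization.mk_eq_mk_iff']
      refine ⟨l⁻¹ * k, ?_⟩
      rw [mul_smul, ← hk x, h1, Matrix.transpose_smul, Matrix.transpose_one,
        Matrix.mul_smul, mul_one, smul_smul, inv_mul_cancel₀ hl, one_smul]
  rw [map_inv, inv_eq_one] at h3
  exact eq_one_or_neg_one_of_moebius_eq_one h3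

theorem exists_eigenrows_of_isGaloisLift {d n m : ℕ} {φ : P1 → P1} (hφ : IsGaloisCovering d φ)
    {F : P1 → P6} {g : P1 → P3} {a b c e : V n} (hF : IsMorphismOfDegree m F)
    (hF2 : ¬ ∀ p, F p ∈ closedTwoDimOrbit) (hg : IsGivenBy g a b c e) (hl : IsGaloisLift φ g F) :
    ∃ φ₂ : binaryGroup (deckGroup φ) →* binaryOctahedral,
      Function.Injective φ₂ ∧
      ∃ U₁ U₂ : Subrepresentation (tensorRep n φ₂),
        U₁.toSubmodule = Submodule.span ℂ {row a b} ∧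
        U₂.toSubmodule = Submodule.span ℂ {row c e} ∧
        IsOneDimIrreducible U₁ ∧ IsOneDimIrreducible U₂ ∧
        Nonempty (U₁.toRepresentation.Equiv U₂.toRepresentation) ∧
        LinearIndependent ℂ ![row a b, row c e] := by
  obtain ⟨hd, hφm, hcard⟩ := hφ
  obtain ⟨hc, hfaith⟩ := hl
  have hdet := detForm_ne_zero hd hφm hF hF2 hg hc
  have hfin : Finite (deckGroup φ) := Nat.finite_of_card_ne_zero (by omega)
  have hfinH := finite_binaryGroup (deckGroup φ)
  let H := binaryGroup (deckGroup φ)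
  -- The correspondence between `G*` and `S₄*` from which `φ₂` is cut out. It contains all pairs of
  -- signs, which act on both rows by the same scalar.
  let E : Subgroup (SL(2, ℂ) × SL(2, ℂ)) :=
    eigenSubgroup (row a b) (row c e) ⊓ H.prod binaryOctahedral
  have hE : ∀ t s : SL(2, ℂ), (t, s) ∈ E ↔ (∃ k : ℂ, k ≠ 0 ∧ ∀ x,
      formMatrix a b c e ((t⁻¹ : SL(2, ℂ)).1.mulVec x) * s.1.transpose =
        k • formMatrix a b c e x) ∧ t ∈ H ∧ s ∈ binaryOctahedral := by
    intro t s
    rw [Subgroup.mem_inf, mem_eigenSubgroup_rows, Subgroup.mem_prod]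
  have hscal : ∀ s : SL(2, ℂ), (s = 1 ∨ s = -1) → ∀ t : SL(2, ℂ), (t = 1 ∨ t = -1) →
      (t, s) ∈ E := by
    intro s hs t ht
    refine (hE t s).2 ⟨?_, ?_, ?_⟩
    · obtain ⟨k, hk, h1, -⟩ := coe_of_eq_one_or_neg_one hs
      obtain ⟨l, hl, -, h2⟩ := coe_of_eq_one_or_neg_one ht
      refine ⟨l ^ n * k, mul_ne_zero (pow_ne_zero n hl) hk, fun x => ?_⟩
      rw [h1, h2, Matrix.smul_mulVec, Matrix.one_mulVec, formMatrix_smul, Matrix.transpose_smul,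
        Matrix.transpose_one, Matrix.mul_smul, mul_one, smul_smul, mul_comm]
    · rcases ht with rfl | rfl
      · exact one_mem _
      · exact neg_one_mem_binaryGroup _
    · rcases hs with rfl | rfl
      · exact one_mem _
      · exact neg_one_mem_binaryOctahedral
  have hsign : ∀ u ∈ E, (u.1 = 1 ∨ u.1 = -1) ↔ (u.2 = 1 ∨ u.2 = -1) := by
    rintro ⟨t, s⟩ hu
    obtain ⟨⟨k, hk, hk2⟩, htH, -⟩ := (hE t s).1 hu
    constructor
    · exact fun ht => eq_one_or_neg_one_of_equivariant hdet ht hk2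
    · exact fun hs => eq_one_or_neg_one_of_faithful hg hfaith htH hs hk2
  obtain ⟨φ₂, hinj, hφ₂⟩ := exists_injective_lift (H := H) E
    (fun u hu => ((hE u.1 u.2).1 hu).2.1) (fun u hu => ((hE u.1 u.2).1 hu).2.2) hsign
    (hscal 1 (Or.inl rfl) (-1) (Or.inr rfl)) (hscal (-1) (Or.inr rfl) 1 (Or.inl rfl)) (by
      intro t ht
      obtain ⟨s, hs, h1⟩ := exists_equivariant hdet hg hc ht
      exact ⟨s, (hE t s).2 ⟨h1, ht, hs⟩⟩)
  have hχ : ∀ t : H, ∃ k : ℂ, tensorRep n φ₂ t (row a b) = k • row a b ∧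
      tensorRep n φ₂ t (row c e) = k • row c e := by
    intro t
    obtain ⟨k, -, h1⟩ := ((hE _ _).1 (hφ₂ t)).1
    exact ⟨k, (eigen_rows_iff t.1 (φ₂ t).1 a b c e k).2 h1⟩
  exact ⟨φ₂, hinj, exists_eigenlines (tensorRep n φ₂) (row a b) (row c e)
    (eq_zero_of_smul_rows hdet) hχ⟩

/-! ### Semi-invariant forms -/

theorem eval_aeval_forms (p : Fin 2 → MvPolynomial (Fin 2) ℂ) (A : MvPolynomial (Fin 2) ℂ)
    (x : Fin 2 → ℂ) : eval x (aeval p A) = eval (fun k => eval x (p k)) A := by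
  have h : (eval x).comp (aeval p : MvPolynomial (Fin 2) ℂ →ₐ[ℂ] _).toRingHom =
      eval (fun k => eval x (p k)) := by
    ext i
    · simp
    · simp
  exact RingHom.congr_fun h A

theorem C_mul_mem {m : ℕ} {p : MvPolynomial (Fin 2) ℂ} (k : ℂ) (hp : p ∈ V m) : C k * p ∈ V m :=
  ((mem_homogeneousSubmodule _ _).1 hp).C_mul k

theorem mul_mem_add {m n : ℕ} {p q : MvPolynomial (Fin 2) ℂ} (hp : p ∈ V m) (hq : q ∈ V n) :
    p * q ∈ V (m + n) :=
  ((mem_homogeneousSubmodule _ _).1 hp).mul ((mem_homogeneousSubmodule _ _).1 hq)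

theorem eval_mulVec_wedge_mulVec (t : SL(2, ℂ)) (u v : Fin 2 → ℂ) :
    eval (t.1.mulVec u) (wedge (t.1.mulVec v)) = eval u (wedge v) := by
  have hdet := t.2
  rw [Matrix.det_fin_two] at hdet
  simp only [eval_wedge, Matrix.mulVec, dotProduct, Fin.sum_univ_two]
  linear_combination (v 1 * u 0 - v 0 * u 1) * hdet

/-- A point outside of the zero set of a given form with trivial stabilizer in `PSL₂`. -/
theorem exists_free_point {H : Subgroup SL(2, ℂ)} [Finite H] {Q : MvPolynomial (Fin 2) ℂ}
    (hQ : Q ≠ 0) : ∃ y : Fin 2 → ℂ, y ≠ 0 ∧ eval y Q ≠ 0 ∧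
      ∀ t ∈ H, ¬ (t = 1 ∨ t = -1) → eval (t.1.mulVec y) (wedge y) ≠ 0 := by
  classical
  have : Fintype H := Fintype.ofFinite _
  -- The quadratic form `w t` vanishes at the fixed points of `t`, and is nonzero unless `t = ±1`.
  -- The product over the finite group is then a nonzero form to be avoided.
  let w : SL(2, ℂ) → MvPolynomial (Fin 2) ℂ := fun t =>
    X 1 * subst t.1 (X 0) - X 0 * subst t.1 (X 1)
  have hw : ∀ t y, eval y (w t) = eval (t.1.mulVec y) (wedge y) := by
    intro t y
    simp only [w, map_sub, map_mul, eval_X, eval_subst, eval_wedge]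
  have hprod : Q * X 0 * ∏ t ∈ Finset.univ.filter (fun t : H => ¬ (t.1 = 1 ∨ t.1 = -1)), w t.1
      ≠ 0 := by
    refine mul_ne_zero (mul_ne_zero hQ (X_ne_zero 0)) (Finset.prod_ne_zero_iff.2 fun t ht h => ?_)
    refine (Finset.mem_filter.1 ht).2 (eq_one_or_neg_one_of_fixed fun y => ?_)
    rw [← hw, h, map_zero]
  obtain ⟨y, hy⟩ := exists_eval_ne_zero hprod
  rw [map_mul, map_mul, eval_X, map_prod] at hy
  have h1 := left_ne_zero_of_mul hy
  refine ⟨y, ?_, left_ne_zero_of_mul h1, fun t ht hne => ?_⟩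
  · rintro rfl
    exact right_ne_zero_of_mul h1 rfl
  · have h2 := Finset.prod_ne_zero_iff.1 (right_ne_zero_of_mul hy) ⟨t, ht⟩
      (Finset.mem_filter.2 ⟨Finset.mem_univ _, hne⟩)
    rwa [hw] at h2

section covering

variable {d : ℕ} {φ : P1 → P1} {p : Fin 2 → MvPolynomial (Fin 2) ℂ}

/-- The form cutting out the fibre through `y` of the covering given by the forms `p`. -/
def fibreForm (p : Fin 2 → MvPolynomial (Fin 2) ℂ) (y : Fin 2 → ℂ) : MvPolynomial (Fin 2) ℂ :=
  C (eval y (p 1)) * p 0 - C (eval y (p 0)) * p 1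

theorem fibreForm_mem (hp : ∀ i, p i ∈ V d) (y : Fin 2 → ℂ) : fibreForm p y ∈ V d :=
  Submodule.sub_mem _ (C_mul_mem _ (hp 0)) (C_mul_mem _ (hp 1))

/-- Otherwise the map given by `p` would be constant; a zero of `p 0` or of `p 1`, which exists in
positive degree, would produce a common zero, there or at `y`. -/
theorem fibreForm_ne_zero (hd : 0 < d) (hp : ∀ i, p i ∈ V d)
    (hz : ∀ y : Fin 2 → ℂ, y ≠ 0 → ∃ i, eval y (p i) ≠ 0) {y : Fin 2 → ℂ} (hy : y ≠ 0) :
    fibreForm p y ≠ 0 := by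
  intro h
  have hval : ∀ x, eval y (p 1) * eval x (p 0) - eval y (p 0) * eval x (p 1) = 0 := by
    intro x
    have := congrArg (eval x) h
    simpa [fibreForm] using this
  have hz' : ∀ x : Fin 2 → ℂ, x ≠ 0 → ¬ (eval x (p 0) = 0 ∧ eval x (p 1) = 0) := by
    rintro x hx ⟨h0, h1⟩
    obtain ⟨i, hi⟩ := hz x hx
    fin_cases i
    · exact hi h0
    · exact hi h1
  by_cases h1 : eval y (p 1) = 0
  · obtain ⟨x, hx, hx0⟩ := exists_zero_of_pos hd (hp 0)
    have h2 := hval x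
    rw [h1, zero_mul, zero_sub, neg_eq_zero] at h2
    rcases mul_eq_zero.1 h2 with h3 | h3
    · exact hz' y hy ⟨h3, h1⟩
    · exact hz' x hx ⟨hx0, h3⟩
  · obtain ⟨x, hx, hx0⟩ := exists_zero_of_pos hd (hp 1)
    have h2 := hval x
    rw [hx0, mul_zero, sub_zero] at h2
    exact hz' x hx ⟨(mul_eq_zero.1 h2).resolve_left h1, hx0⟩

/-- A form vanishing on the orbit of a point with trivial stabilizer is divisible by the form of
the fibre through this point. -/
theorem exists_fibreForm_mul (hφ : IsGaloisCovering d φ) (hG : deckGroup φ ≤ SO3)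
    (hp : ∀ i, p i ∈ V d)
    (hφp : ∀ (x : Fin 2 → ℂ) (hx : x ≠ 0), ∃ h : (fun i => eval x (p i)) ≠ 0,
        φ (Projectivization.mk ℂ x hx) = Projectivization.mk ℂ (fun i => eval x (p i)) h)
    {y : Fin 2 → ℂ} (hy : y ≠ 0)
    (hfree : ∀ t ∈ binaryGroup (deckGroup φ), ¬ (t = 1 ∨ t = -1) →
      eval (t.1.mulVec y) (wedge y) ≠ 0)
    {m : ℕ} {P : MvPolynomial (Fin 2) ℂ} (hP : P ∈ V m)
    (hvan : ∀ t ∈ binaryGroup (deckGroup φ), eval (t.1.mulVec y) P = 0) :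
    ∃ R ∈ V (m - d), P = fibreForm p y * R ∧ (R ≠ 0 → d ≤ m) := by
  obtain ⟨hd, -, hcard⟩ := hφ
  have hfin : Finite (deckGroup φ) := Nat.finite_of_card_ne_zero (by omega)
  have : Fintype (deckGroup φ) := Fintype.ofFinite _
  by_cases hP0 : P = 0
  · exact ⟨0, Submodule.zero_mem _, by rw [hP0, mul_zero], fun h => absurd rfl h⟩
  have hlift : ∀ σ : deckGroup φ, ∃ t ∈ binaryGroup (deckGroup φ), moebius t = σ.1 := by
    intro σ
    obtain ⟨t, ht, hσ⟩ := hG σ.2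
    refine ⟨t, ⟨ht, ?_⟩, hσ⟩
    change moebius t ∈ deckGroup φ
    rw [hσ]
    exact σ.2
  choose t ht htσ using hlift
  have hpair : ∀ σ ∈ (Finset.univ : Finset (deckGroup φ)), ∀ τ ∈ Finset.univ, σ ≠ τ →
      eval ((t σ).1.mulVec y) (wedge ((t τ).1.mulVec y)) ≠ 0 := by
    intro σ _ τ _ hne
    have h1 : (t σ).1.mulVec y = (t τ).1.mulVec (((t τ)⁻¹ * t σ : SL(2, ℂ)).1.mulVec y) := by
      rw [Matrix.mulVec_mulVec, ← Matrix.SpecialLinearGroup.coe_mul, mul_inv_cancel_left]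
    rw [h1, eval_mulVec_wedge_mulVec]
    refine hfree _ (mul_mem (inv_mem (ht τ)) (ht σ)) fun h2 => hne ?_
    have h3 : moebius ((t τ)⁻¹ * t σ) = 1 := by
      rcases h2 with h2 | h2 <;> rw [h2]
      · exact map_one _
      · exact moebius_neg_one
    rw [map_mul, map_inv, inv_mul_eq_one, htσ, htσ] at h3
    exact (Subtype.ext h3).symm
  have hne : ∀ σ ∈ (Finset.univ : Finset (deckGroup φ)), (t σ).1.mulVec y ≠ 0 :=
    fun σ _ => mulVec_ne_zero _ hy
  have hcard' : (Finset.univ : Finset (deckGroup φ)).card = d := by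
    rw [Finset.card_univ, ← Nat.card_eq_fintype_card, hcard]
  have hz : ∀ y : Fin 2 → ℂ, y ≠ 0 → ∃ i, eval y (p i) ≠ 0 := fun y hy =>
    Function.ne_iff.1 (hφp y hy).1
  have hf0 := fibreForm_ne_zero hd hp hz hy
  -- The orbit of `y` has `d` distinct points, and `d` is the degree of the fibre form. Hence that
  -- form is a constant times the product of the linear forms of the orbit, and the product divides
  -- `P`.
  obtain ⟨-, r, hr, hfr⟩ := exists_prod_wedge_mul Finset.univ _ hne hpair (fibreForm_mem hp y) hf0
    (fun σ _ => by
      obtain ⟨k, -, hk⟩ := exists_semiinvariant hp hφp (ht σ)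
      have h1 : ∀ i, eval ((t σ).1.mulVec y) (p i) = k * eval y (p i) := by
        intro i
        rw [← eval_subst, hk, map_mul, eval_C]
      simp only [fibreForm, map_sub, map_mul, eval_C, h1]
      ring)
  obtain ⟨hdm, R, hR, hPR⟩ := exists_prod_wedge_mul Finset.univ _ hne hpair hP hP0
    (fun σ _ => hvan _ (ht σ))
  rw [hcard'] at hdm hR hr
  rw [Nat.sub_self] at hr
  obtain ⟨k, rfl⟩ := mem_of_degree_zero hr
  have hk : k ≠ 0 := by
    rintro rfl
    exact hf0 (by rw [hfr, C_0, mul_zero])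
  refine ⟨C k⁻¹ * R, C_mul_mem _ hR, ?_, fun _ => hdm⟩
  have hkk : (C k * C k⁻¹ : MvPolynomial (Fin 2) ℂ) = 1 := by
    rw [← C_mul, mul_inv_cancel₀ hk, C_1]
  rw [hfr, hPR]
  linear_combination (-(∏ σ, wedge ((t σ).1.mulVec y)) * R) * hkk

/-- The forms of degree `m` with a given character under the binary covering group are, up to a
common factor, forms in the two forms that define the covering. -/
theorem exists_semiinvariant_generator (hφ : IsGaloisCovering d φ) (hG : deckGroup φ ≤ SO3)
    (hp : ∀ i, p i ∈ V d)
    (hφp : ∀ (x : Fin 2 → ℂ) (hx : x ≠ 0), ∃ h : (fun i => eval x (p i)) ≠ 0,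
        φ (Projectivization.mk ℂ x hx) = Projectivization.mk ℂ (fun i => eval x (p i)) h)
    (m : ℕ) : ∀ χ : SL(2, ℂ) → ℂ, ∃ (θ : MvPolynomial (Fin 2) ℂ) (k : ℕ), ∀ P ∈ V m,
      (∀ t ∈ binaryGroup (deckGroup φ), subst t.1 P = C (χ t) * P) →
      ∃ A ∈ V k, P = θ * aeval p A := by
  have hd := hφ.1
  have hfin : Finite (deckGroup φ) := Nat.finite_of_card_ne_zero (by rw [hφ.2.2]; omega)
  have hfinH := finite_binaryGroup (deckGroup φ)
  have hz : ∀ y : Fin 2 → ℂ, y ≠ 0 → ∃ i, eval y (p i) ≠ 0 := fun y hy =>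
    Function.ne_iff.1 (hφp y hy).1
  have hcφ : ∀ t : SL(2, ℂ), ∃ k : ℂ, t ∈ binaryGroup (deckGroup φ) →
      k ≠ 0 ∧ ∀ i, subst t.1 (p i) = C k * p i := by
    intro t
    by_cases ht : t ∈ binaryGroup (deckGroup φ)
    · obtain ⟨k, hk⟩ := exists_semiinvariant hp hφp ht
      exact ⟨k, fun _ => hk⟩
    · exact ⟨0, fun h => absurd h ht⟩
  choose κ hκ using hcφ
  have hsC : ∀ (B : Matrix (Fin 2) (Fin 2) ℂ) (k : ℂ), subst B (C k) = C k := fun B k =>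
    (subst B).commutes k
  -- division of two semi-invariants with the same character
  have hdiv : ∀ (m : ℕ) (χ : SL(2, ℂ) → ℂ) (P Q : MvPolynomial (Fin 2) ℂ), P ∈ V m → Q ∈ V m →
      (∀ t ∈ binaryGroup (deckGroup φ), subst t.1 P = C (χ t) * P) →
      (∀ t ∈ binaryGroup (deckGroup φ), subst t.1 Q = C (χ t) * Q) → Q ≠ 0 →
      ∃ (α a b : ℂ) (R : MvPolynomial (Fin 2) ℂ), R ∈ V (m - d) ∧ (R ≠ 0 → d ≤ m) ∧
        (∀ t ∈ binaryGroup (deckGroup φ), subst t.1 R = C (χ t / κ t) * R) ∧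
        P = C α * Q + (C a * p 0 + C b * p 1) * R := by
    intro m χ P Q hP hQ hPχ hQχ hQ0
    -- The combination `Q(y) P - P(y) Q` is a semi-invariant vanishing at `y`, hence on its free
    -- orbit, and is divisible by the form of the fibre through `y`. The quotient `R` has character
    -- `χ / κ`, where `κ` is the character of `p`.
    obtain ⟨y, hy, hyQ, hfree⟩ := exists_free_point (H := binaryGroup (deckGroup φ)) hQ0
    have hsemi : ∀ t ∈ binaryGroup (deckGroup φ), subst t.1 (C (eval y Q) * P - C (eval y P) * Q) =
        C (χ t) * (C (eval y Q) * P - C (eval y P) * Q) := by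
      intro t ht
      rw [map_sub, map_mul, map_mul, hsC, hsC, hPχ t ht, hQχ t ht]
      ring
    obtain ⟨R, hR, hPR, hRd⟩ := exists_fibreForm_mul hφ hG hp hφp hy hfree
      (P := C (eval y Q) * P - C (eval y P) * Q)
      (Submodule.sub_mem _ (C_mul_mem _ hP) (C_mul_mem _ hQ)) (fun t ht => by
        rw [← eval_subst, hsemi t ht]
        simp only [map_mul, map_sub, eval_C]
        ring)
    have hf0 := fibreForm_ne_zero hd hp hz hy
    have hRχ : ∀ t ∈ binaryGroup (deckGroup φ), subst t.1 R = C (χ t / κ t) * R := by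
      intro t ht
      obtain ⟨hκ0, hκt⟩ := hκ t ht
      have h1 : subst t.1 (fibreForm p y) = C (κ t) * fibreForm p y := by
        simp only [fibreForm, map_sub, map_mul, hsC, hκt]
        ring
      have h2 := hsemi t ht
      rw [hPR, map_mul, h1] at h2
      have hκC : (C (κ t) : MvPolynomial (Fin 2) ℂ) ≠ 0 := by rwa [Ne, C_eq_zero]
      apply mul_left_cancel₀ (mul_ne_zero hκC hf0)
      have h3 : (C (χ t / κ t) * C (κ t) : MvPolynomial (Fin 2) ℂ) = C (χ t) := by
        rw [← C_mul, div_mul_cancel₀ _ hκ0]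
      linear_combination h2 - (fibreForm p y * R) * h3
    have hinv : (C (eval y Q) * C (eval y Q)⁻¹ : MvPolynomial (Fin 2) ℂ) = 1 := by
      rw [← C_mul, mul_inv_cancel₀ hyQ, C_1]
    refine ⟨eval y P * (eval y Q)⁻¹, eval y (p 1) * (eval y Q)⁻¹, -eval y (p 0) * (eval y Q)⁻¹, R,
      hR, hRd, hRχ, ?_⟩
    simp only [C_mul, C_neg]
    rw [fibreForm] at hPR
    linear_combination C (eval y Q)⁻¹ * hPR - P * hinv
  induction m using Nat.strong_induction_on with
  | _ m ih =>
  intro χ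
  by_cases hM : ∃ r ∈ V (m - d), d ≤ m ∧ r ≠ 0 ∧
      ∀ t ∈ binaryGroup (deckGroup φ), subst t.1 r = C (χ t / κ t) * r
  · obtain ⟨r, hr, hdm, hr0, hrχ⟩ := hM
    obtain ⟨θ, k, hθ⟩ := ih (m - d) (by omega) (fun t => χ t / κ t)
    obtain ⟨A₀, hA₀, hrA⟩ := hθ r hr hrχ
    obtain ⟨i, hi⟩ := hz ![1, 0] (fun h => by simpa using congrFun h 0)
    have hpi : p i ≠ 0 := fun h => hi (by rw [h, map_zero])
    refine ⟨θ, 1 + k, fun P hP hPχ => ?_⟩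
    obtain ⟨α, a, b, R, hR, -, hRχ, hPR⟩ := hdiv m χ P (p i * r) hP
      (by simpa [Nat.add_sub_cancel' hdm] using mul_mem_add (hp i) hr) hPχ
      (fun t ht => by
        obtain ⟨hκ0, hκt⟩ := hκ t ht
        rw [map_mul, hκt, hrχ t ht]
        have h3 : (C (χ t / κ t) * C (κ t) : MvPolynomial (Fin 2) ℂ) = C (χ t) := by
          rw [← C_mul, div_mul_cancel₀ _ hκ0]
        linear_combination (p i * r) * h3) (mul_ne_zero hpi hr0)
    obtain ⟨A, hA, hRA⟩ := hθ R hR hRχ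
    refine ⟨C α * (X i * A₀) + (C a * X 0 + C b * X 1) * A, Submodule.add_mem _
      (C_mul_mem _ (mul_mem_add (isHomogeneous_X ℂ i) hA₀))
      (mul_mem_add (Submodule.add_mem _ (C_mul_mem _ (isHomogeneous_X ℂ 0))
        (C_mul_mem _ (isHomogeneous_X ℂ 1))) hA), ?_⟩
    rw [hPR]
    nth_rewrite 1 [hrA]
    nth_rewrite 1 [hRA]
    simp only [map_add, map_mul, aeval_X, algHom_C, algebraMap_eq]
    ring
  · by_cases hQ : ∃ Q ∈ V m, Q ≠ 0 ∧
        ∀ t ∈ binaryGroup (deckGroup φ), subst t.1 Q = C (χ t) * Q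
    · obtain ⟨Q, hQ, hQ0, hQχ⟩ := hQ
      refine ⟨Q, 0, fun P hP hPχ => ?_⟩
      obtain ⟨α, a, b, R, hR, hRd, hRχ, hPR⟩ := hdiv m χ P Q hP hQ hPχ hQχ hQ0
      have hR0 : R = 0 := by
        by_contra h
        exact hM ⟨R, hR, hRd h, h, hRχ⟩
      refine ⟨C α, isHomogeneous_C _ _, ?_⟩
      rw [hPR, hR0, algHom_C, algebraMap_eq]
      ring
    · refine ⟨0, 0, fun P hP hPχ => ⟨0, Submodule.zero_mem _, ?_⟩⟩
      by_contra h
      exact hQ ⟨P, hP, fun h0 => h (by rw [h0]; simp), hPχ⟩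

end covering

/-! ### The curve of a pair of eigenvectors -/

/-- A one-dimensional `σ` is a character `χ`. The vectors on which `ρ t` acts as `χ t` form a
submodule containing every copy of `σ`, hence their sum. -/
theorem exists_character_isotypic {H U W : Type*} [Group H] [AddCommMonoid U] [Module ℂ U]
    [AddCommGroup W] [Module ℂ W] (ρ : Representation ℂ H U) (σ : Representation ℂ H W)
    (hW : Module.finrank ℂ W = 1) :
    ∃ χ : H → ℂ, ∀ v ∈ isotypic ρ σ, ∀ t, ρ t v = χ t • v := by
  obtain ⟨w, hw0, hw⟩ := finrank_eq_one_iff'.1 hW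
  choose χ hχ using fun t => hw (σ t w)
  have hσ : ∀ t w', σ t w' = χ t • w' := by
    intro t w'
    obtain ⟨k, rfl⟩ := hw w'
    rw [map_smul, ← hχ, smul_comm]
  refine ⟨χ, fun v hv t => ?_⟩
  have hle : isotypic ρ σ ≤ LinearMap.eqLocus (ρ t) (χ t • LinearMap.id) := by
    refine iSup₂_le fun S hS v hv => ?_
    obtain ⟨f⟩ := hS
    have h1 : f.toLinearEquiv (S.toRepresentation t ⟨v, hv⟩) = f.toLinearEquiv (χ t • ⟨v, hv⟩) := by
      rw [map_smul, ← hσ]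
      exact LinearMap.congr_fun (f.isIntertwining' t) ⟨v, hv⟩
    exact congrArg Subtype.val (f.toLinearEquiv.injective h1)
  exact hle hv

/-- Removing the common factors of a matrix of forms. -/
theorem exists_reduced {n : ℕ} (a b c e : V n) (h : ∃ x, formMatrix a b c e x ≠ 0) :
    ∃ (k : ℕ) (a' b' c' e' : V k) (γ : MvPolynomial (Fin 2) ℂ), γ ≠ 0 ∧
      (∀ x, formMatrix a b c e x = eval x γ • formMatrix a' b' c' e' x) ∧
      ∀ x, x ≠ 0 → formMatrix a' b' c' e' x ≠ 0 := by
  obtain ⟨x₀, hx₀⟩ := h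
  let m : Fin 4 → MvPolynomial (Fin 2) ℂ := ![a.1, b.1, c.1, e.1]
  have hm : ∀ i, m i ∈ V n := by
    intro i
    fin_cases i
    exacts [a.2, b.2, c.2, e.2]
  obtain ⟨k, γ, q, hγ, hq, hmq, hz⟩ := exists_common_factor m hm (by
    by_contra! h
    apply hx₀
    have h0 : a.1 = 0 := h 0
    have h1 : b.1 = 0 := h 1
    have h2 : c.1 = 0 := h 2
    have h3 : e.1 = 0 := h 3
    ext i j
    fin_cases i <;> fin_cases j <;> simp [formMatrix, h0, h1, h2, h3])
  refine ⟨k, ⟨q 0, hq 0⟩, ⟨q 1, hq 1⟩, ⟨q 2, hq 2⟩, ⟨q 3, hq 3⟩, γ, hγ, fun x => ?_, fun x hx h => ?_⟩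
  · have h0 : a.1 = γ * q 0 := hmq 0
    have h1 : b.1 = γ * q 1 := hmq 1
    have h2 : c.1 = γ * q 2 := hmq 2
    have h3 : e.1 = γ * q 3 := hmq 3
    ext i j
    fin_cases i <;> fin_cases j <;> simp [formMatrix, h0, h1, h2, h3]
  · obtain ⟨i, hi⟩ := hz x hx
    apply hi
    fin_cases i
    · exact congrFun (congrFun h 0) 0
    · exact congrFun (congrFun h 0) 1
    · exact congrFun (congrFun h 1) 0
    · exact congrFun (congrFun h 1) 1

theorem exists_isGivenBy {n : ℕ} (a b c e : V n) (h : ∀ x, x ≠ 0 → formMatrix a b c e x ≠ 0) :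
    ∃ g : P1 → P3, IsCurve g ∧ IsGivenBy g a b c e := by
  let m : Fin 2 × Fin 2 → MvPolynomial (Fin 2) ℂ := fun ij =>
    (![![a.1, b.1], ![c.1, e.1]] : Fin 2 → Fin 2 → _) ij.1 ij.2
  obtain ⟨g, hg, hg'⟩ := exists_morphism (m := n) (formMatrix a b c e)
    (exists_form_of_dual (Matrix.stdBasis ℂ (Fin 2) (Fin 2)) _ m (by
      rintro ⟨i, j⟩
      fin_cases i <;> fin_cases j
      exacts [a.2, b.2, c.2, e.2]) (by
      rintro x ⟨i, j⟩
      have h1 : ∀ M : Matrix (Fin 2) (Fin 2) ℂ,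
          (Matrix.stdBasis ℂ (Fin 2) (Fin 2)).repr M (i, j) = M i j := fun M => rfl
      rw [h1]
      fin_cases i <;> fin_cases j <;> rfl)) h
  exact ⟨g, ⟨n, hg⟩, fun x hx => ⟨h x hx, hg' x hx⟩⟩

/-- A curve is determined by its composition with a covering. -/
theorem eq_of_commutes {d n : ℕ} (hd : 0 < d) {φ : P1 → P1} (hφ : IsMorphismOfDegree d φ)
    {g : P1 → P3} {a b c e : V n} (hg : IsGivenBy g a b c e) {F F' : P1 → P6} (hF : IsCurve F)
    (hF' : IsCurve F') (hc : Commutes φ g F) (hc' : Commutes φ g F') : F = F' := by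
  obtain ⟨_, hF⟩ := hF
  obtain ⟨_, hF'⟩ := hF'
  obtain ⟨A, -, hFA⟩ := exists_forms hF
  obtain ⟨B, -, hFB⟩ := exists_forms hF'
  obtain ⟨p, -, hφp⟩ := exists_forms hφ
  obtain ⟨x₀, hx₀⟩ := exists_f₁_ne_zero hg hc
  obtain ⟨l, hl⟩ := Function.ne_iff.1 hx₀
  obtain ⟨ψ, -, hψ⟩ := exists_f₁_formMatrix a b c e
  have hψl : ψ l ≠ 0 := fun h => hl (by rw [← hψ, h, map_zero]; rfl)
  -- The cross relations between `F` and `F'`, pulled back by the covering, hold wherever `f₁ ∘ g`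
  -- is defined. Multiplied by the nonzero form `ψ l * X 0` they vanish at every point, so they are
  -- polynomial identities.
  have key : ∀ i j, aeval p (A i * B j - A j * B i) = (0 : MvPolynomial (Fin 2) ℂ) := by
    intro i j
    refine (mul_eq_zero.1 (eq_zero_of_eval (p := aeval p (A i * B j - A j * B i) * (ψ l * X 0))
      fun x => ?_)).resolve_right (mul_ne_zero hψl (X_ne_zero 0))
    rw [map_mul, map_mul, hψ, eval_X]
    by_cases hx : x = 0
    · simp [hx]
    by_cases hf : f₁ (formMatrix a b c e x) = 0
    · simp [hf]
    have h1 := apply_eq_mk_f₁ hg hc x hx hf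
    rw [← apply_eq_mk_f₁ hg hc' x hx hf] at h1
    obtain ⟨h2, h3⟩ := hφp x hx
    obtain ⟨h4, h5⟩ := hFA _ h2
    obtain ⟨h6, h7⟩ := hFB _ h2
    rw [h3, h5, h7] at h1
    have h8 := mul_eq_mul_of_mk_eq h1 i j
    rw [eval_aeval_forms, map_sub, map_mul, map_mul, h8, sub_self, zero_mul]
  funext P
  obtain ⟨Q, rfl⟩ := surjective_of_isMorphismOfDegree hd hφ P
  induction Q using Projectivization.ind with
  | h x hx =>
    obtain ⟨h2, h3⟩ := hφp x hx
    obtain ⟨h4, h5⟩ := hFA _ h2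
    obtain ⟨h6, h7⟩ := hFB _ h2
    rw [h3, h5, h7]
    refine mk_eq_mk_of_mul_eq h4 h6 fun i j => ?_
    have h8 := congrArg (eval x) (key i j)
    rw [eval_aeval_forms, map_sub, map_mul, map_mul, map_zero] at h8
    exact sub_eq_zero.1 h8

/-- The form-valued map `f₁` along equivariant rows is semi-invariant. -/
theorem exists_f₁_semiinvariant {n : ℕ} {H : Subgroup SL(2, ℂ)} (φ₂ : H →* binaryOctahedral)
    {a b c e : V n} {χ : H → ℂ} (h1 : ∀ t, tensorRep n φ₂ t (row a b) = χ t • row a b)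
    (h2 : ∀ t, tensorRep n φ₂ t (row c e) = χ t • row c e) {t : SL(2, ℂ)} (ht : t ∈ H) :
    ∃ k : ℂ, ∀ x, f₁ (formMatrix a b c e (t.1.mulVec x)) = k • f₁ (formMatrix a b c e x) := by
  let u : H := ⟨t, ht⟩
  -- Equivariance is used for `t⁻¹` so that `t` itself acts on the argument. The factor `χ⁶` below
  -- comes from the degree of `f₁`.
  have h3 := (eigen_rows_iff (u⁻¹).1 (φ₂ u⁻¹).1 a b c e (χ u⁻¹)).1 ⟨h1 u⁻¹, h2 u⁻¹⟩
  let s : SL(2, ℂ) := (φ₂ u⁻¹).1.transpose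
  have hs : s ∈ binaryOctahedral := transpose_mem_binaryOctahedral (φ₂ u⁻¹).2
  obtain ⟨ε, hε⟩ := f₁_mul_of_mem (inv_mem hs)
  refine ⟨ε * χ u⁻¹ ^ 6, fun x => ?_⟩
  have h4 : formMatrix a b c e (t.1.mulVec x) * s.1 = χ u⁻¹ • formMatrix a b c e x := by
    have h5 := h3 x
    rwa [show ((u⁻¹).1⁻¹ : SL(2, ℂ)) = t from inv_inv t] at h5
  have h6 : formMatrix a b c e (t.1.mulVec x) =
      (χ u⁻¹ • formMatrix a b c e x) * (s⁻¹ : SL(2, ℂ)).1 := by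
    rw [← h4, mul_assoc, ← Matrix.SpecialLinearGroup.coe_mul, mul_inv_cancel,
      Matrix.SpecialLinearGroup.coe_one, mul_one]
  rw [h6, hε, f₁_smul, smul_smul]

/-- The seven components `ψ i` of `f₁` along the matrix share a character, so `ψ i = θ * aeval p (A
i)` with one factor `θ`. Removing the common factor of the `A i` leaves the forms `B i` that define
`F`. -/
theorem existsUnique_curve {d n : ℕ} {φ : P1 → P1} (hφ : IsGaloisCovering d φ)
    (hG : deckGroup φ ≤ SO3) (φ₂ : binaryGroup (deckGroup φ) →* binaryOctahedral)
    {a b c e : V n} {χ : binaryGroup (deckGroup φ) → ℂ}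
    (h1 : ∀ t, tensorRep n φ₂ t (row a b) = χ t • row a b)
    (h2 : ∀ t, tensorRep n φ₂ t (row c e) = χ t • row c e)
    (hf : ∃ x, f₁ (formMatrix a b c e x) ≠ 0) :
    ∃ g : P1 → P3, IsInducedBy g a b c e ∧ ∃! F : P1 → P6, IsCurve F ∧ Commutes φ g F := by
  obtain ⟨x₀, hx₀⟩ := hf
  obtain ⟨l, hl⟩ := Function.ne_iff.1 hx₀
  have hf0 : f₁ (0 : Matrix (Fin 2) (Fin 2) ℂ) = 0 := by
    have := f₁_smul 0 0
    simpa using this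
  obtain ⟨k, a', b', c', e', γ, hγ, hγM, hM'⟩ := exists_reduced a b c e
    ⟨x₀, fun h => hx₀ (by rw [h, hf0])⟩
  obtain ⟨g, hgc, hg⟩ := exists_isGivenBy a' b' c' e' hM'
  obtain ⟨ψ, hψm, hψ⟩ := exists_f₁_formMatrix a b c e
  obtain ⟨ψ', -, hψ'⟩ := exists_f₁_formMatrix a' b' c' e'
  have hψγ : ∀ i, ψ i = γ ^ 6 * ψ' i := by
    intro i
    refine MvPolynomial.funext fun x => ?_
    rw [hψ, hγM, f₁_smul, Pi.smul_apply, smul_eq_mul, map_mul, map_pow, hψ']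
  have hψl : ψ l ≠ 0 := fun h => hl (by rw [← hψ, h, map_zero]; rfl)
  obtain ⟨p, hp, hφp⟩ := exists_forms hφ.2.1
  -- the components of `f₁` have a common character
  have hχ : ∀ t : SL(2, ℂ), ∃ κ : ℂ, t ∈ binaryGroup (deckGroup φ) → ∀ x,
      f₁ (formMatrix a b c e (t.1.mulVec x)) = κ • f₁ (formMatrix a b c e x) := by
    intro t
    by_cases ht : t ∈ binaryGroup (deckGroup φ)
    · obtain ⟨κ, hκ⟩ := exists_f₁_semiinvariant φ₂ h1 h2 ht
      exact ⟨κ, fun _ => hκ⟩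
    · exact ⟨0, fun h => absurd h ht⟩
  choose κ hκ using hχ
  obtain ⟨θ, r, hθ⟩ := exists_semiinvariant_generator hφ hG hp hφp (6 * n) κ
  choose A hA hψA using fun i => hθ (ψ i) (hψm i) (fun t ht => MvPolynomial.funext fun x => by
    rw [eval_subst, hψ, hκ t ht, Pi.smul_apply, smul_eq_mul, map_mul, eval_C, hψ])
  obtain ⟨r', δ, B, hδ, hB, hAB, hBz⟩ := exists_common_factor A hA
    ⟨l, fun h => hψl (by rw [hψA, h, map_zero, mul_zero])⟩
  have hB0 : ∀ y : Fin 2 → ℂ, y ≠ 0 → (fun i => eval y (B i)) ≠ 0 := fun y hy =>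
    Function.ne_iff.2 (hBz y hy)
  obtain ⟨F, hF, hFB⟩ := exists_morphism (m := r') (fun y i => eval y (B i))
    (exists_form_of_dual (Pi.basisFun ℂ (Fin 7)) _ B hB fun x i => rfl) hB0
  have hθδ : θ * aeval p δ ≠ 0 := by
    intro h
    apply hψl
    rw [hψA, hAB, map_mul, ← mul_assoc, h, zero_mul]
  -- Both `aeval p (B i)` and the components `ψ' i` along the reduced matrix are the `ψ i` stripped
  -- of a nonzero common factor, `θ * aeval p δ` and `γ ^ 6`, so they are projectively equal.
  have hprop : ∀ i j, aeval p (B i) * ψ' j = aeval p (B j) * ψ' i := by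
    intro i j
    apply mul_left_cancel₀ (mul_ne_zero hθδ (pow_ne_zero 6 hγ))
    have e : ∀ i, θ * aeval p δ * aeval p (B i) = γ ^ 6 * ψ' i := by
      intro i
      rw [← hψγ, hψA, hAB, map_mul, mul_assoc]
    linear_combination γ ^ 6 * ψ' j * e i - γ ^ 6 * ψ' i * e j
  have hcomm : Commutes φ g F := by
    constructor
    · obtain ⟨x, hx⟩ := exists_eval_ne_zero (mul_ne_zero hψl (X_ne_zero (R := ℂ) (0 : Fin 2)))
      rw [map_mul, eval_X] at hx
      have hx0 : x ≠ 0 := by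
        rintro rfl
        exact right_ne_zero_of_mul hx rfl
      obtain ⟨h3, h4⟩ := hg x hx0
      refine ⟨Projectivization.mk ℂ x hx0, _, h3, h4, fun h => left_ne_zero_of_mul hx ?_⟩
      rw [hψγ, map_mul, hψ', h, Pi.zero_apply, mul_zero]
    · intro P M hM hP hfM
      induction P using Projectivization.ind with
      | h x hx =>
        obtain ⟨h3, h4⟩ := hg x hx
        rw [h4, eq_comm, Projectivization.mk_eq_mk_iff'] at hP
        obtain ⟨q, rfl⟩ := hP
        obtain ⟨h5, h6⟩ := hφp x hx
        rw [h6, hFB _ h5]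
        refine mk_eq_mk_of_mul_eq _ _ fun i j => ?_
        have h7 := congrArg (eval x) (hprop i j)
        rw [map_mul, map_mul, eval_aeval_forms, eval_aeval_forms, hψ', hψ'] at h7
        rw [f₁_smul, Pi.smul_apply, Pi.smul_apply, smul_eq_mul, smul_eq_mul]
        linear_combination q ^ 6 * h7
  refine ⟨g, ⟨hgc, fun x hx h => ?_⟩, F, ⟨⟨r', hF⟩, hcomm⟩, fun F' hF' => ?_⟩
  · obtain ⟨h3, h4⟩ := hg x hx
    rw [h4, eq_comm, Projectivization.mk_eq_mk_iff']
    exact ⟨_, (hγM x).symm⟩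
  · exact eq_of_commutes hφ.1 hφ.2.1 hg hF'.1 ⟨r', hF⟩ hF'.2 hcomm

end

end GaloisLift

end

theorem theorem3p1 (d : ℕ) (φ : P1 → P1)
    (hφ : IsGaloisCovering d φ)
    (hG : deckGroup φ ≤ SO3) (n : ℕ) :
    (∀ (F : P1 → P6) (g : P1 → P3)
        (a b c e : V n),
        IsSexticCurve F →
        (¬ ∀ p, F p ∈ closedTwoDimOrbit) →
        IsGivenBy g a b c e →
        IsGaloisLift φ g F →
        ∃ φ₂ : binaryGroup (deckGroup φ) →* binaryOctahedral,
          Function.Injective φ₂ ∧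
          ∃ U₁ U₂ : Subrepresentation (tensorRep n φ₂),
            U₁.toSubmodule = Submodule.span ℂ {row a b} ∧
            U₂.toSubmodule = Submodule.span ℂ {row c e} ∧
            IsOneDimIrreducible U₁ ∧
            IsOneDimIrreducible U₂ ∧
            Nonempty (U₁.toRepresentation.Equiv U₂.toRepresentation) ∧
            LinearIndependent ℂ ![row a b, row c e]) ∧
    (∀ (φ₂ : binaryGroup (deckGroup φ) →* binaryOctahedral)
        (W : Type*) [AddCommGroup W] [Module ℂ W]
        (σ : Representation ℂ (binaryGroup (deckGroup φ)) W)
        (a b c e : V n),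
        Module.finrank ℂ W = 1 →
        row a b ∈ isotypic (tensorRep n φ₂) σ →
        row c e ∈ isotypic (tensorRep n φ₂) σ →
        LinearIndependent ℂ ![row a b, row c e] →
        (∃ x, f₁ (formMatrix a b c e x) ≠ 0) →
        ∃ g : P1 → P3, IsInducedBy g a b c e ∧
          ∃! F : P1 → P6,
            IsCurve F ∧ Commutes φ g F) := by
  refine ⟨fun F g a b c e hF hF2 hg hl => exists_eigenrows_of_isGaloisLift hφ hF.1 hF2 hg hl, ?_⟩
  intro φ₂ W _ _ σ a b c e hW h1 h2 _ hf
  obtain ⟨χ, hχ⟩ := exists_character_isotypic (tensorRep n φ₂) σ hW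
  exact existsUnique_curve hφ hG φ₂ (hχ _ h1) (hχ _ h2) hf
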